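/- Let $n_X,n_Y\ge 1$, let $S$ be a homogeneous polynomial on $\mathbb R^{n_X}\times\mathbb R^{n_Y}$ with real coefficients, of degree $d>n_X+n_Y$, satisfying the rank one condition: the system $\partial_{x_i}\partial_{y_j}S(x,y)=0$ ($1\le i\le n_X$, $1\le j\le n_Y$) has no solution $(x,y)\neq(0,0)$. Let $D$ be a homogeneous polynomial on $\mathbb R^{n_X}\times\mathbb R^{n_Y}$ with real coefficients, of degree $d_D\ge 1$, that does not vanish away from the origin, and let $\varphi\in C_c^\infty(\mathbb R^{n_X}\times\mathbb R^{n_Y})$. For real $\lambda\ne0$ and $z\in\mathbb C$ put $$W_{\lambda,D}^zf(x)=\int_{\mathbb R^{n_Y}}e^{i\lambda S(x,y)}|D(x,y)|^z\varphi(x,y)f(y)\,dy,$$ let $\sigma_0=\frac{d-n_X-n_Y}{2d_D}$, and let $\|\cdot\|_2$ be the operator norm from $L^2(\mathbb R^{n_Y})$ to $L^2(\mathbb R^{n_X})$. Then for all $\delta>0$ and $M\in\mathbb R$ there is a constant $C=C(S,D,\varphi,\delta,M)$, independent of $\lambda$ and $z$, such that for all real $\lambda\neq0$ and all $z\in\mathbb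 C$ the operator $W^z_{\lambda,D}$ is well defined (for $f\in L^2(\mathbb R^{n_Y})$ the integral converges absolutely for almost every $x$) and bounded, with $$\|W_{\lambda,D}^z\|_2\le C(1+|z|)^2\begin{cases}|\lambda|^{-1/2}, & \sigma_0+\delta\le\operatorname{Re}z\le M,\\ |\lambda|^{-1/2}\log(2+|\lambda|), & \operatorname{Re}z=\sigma_0,\\ |\lambda|^{-\frac{d_D}{d}\operatorname{Re}z-\frac{n_X+n_Y}{2d}}, & -\frac{\min\{n_X,n_Y\}}{d_D}<\operatorname{Re}z\le\sigma_0-\delta,\end{cases}$$ whenever $\operatorname{Re} z$ lies in one of these three ranges. In particular the three bounds hold for all $z$ with $\operatorname{Re}z>\sigma_0$, $\operatorname{Re}z=\sigma_0$, and $-\min\{n_X,n_Y\}/d_D<\operatorname{Re}z<\sigma_0$ respectively, with a constant that depends on $z$ only through $\operatorname{Re}z$. -/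

import Mathlib

open MeasureTheory
open scoped ContDiff

noncomputable section

namespace DampedOIO

/-- The value at `(x, y) ∈ ℝ^{n_X} × ℝ^{n_Y}` of a real polynomial in the variables
`x_i` (`Sum.inl i`) and `y_j` (`Sum.inr j`). -/
def polyEval {nX nY : ℕ} (P : MvPolynomial (Fin nX ⊕ Fin nY) ℝ)
    (x : Fin nX → ℝ) (y : Fin nY → ℝ) : ℝ :=
  MvPolynomial.eval (Sum.elim x y) P

/-- The rank one condition: the system `∂_{x_i} ∂_{y_j} S (x, y) = 0` (all `i`, `j`) has no
solution other than the origin. -/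
def RankOne {nX nY : ℕ} (S : MvPolynomial (Fin nX ⊕ Fin nY) ℝ) : Prop :=
  ∀ (x : Fin nX → ℝ) (y : Fin nY → ℝ),
    (∀ (i : Fin nX) (j : Fin nY),
      polyEval (MvPolynomial.pderiv (Sum.inl i) (MvPolynomial.pderiv (Sum.inr j) S)) x y = 0) →
    x = 0 ∧ y = 0

/-- `P` has no real zero other than the origin. -/
def NonvanishingAwayFromOrigin {nX nY : ℕ} (P : MvPolynomial (Fin nX ⊕ Fin nY) ℝ) : Prop :=
  ∀ (x : Fin nX → ℝ) (y : Fin nY → ℝ), polyEval P x y = 0 → x = 0 ∧ y = 0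

/-- The kernel `e^{iλS(x,y)} |D(x,y)|^z φ(x,y)`. -/
def dampedKernel {nX nY : ℕ} (S D : MvPolynomial (Fin nX ⊕ Fin nY) ℝ)
    (φ : (Fin nX → ℝ) × (Fin nY → ℝ) → ℂ) (lam : ℝ) (z : ℂ)
    (x : Fin nX → ℝ) (y : Fin nY → ℝ) : ℂ :=
  Complex.exp (Complex.I * ((lam * polyEval S x y : ℝ) : ℂ)) *
    ((|polyEval D x y| : ℝ) : ℂ) ^ z * φ (x, y)

/-- The damped oscillatory integral operator
`f ↦ (x ↦ ∫ e^{iλS(x,y)} |D(x,y)|^z φ(x,y) f(y) dy)`. -/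
def dampedOp {nX nY : ℕ} (S D : MvPolynomial (Fin nX ⊕ Fin nY) ℝ)
    (φ : (Fin nX → ℝ) × (Fin nY → ℝ) → ℂ) (lam : ℝ) (z : ℂ)
    (f : (Fin nY → ℝ) → ℂ) (x : Fin nX → ℝ) : ℂ :=
  ∫ y, dampedKernel S D φ lam z x y * f y

/-- The damped operator is well defined and bounded from `L²(ℝ^{n_Y})` to `L²(ℝ^{n_X})` (Lebesgue
measure), with operator norm at most `A`: for every `f ∈ L²` the defining integral converges
absolutely for almost every `x`, the resulting function is in `L²`, and its norm is at most
`A` times that of `f`. -/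
def DampedNormLE {nX nY : ℕ} (S D : MvPolynomial (Fin nX ⊕ Fin nY) ℝ)
    (φ : (Fin nX → ℝ) × (Fin nY → ℝ) → ℂ) (lam : ℝ) (z : ℂ) (A : ℝ) : Prop :=
  ∀ f : (Fin nY → ℝ) → ℂ, MemLp f 2 volume →
    (∀ᵐ x : Fin nX → ℝ, Integrable (fun y => dampedKernel S D φ lam z x y * f y)) ∧
    MemLp (dampedOp S D φ lam z f) 2 volume ∧
    eLpNorm (dampedOp S D φ lam z f) 2 volume ≤ ENNReal.ofReal A * eLpNorm f 2 volume

/-- The critical exponent `(d - n_X - n_Y) / (2 d_D)`. -/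
def critExp (nX nY d dD : ℕ) : ℝ := ((d : ℝ) - nX - nY) / (2 * dD)

end DampedOIO

end

noncomputable section

namespace DampedOIO

open scoped ComplexConjugate Manifold

/-! ### Cauchy–Schwarz and Schur's test -/

section General

variable {X Y : Type*} [MeasurableSpace X] [MeasurableSpace Y]

/-! The kernel is cut into dyadic shells `‖(x, y)‖ ~ r`, with `r = R / 2 ^ k`, and each shell is
estimated by oscillation. What is left near the origin is estimated by size alone. Write `m`, `n`
for the two dimensions.

Oscillation: dilating a shell to unit size turns the frequency `λ` into `λ r ^ d` and extracts the
factor `r ^ (dD z)`, by homogeneity (`dampedKernel_smul`, `KernelNormLE.of_scaled`). On the unit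
annulus, compactness and the rank one condition give finitely many balls, on each of which one mixed
derivative `∂_{x_i} ∂_{y_j} S` and the polynomial `D` are both nonzero (`exists_annulus_partition`).
With all other variables frozen, the operator in `(x_i, y_j)` is a one-dimensional oscillatory
operator. The `T T*` method and two integrations by parts bound it by `|μ| ^ (-1/2)`
(`kernelNormLE_oscillatory`), and the frozen variables cost only the volume of the box
(`KernelNormLE.of_slices`). Up to two derivatives fall on `|D| ^ z`, hence the factor `(1 + ‖z‖) ^
2`. Undoing the dilation, a shell contributes `|λ| ^ (-1/2) * r ^ β` with `β = dD * (Re z - σ₀)`.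

Size: `|D|` is comparable to the `dD`-th power of the norm. On a ball of radius `ρ` the kernel is
therefore at most a constant times `ρ ^ γ * max ‖x‖ ‖y‖ ^ (-(m + n) / 2)`, with `γ = dD * Re z + (m
+ n) / 2 ≥ 0`. The homogeneous kernel is bounded on `L²` by Schur's test
(`exists_kernelNormLE_of_norm_le`).

The shells stop at `r ~ |λ| ^ (-1/d)`, where the two bounds agree because `γ = d / 2 + β`. For `β >
0` the sum over shells is a convergent geometric series. For `β = 0` it counts the shells, which
gives the logarithm. For `β < 0` the smallest shell dominates. The sums are controlled uniformly in
`z` because `|β| ≥ dD * δ` off the critical line. -/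

theorem lintegral_mul_sq_le (μ : Measure X) {f g : X → ENNReal} (hf : AEMeasurable f μ)
    (hg : AEMeasurable g μ) :
    (∫⁻ x, f x * g x ∂μ) ^ 2 ≤ (∫⁻ x, f x ^ 2 ∂μ) * ∫⁻ x, g x ^ 2 ∂μ := by
  have h := ENNReal.lintegral_mul_le_Lp_mul_Lq μ Real.HolderConjugate.two_two hf hg
  simp only [Pi.mul_apply, ENNReal.rpow_two] at h
  have h2 := pow_le_pow_left₀ zero_le h 2
  have key : ∀ a : ENNReal, (a ^ (1 / 2 : ℝ)) ^ 2 = a := fun a => by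
    rw [← ENNReal.rpow_natCast, ← ENNReal.rpow_mul]; norm_num
  rwa [mul_pow, key, key] at h2

/-- Schur's test for nonnegative kernels. -/
theorem lintegral_schur_test (μ : Measure X) (ν : Measure Y) [SFinite μ] [SFinite ν]
    {K : X → Y → ENNReal} (hK : Measurable (Function.uncurry K))
    {v : X → ENNReal} (hv : Measurable v) {w : Y → ENNReal} (hw : Measurable w)
    (hw0 : ∀ᵐ y ∂ν, w y ≠ 0 ∧ w y ≠ ⊤) {A B : ENNReal}
    (hA : ∀ᵐ x ∂μ, ∫⁻ y, K x y * w y ∂ν ≤ A * v x)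
    (hB : ∀ᵐ y ∂ν, ∫⁻ x, K x y * v x ∂μ ≤ B * w y)
    {f : Y → ENNReal} (hf : Measurable f) :
    ∫⁻ x, (∫⁻ y, K x y * f y ∂ν) ^ 2 ∂μ ≤ A * B * ∫⁻ y, f y ^ 2 ∂ν := by
  have hKx : ∀ x, Measurable (K x) := fun x => hK.comp measurable_prodMk_left
  have hKy : ∀ y, Measurable fun x => K x y := fun y => hK.comp measurable_prodMk_right
  have hroot : ∀ a : ENNReal, (a ^ (1 / 2 : ℝ)) ^ 2 = a := fun a => by
    rw [← ENNReal.rpow_natCast, ← ENNReal.rpow_mul]; norm_num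
  have h1 : ∀ᵐ x ∂μ, (∫⁻ y, K x y * f y ∂ν) ^ 2 ≤
      A * v x * ∫⁻ y, K x y * ((w y)⁻¹ * f y ^ 2) ∂ν := by
    filter_upwards [hA] with x hx
    -- Write `K f = (K w)^{1/2} · (K / w)^{1/2} f` and apply Cauchy–Schwarz in `y`; the first factor
    -- is controlled by the row bound.
    calc (∫⁻ y, K x y * f y ∂ν) ^ 2
        = (∫⁻ y, (K x y * w y) ^ (1 / 2 : ℝ) * ((K x y * (w y)⁻¹) ^ (1 / 2 : ℝ) * f y) ∂ν) ^ 2 := by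
          congr 1
          refine lintegral_congr_ae ?_
          filter_upwards [hw0] with y hy
          rw [← mul_assoc, ← ENNReal.mul_rpow_of_nonneg _ _ (by norm_num)]
          have : K x y * w y * (K x y * (w y)⁻¹) = K x y ^ (2 : ℝ) := by
            rw [ENNReal.rpow_two, mul_mul_mul_comm, ENNReal.mul_inv_cancel hy.1 hy.2, mul_one, sq]
          rw [this, ← ENNReal.rpow_mul]
          norm_num
      _ ≤ (∫⁻ y, ((K x y * w y) ^ (1 / 2 : ℝ)) ^ 2 ∂ν) *
          ∫⁻ y, ((K x y * (w y)⁻¹) ^ (1 / 2 : ℝ) * f y) ^ 2 ∂ν := by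
          refine lintegral_mul_sq_le ν ?_ ?_
          · exact (((hKx x).mul hw).pow_const _).aemeasurable
          · exact ((((hKx x).mul hw.inv).pow_const _).mul hf).aemeasurable
      _ ≤ A * v x * ∫⁻ y, K x y * ((w y)⁻¹ * f y ^ 2) ∂ν := by
          refine mul_le_mul' ?_ (le_of_eq ?_)
          · simpa only [hroot] using hx
          · simp only [mul_pow, hroot, mul_assoc]
  have hmeas : Measurable (Function.uncurry fun x y => K x y * ((w y)⁻¹ * f y ^ 2)) := by
    have h2 : Measurable fun p : X × Y => (w p.2)⁻¹ * f p.2 ^ 2 :=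
      (hw.inv.mul (hf.pow_const 2)).comp measurable_snd
    exact hK.mul h2
  calc ∫⁻ x, (∫⁻ y, K x y * f y ∂ν) ^ 2 ∂μ
      ≤ ∫⁻ x, A * v x * ∫⁻ y, K x y * ((w y)⁻¹ * f y ^ 2) ∂ν ∂μ := lintegral_mono_ae h1
    _ = ∫⁻ x, ∫⁻ y, A * v x * (K x y * ((w y)⁻¹ * f y ^ 2)) ∂ν ∂μ := by
        refine lintegral_congr fun x => ?_
        exact (lintegral_const_mul (A * v x) (hmeas.comp measurable_prodMk_left)).symm
    _ = ∫⁻ y, ∫⁻ x, A * v x * (K x y * ((w y)⁻¹ * f y ^ 2)) ∂μ ∂ν := by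
        refine lintegral_lintegral_swap (Measurable.aemeasurable ?_)
        exact ((hv.comp measurable_fst).const_mul A).mul hmeas
    _ = ∫⁻ y, A * ((w y)⁻¹ * f y ^ 2) * ∫⁻ x, K x y * v x ∂μ ∂ν := by
        refine lintegral_congr fun y => ?_
        rw [← lintegral_const_mul (f := fun x => K x y * v x) _ ((hKy y).mul hv)]
        exact lintegral_congr fun x => by ring
    _ ≤ ∫⁻ y, A * B * f y ^ 2 ∂ν := by
        refine lintegral_mono_ae ?_
        filter_upwards [hB, hw0] with y hy hy0
        calc A * ((w y)⁻¹ * f y ^ 2) * ∫⁻ x, K x y * v x ∂μ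
            ≤ A * ((w y)⁻¹ * f y ^ 2) * (B * w y) := by gcongr
          _ = A * B * f y ^ 2 * (w y * (w y)⁻¹) := by ring
          _ = A * B * f y ^ 2 := by rw [ENNReal.mul_inv_cancel hy0.1 hy0.2, mul_one]
    _ = A * B * ∫⁻ y, f y ^ 2 ∂ν := lintegral_const_mul _ (hf.pow_const 2)

theorem eLpNorm_two_sq {E : Type*} [NormedAddCommGroup E] (μ : Measure X) (f : X → E) :
    eLpNorm f 2 μ ^ 2 = ∫⁻ x, ‖f x‖ₑ ^ 2 ∂μ := by
  rw [eLpNorm_eq_lintegral_rpow_enorm_toReal (by norm_num) (by norm_num),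
    ← ENNReal.rpow_natCast, ← ENNReal.rpow_mul]
  norm_num

theorem eLpNorm_two_le_of_sq_le {E F : Type*} [NormedAddCommGroup E] [NormedAddCommGroup F]
    {μ : Measure X} {ν : Measure Y} {f : X → E} {g : Y → F} {A : ENNReal}
    (h : ∫⁻ x, ‖f x‖ₑ ^ 2 ∂μ ≤ A ^ 2 * ∫⁻ y, ‖g y‖ₑ ^ 2 ∂ν) :
    eLpNorm f 2 μ ≤ A * eLpNorm g 2 ν := by
  rw [← eLpNorm_two_sq, ← eLpNorm_two_sq, ← mul_pow] at h
  exact (ENNReal.pow_right_strictMono two_ne_zero).le_iff_le.1 h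

end General

/-! ### Calculus of `L²` bounds for integral kernels -/

section Kernel

variable {X Y : Type*} [MeasureSpace X] [MeasureSpace Y]

/-- The integral operator with kernel `K` has `L²` norm at most `A` (on measurable functions). -/
def KernelNormLE (K : X → Y → ℂ) (A : ℝ) : Prop :=
  ∀ f : Y → ℂ, Measurable f → MemLp f 2 volume →
    eLpNorm (fun x => ∫ y, K x y * f y) 2 volume ≤ ENNReal.ofReal A * eLpNorm f 2 volume

/-- The integral operator with kernel `K` is defined by absolutely convergent integrals on `L²`. -/
def KernelIntegrable (K : X → Y → ℂ) : Prop :=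
  ∀ f : Y → ℂ, Measurable f → MemLp f 2 volume →
    ∀ᵐ x : X, Integrable (fun y => K x y * f y)

theorem KernelNormLE.mono {K : X → Y → ℂ} {A B : ℝ} (h : KernelNormLE K A) (hAB : A ≤ B) :
    KernelNormLE K B := fun f hf hf2 =>
  (h f hf hf2).trans (by gcongr)

theorem measurable_integral_kernel [SFinite (volume : Measure Y)] {K : X → Y → ℂ}
    (hK : Measurable (Function.uncurry K)) {f : Y → ℂ} (hf : Measurable f) :
    StronglyMeasurable fun x => ∫ y, K x y * f y := by
  have : Measurable (Function.uncurry fun x y => K x y * f y) :=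
    hK.mul (hf.comp measurable_snd)
  exact this.stronglyMeasurable.integral_prod_right

/-- Norm bounds alone do not add: the Bochner integral is zero on non-integrable functions, so it is
additive only where both integrals converge. This is why `KernelIntegrable` is carried along
everywhere. -/
theorem KernelNormLE.add [SFinite (volume : Measure Y)] {K L : X → Y → ℂ} {A B : ℝ}
    (hK : KernelNormLE K A) (hL : KernelNormLE L B) (hA : 0 ≤ A) (hB : 0 ≤ B)
    (hKm : Measurable (Function.uncurry K)) (hLm : Measurable (Function.uncurry L))
    (hKi : KernelIntegrable K) (hLi : KernelIntegrable L) :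
    KernelNormLE (fun x y => K x y + L x y) (A + B) := fun f hf hf2 => by
  have h : (fun x => ∫ y, (K x y + L x y) * f y) =ᵐ[volume]
      (fun x => ∫ y, K x y * f y) + fun x => ∫ y, L x y * f y := by
    filter_upwards [hKi f hf hf2, hLi f hf hf2] with x h1 h2
    simp only [add_mul, Pi.add_apply]
    exact integral_add h1 h2
  rw [eLpNorm_congr_ae h, ENNReal.ofReal_add hA hB, add_mul]
  exact (eLpNorm_add_le (measurable_integral_kernel hKm hf).aestronglyMeasurable
    (measurable_integral_kernel hLm hf).aestronglyMeasurable (by norm_num)).trans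
    (add_le_add (hK f hf hf2) (hL f hf hf2))

theorem KernelIntegrable.add {K L : X → Y → ℂ}
    (hKi : KernelIntegrable K) (hLi : KernelIntegrable L) :
    KernelIntegrable (fun x y => K x y + L x y) := fun f hf hf2 => by
  filter_upwards [hKi f hf hf2, hLi f hf hf2] with x h1 h2
  simp only [add_mul]
  exact h1.add h2

theorem KernelNormLE.zero : KernelNormLE (fun (_ : X) (_ : Y) => (0 : ℂ)) 0 := fun f _ _ => by
  simp

theorem KernelIntegrable.zero : KernelIntegrable (fun (_ : X) (_ : Y) => (0 : ℂ)) :=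
  fun f _ _ => by simp

theorem KernelNormLE.sum [SFinite (volume : Measure Y)] {ι : Type*} (s : Finset ι)
    {K : ι → X → Y → ℂ} {A : ι → ℝ}
    (hK : ∀ i ∈ s, KernelNormLE (K i) (A i)) (hA : ∀ i ∈ s, 0 ≤ A i)
    (hKm : ∀ i ∈ s, Measurable (Function.uncurry (K i)))
    (hKi : ∀ i ∈ s, KernelIntegrable (K i)) :
    KernelNormLE (fun x y => ∑ i ∈ s, K i x y) (∑ i ∈ s, A i) ∧
      KernelIntegrable (fun x y => ∑ i ∈ s, K i x y) := by
  classical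
  induction s using Finset.induction_on with
  | empty => simpa using ⟨KernelNormLE.zero, KernelIntegrable.zero⟩
  | insert a s ha ih =>
    simp only [Finset.sum_insert ha]
    obtain ⟨ih1, ih2⟩ := ih (fun i hi => hK i (Finset.mem_insert_of_mem hi))
      (fun i hi => hA i (Finset.mem_insert_of_mem hi))
      (fun i hi => hKm i (Finset.mem_insert_of_mem hi))
      (fun i hi => hKi i (Finset.mem_insert_of_mem hi))
    have ha' := Finset.mem_insert_self a s
    refine ⟨(hK a ha').add ih1 (hA a ha')
      (Finset.sum_nonneg fun i hi => hA i (Finset.mem_insert_of_mem hi)) (hKm a ha') ?_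
      (hKi a ha') ih2, (hKi a ha').add ih2⟩
    have : (Function.uncurry fun x y => ∑ i ∈ s, K i x y) =
        fun p => ∑ i ∈ s, Function.uncurry (K i) p := by
      ext p; rfl
    rw [this]
    exact Finset.measurable_sum s fun i hi => hKm i (Finset.mem_insert_of_mem hi)

/-- A kernel dominated by a nonnegative `L²`-bounded kernel is `L²`-bounded. -/
theorem kernel_of_lintegral_bound {K : X → Y → ℂ}
    [SFinite (volume : Measure Y)]
    (hKm : Measurable (Function.uncurry K)) {A : ℝ}
    (h : ∀ f : Y → ENNReal, Measurable f →
      ∫⁻ x, (∫⁻ y, ‖K x y‖ₑ * f y) ^ 2 ≤ ENNReal.ofReal A ^ 2 * ∫⁻ y, f y ^ 2) :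
    KernelNormLE K A ∧ KernelIntegrable K := by
  refine ⟨fun f hf hf2 => ?_, fun f hf hf2 => ?_⟩
  · refine eLpNorm_two_le_of_sq_le (le_trans (lintegral_mono fun x => ?_) (h _ hf.enorm))
    gcongr
    refine (enorm_integral_le_lintegral_enorm _).trans (le_of_eq ?_)
    simp only [enorm_mul]
  · have hfin : ∫⁻ x, (∫⁻ y, ‖K x y‖ₑ * ‖f y‖ₑ) ^ 2 ≠ ⊤ := by
      refine ne_top_of_le_ne_top ?_ (h _ hf.enorm)
      rw [← eLpNorm_two_sq]
      exact ENNReal.mul_ne_top (ENNReal.pow_ne_top ENNReal.ofReal_ne_top)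
        (ENNReal.pow_ne_top hf2.eLpNorm_ne_top)
    have hm : Measurable fun x => (∫⁻ y, ‖K x y‖ₑ * ‖f y‖ₑ) ^ 2 := by
      refine Measurable.pow_const (Measurable.lintegral_prod_right ?_) 2
      exact hKm.enorm.mul (hf.enorm.comp measurable_snd)
    filter_upwards [ae_lt_top hm hfin] with x hx
    refine ⟨((hKm.comp measurable_prodMk_left).mul hf).aestronglyMeasurable, ?_⟩
    have : (∫⁻ y, ‖K x y‖ₑ * ‖f y‖ₑ) < ⊤ := by
      by_contra hc
      rw [not_lt, top_le_iff] at hc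
      simp [hc] at hx
    simpa only [HasFiniteIntegral, enorm_mul] using this

end Kernel

/-! ### Dilations and the homogeneous Hilbert-type kernel -/

theorem lintegral_eq_mul_lintegral_smul {n : ℕ} {r : ℝ} (hr : 0 < r)
    {f : (Fin n → ℝ) → ENNReal} (hf : Measurable f) :
    ∫⁻ x, f x = ENNReal.ofReal (r ^ n) * ∫⁻ u, f (r • u) := by
  have hrn : 0 < r ^ n := pow_pos hr n
  have h := lintegral_map (μ := (volume : Measure (Fin n → ℝ))) hf (measurable_const_smul r)
  rw [Measure.map_addHaar_smul volume hr.ne', lintegral_smul_measure, Module.finrank_fin_fun,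
    abs_of_pos (inv_pos.2 hrn)] at h
  rw [← h, smul_eq_mul, ← mul_assoc, ← ENNReal.ofReal_mul hrn.le, mul_inv_cancel₀ hrn.ne']
  simp

/-- In squared norms, substituting `y = r v` inside the operator gives `r ^ (2n)`, the outer
`x`-integral gives `r ^ m`, and the norm of `f` gives back `r ^ n`. The net factor is `r ^ (m + n)`.
-/
theorem KernelNormLE.of_scaled {m n : ℕ} {r : ℝ} (hr : 0 < r)
    {K : (Fin m → ℝ) → (Fin n → ℝ) → ℂ} (hK : Measurable (Function.uncurry K)) {A : ℝ}
    (h : KernelNormLE (fun x y => K (r • x) (r • y)) A) :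
    KernelNormLE K (r ^ (((m : ℝ) + n) / 2) * A) := fun f hf hf2 => by
  have hfsq : ∫⁻ y, ‖f y‖ₑ ^ 2 = ENNReal.ofReal (r ^ n) * ∫⁻ u, ‖f (r • u)‖ₑ ^ 2 :=
    lintegral_eq_mul_lintegral_smul hr (hf.enorm.pow_const 2)
  have hgm : Measurable fun u => f (r • u) := hf.comp (measurable_const_smul r)
  have hrn : ∀ k : ℕ, ENNReal.ofReal (r ^ k) ≠ 0 := fun k => by
    simpa using pow_pos hr k
  have hg2 : MemLp (fun u => f (r • u)) 2 volume := by
    refine ⟨hgm.aestronglyMeasurable, ?_⟩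
    have h1 : ∫⁻ y, ‖f y‖ₑ ^ 2 ≠ ⊤ := by
      rw [← eLpNorm_two_sq]; exact ENNReal.pow_ne_top hf2.eLpNorm_ne_top
    have h2 : eLpNorm (fun u => f (r • u)) 2 volume ^ 2 ≠ ⊤ := by
      rw [eLpNorm_two_sq]
      intro h3
      rw [hfsq, h3, ENNReal.mul_top (hrn n)] at h1
      exact h1 rfl
    rw [lt_top_iff_ne_top]
    intro h3
    exact h2 (by rw [h3]; simp)
  have hT : ∀ u, ∫ y, K (r • u) y * f y =
      ((r ^ n : ℝ) : ℂ) * ∫ v, K (r • u) (r • v) * f (r • v) := fun u => by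
    have := Measure.integral_comp_smul volume (fun y => K (r • u) y * f y) r
    rw [this, Module.finrank_fin_fun, abs_of_pos (inv_pos.2 (pow_pos hr n)), Complex.real_smul,
      ← mul_assoc, ← Complex.ofReal_mul, mul_inv_cancel₀ (pow_pos hr n).ne']
    simp
  have hA := pow_le_pow_left₀ zero_le (h _ hgm hg2) 2
  rw [mul_pow, eLpNorm_two_sq, eLpNorm_two_sq] at hA
  refine eLpNorm_two_le_of_sq_le ?_
  have hc : (r ^ (((m : ℝ) + n) / 2)) ^ 2 = r ^ m * r ^ n := by
    rw [← Real.rpow_natCast, ← Real.rpow_mul hr.le, ← pow_add, ← Real.rpow_natCast]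
    congr 1; push_cast; ring
  rw [lintegral_eq_mul_lintegral_smul hr
    ((measurable_integral_kernel hK hf).measurable.enorm.pow_const 2)]
  simp only [hT, enorm_mul, mul_pow]
  rw [lintegral_const_mul']
  swap; · exact ENNReal.pow_ne_top enorm_ne_top
  rw [hfsq, ENNReal.ofReal_mul (by positivity), mul_pow,
    ← ENNReal.ofReal_pow (p := r ^ (((m : ℝ) + n) / 2)) (by positivity), hc,
    ENNReal.ofReal_mul (by positivity)]
  have he : ‖((r ^ n : ℝ) : ℂ)‖ₑ = ENNReal.ofReal (r ^ n) := by
    rw [← ofReal_norm, Complex.norm_real, Real.norm_of_nonneg (by positivity)]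
  rw [he]
  calc _ ≤ ENNReal.ofReal (r ^ m) * (ENNReal.ofReal (r ^ n) ^ 2 *
        (ENNReal.ofReal A ^ 2 * ∫⁻ x, ‖f (r • x)‖ₑ ^ 2)) := by gcongr
    _ = _ := by ring

/-- The radial profile controlling the homogeneous Hilbert-type kernel is integrable. -/
theorem integrable_max_rpow_mul_rpow {n : ℕ} (hn : 0 < n) {m : ℝ} (hm : 0 < m) :
    Integrable fun u : Fin n → ℝ =>
      (max 1 ‖u‖) ^ (-((m + n) / 2)) * ‖u‖ ^ (-((n : ℝ) / 2)) := by
  have : Nonempty (Fin n) := ⟨⟨0, hn⟩⟩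
  have hn1 : (1 : ℝ) ≤ n := by exact_mod_cast hn
  refine (integrable_fun_norm_addHaar (E := Fin n → ℝ) (volume)
    (f := fun t : ℝ => (max 1 t) ^ (-((m + n) / 2)) * t ^ (-((n : ℝ) / 2)))).2 ?_
  rw [Module.finrank_fin_fun, ← Set.Ioc_union_Ioi_eq_Ioi zero_le_one, integrableOn_union]
  constructor
  -- In polar coordinates the density `t ^ (n - 1)` leaves `t ^ (n/2 - 1)` near zero and `t ^ (-1 -
  -- m/2)` at infinity; `0 < n` and `0 < m` give the two convergences.
  · have h : IntegrableOn (fun t : ℝ => t ^ ((n : ℝ) / 2 - 1)) (Set.Ioc 0 1) := by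
      rw [← intervalIntegrable_iff_integrableOn_Ioc_of_le zero_le_one]
      exact intervalIntegral.intervalIntegrable_rpow' (by linarith)
    refine h.congr_fun (fun t ht => ?_) measurableSet_Ioc
    simp only [max_eq_left ht.2, Real.one_rpow, one_mul, smul_eq_mul]
    rw [← Real.rpow_natCast, ← Real.rpow_add ht.1, Nat.cast_sub hn]
    congr 1; push_cast; ring
  · have h : IntegrableOn (fun t : ℝ => t ^ (-1 - m / 2)) (Set.Ioi 1) :=
      integrableOn_Ioi_rpow_of_lt (by linarith) one_pos
    refine h.congr_fun (fun t ht => ?_) measurableSet_Ioi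
    have ht1 : (1 : ℝ) < t := ht
    have ht0 : 0 < t := by linarith
    simp only [max_eq_right ht1.le, smul_eq_mul]
    rw [← Real.rpow_natCast, ← Real.rpow_add ht0, ← Real.rpow_add ht0, Nat.cast_sub hn]
    congr 1; push_cast; ring

/-- Substituting `y = ρ u` reduces everything to `ρ = 1`, since the powers of `ρ` add up to `n - (m
+ n)/2 - n/2 = -m/2`. This is one of the two hypotheses of Schur's test; the other follows by
exchanging `m` and `n`. -/
theorem exists_lintegral_max_rpow_le {n : ℕ} (hn : 0 < n) {m : ℝ} (hm : 0 < m) :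
    ∃ C : ℝ, 0 ≤ C ∧ ∀ ρ : ℝ, 0 < ρ →
      ∫⁻ y : Fin n → ℝ, ENNReal.ofReal ((max ρ ‖y‖) ^ (-((m + n) / 2))) *
        ENNReal.ofReal (‖y‖ ^ (-((n : ℝ) / 2))) ≤
      ENNReal.ofReal C * ENNReal.ofReal (ρ ^ (-(m / 2))) := by
  have hint := integrable_max_rpow_mul_rpow hn hm
  refine ⟨∫ u : Fin n → ℝ, (max 1 ‖u‖) ^ (-((m + n) / 2)) * ‖u‖ ^ (-((n : ℝ) / 2)),
    integral_nonneg fun u => by positivity, fun ρ hρ => ?_⟩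
  rw [ofReal_integral_eq_lintegral_ofReal hint
    (Filter.Eventually.of_forall fun u => by positivity), lintegral_eq_mul_lintegral_smul hρ,
    ← lintegral_const_mul', ← lintegral_mul_const']
  · refine le_of_eq (lintegral_congr fun u => ?_)
    have h1 : max ρ ‖ρ • u‖ = ρ * max 1 ‖u‖ := by
      rw [norm_smul, Real.norm_of_nonneg hρ.le, mul_max_of_nonneg _ _ hρ.le, mul_one]
    rw [h1, norm_smul, Real.norm_of_nonneg hρ.le, Real.mul_rpow hρ.le (by positivity),
      Real.mul_rpow hρ.le (norm_nonneg _), ← ENNReal.ofReal_mul (by positivity),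
      ← ENNReal.ofReal_mul (by positivity), ← ENNReal.ofReal_mul (by positivity)]
    congr 1
    have h2 : ρ ^ n * (ρ ^ (-((m + n) / 2)) * ρ ^ (-((n : ℝ) / 2))) = ρ ^ (-(m / 2)) := by
      rw [← Real.rpow_natCast, ← Real.rpow_add hρ, ← Real.rpow_add hρ]
      congr 1; ring
    rw [← h2]; ring
  · exact ENNReal.ofReal_ne_top
  · exact ENNReal.ofReal_ne_top
  · exact ((measurable_const.max measurable_norm).pow_const _).ennreal_ofReal.mul
      (measurable_norm.pow_const _).ennreal_ofReal

/-- The homogeneous kernel `max(‖x‖, ‖y‖)^{-(m+n)/2}` is bounded from `L²(ℝⁿ)` to `L²(ℝᵐ)`, and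
so is every kernel it dominates. -/
theorem exists_kernelNormLE_of_norm_le {m n : ℕ} (hm : 0 < m) (hn : 0 < n) :
    ∃ C : ℝ, 0 < C ∧ ∀ (K : (Fin m → ℝ) → (Fin n → ℝ) → ℂ) (A : ℝ), 0 ≤ A →
      Measurable (Function.uncurry K) →
      (∀ x y, x ≠ 0 → ‖K x y‖ ≤ A * (max ‖x‖ ‖y‖) ^ (-(((m : ℝ) + n) / 2))) →
      KernelNormLE K (C * A) ∧ KernelIntegrable K := by
  have : Nonempty (Fin n) := ⟨⟨0, hn⟩⟩
  have : Nonempty (Fin m) := ⟨⟨0, hm⟩⟩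
  obtain ⟨C₁, hC₁, h₁⟩ := exists_lintegral_max_rpow_le hn (m := m) (by exact_mod_cast hm)
  obtain ⟨C₂, hC₂, h₂⟩ := exists_lintegral_max_rpow_le hm (m := n) (by exact_mod_cast hn)
  refine ⟨max C₁ C₂ + 1, by positivity, fun K A hA hK hKA => ?_⟩
  have hx0 : ∀ᵐ x : Fin m → ℝ, x ≠ 0 := Measure.ae_ne volume 0
  have hy0 : ∀ᵐ y : Fin n → ℝ, y ≠ 0 := Measure.ae_ne volume 0
  refine kernel_of_lintegral_bound hK fun f hf => ?_
  have hmeasK : Measurable (Function.uncurry fun (x : Fin m → ℝ) (y : Fin n → ℝ) =>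
      ENNReal.ofReal ((max ‖x‖ ‖y‖) ^ (-(((m : ℝ) + n) / 2)))) := by
    refine Measurable.ennreal_ofReal (Measurable.pow_const ?_ _)
    exact (measurable_norm.comp measurable_fst).max (measurable_norm.comp measurable_snd)
  -- The weights `‖x‖ ^ (-m/2)` and `‖y‖ ^ (-n/2)` are reproduced, up to constants, by the
  -- homogeneous kernel and its transpose.
  have hschur := lintegral_schur_test (volume : Measure (Fin m → ℝ)) (volume : Measure (Fin n → ℝ))
    hmeasK (v := fun x => ENNReal.ofReal (‖x‖ ^ (-((m : ℝ) / 2))))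
    (measurable_norm.pow_const _).ennreal_ofReal
    (w := fun y => ENNReal.ofReal (‖y‖ ^ (-((n : ℝ) / 2))))
    (measurable_norm.pow_const _).ennreal_ofReal
    (A := ENNReal.ofReal C₁) (B := ENNReal.ofReal C₂) ?_ ?_ ?_ hf
  · have hC : ENNReal.ofReal C₁ * ENNReal.ofReal C₂ ≤ ENNReal.ofReal (max C₁ C₂ + 1) ^ 2 := by
      rw [sq]
      gcongr
      · exact (le_max_left _ _).trans (by linarith)
      · exact (le_max_right _ _).trans (by linarith)
    calc ∫⁻ x, (∫⁻ y, ‖K x y‖ₑ * f y) ^ 2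
        ≤ ∫⁻ x, ENNReal.ofReal A ^ 2 *
          (∫⁻ y, ENNReal.ofReal ((max ‖x‖ ‖y‖) ^ (-(((m : ℝ) + n) / 2))) * f y) ^ 2 := by
          refine lintegral_mono_ae ?_
          filter_upwards [hx0] with x hx
          rw [← mul_pow, ← lintegral_const_mul' _ _ ENNReal.ofReal_ne_top]
          refine pow_le_pow_left₀ zero_le (lintegral_mono fun y => ?_) 2
          rw [← mul_assoc, ← ENNReal.ofReal_mul hA, ← ofReal_norm]
          gcongr
          exact hKA x y hx
      _ = ENNReal.ofReal A ^ 2 * ∫⁻ x,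
          (∫⁻ y, ENNReal.ofReal ((max ‖x‖ ‖y‖) ^ (-(((m : ℝ) + n) / 2))) * f y) ^ 2 :=
          lintegral_const_mul' _ _ (ENNReal.pow_ne_top ENNReal.ofReal_ne_top)
      _ ≤ ENNReal.ofReal A ^ 2 * (ENNReal.ofReal C₁ * ENNReal.ofReal C₂ * ∫⁻ y, f y ^ 2) :=
          mul_le_mul' le_rfl hschur
      _ ≤ ENNReal.ofReal A ^ 2 * (ENNReal.ofReal (max C₁ C₂ + 1) ^ 2 * ∫⁻ y, f y ^ 2) := by
          gcongr
      _ = _ := by rw [ENNReal.ofReal_mul (by positivity)]; ring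
  · filter_upwards [hy0] with y hy
    refine ⟨?_, ENNReal.ofReal_ne_top⟩
    have : 0 < ‖y‖ := norm_pos_iff.2 hy
    simpa using Real.rpow_pos_of_pos this _
  · filter_upwards [hx0] with x hx
    exact h₁ ‖x‖ (norm_pos_iff.2 hx)
  · filter_upwards [hy0] with y hy
    have := h₂ ‖y‖ (norm_pos_iff.2 hy)
    simpa only [max_comm ‖y‖, add_comm (n : ℝ)] using this

/-! ### Oscillatory integrals in one variable -/

theorem hasDerivAt_cexp_phase {Φ : ℝ → ℝ} {p s : ℝ} (μ : ℝ) (h : HasDerivAt Φ p s) :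
    HasDerivAt (fun s => Complex.exp (Complex.I * ((μ * Φ s : ℝ) : ℂ)))
      (Complex.exp (Complex.I * ((μ * Φ s : ℝ) : ℂ)) * (Complex.I * ((μ * p : ℝ) : ℂ))) s :=
  (((h.const_mul μ).ofReal_comp).const_mul Complex.I).cexp

theorem norm_cexp_phase (a : ℝ) : ‖Complex.exp (Complex.I * (a : ℂ))‖ = 1 := by
  rw [mul_comm]; exact Complex.norm_exp_ofReal_mul_I a

/-- Integration by parts against an oscillating factor. -/
theorem integral_cexp_phase_mul {α β μ : ℝ} (hαβ : α ≤ β) (hμ : μ ≠ 0) {Φ p : ℝ → ℝ}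
    {q q' : ℝ → ℂ}
    (hΦ : ∀ s ∈ Set.Icc α β, HasDerivAt Φ (p s) s) (hp : ContinuousOn p (Set.Icc α β))
    (hq : ∀ s ∈ Set.Icc α β, HasDerivAt q (q' s) s) (hq' : ContinuousOn q' (Set.Icc α β))
    (hqα : q α = 0) (hqβ : q β = 0) :
    ∫ s in α..β, Complex.exp (Complex.I * ((μ * Φ s : ℝ) : ℂ)) * ((p s : ℂ) * q s) =
      Complex.I / μ * ∫ s in α..β, Complex.exp (Complex.I * ((μ * Φ s : ℝ) : ℂ)) * q' s := by
  have hI : Set.uIcc α β = Set.Icc α β := Set.uIcc_of_le hαβ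
  set e : ℝ → ℂ := fun s => Complex.exp (Complex.I * ((μ * Φ s : ℝ) : ℂ)) with he
  have hec : ContinuousOn e (Set.Icc α β) := fun s hs =>
    (hasDerivAt_cexp_phase μ (hΦ s hs)).continuousAt.continuousWithinAt
  have hqc : ContinuousOn q (Set.Icc α β) := fun s hs =>
    (hq s hs).continuousAt.continuousWithinAt
  have hpc : ContinuousOn (fun s => (p s : ℂ)) (Set.Icc α β) :=
    Complex.continuous_ofReal.comp_continuousOn hp
  have h1 : IntervalIntegrable (fun s => e s * ((p s : ℂ) * q s)) volume α β :=
    (hI ▸ (hec.mul (hpc.mul hqc))).intervalIntegrable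
  have h2 : IntervalIntegrable (fun s => e s * q' s) volume α β :=
    (hI ▸ (hec.mul hq')).intervalIntegrable
  have h3 : ∫ s in α..β, (Complex.I * μ * (e s * ((p s : ℂ) * q s)) + e s * q' s) =
      e β * q β - e α * q α := by
    refine intervalIntegral.integral_eq_sub_of_hasDerivAt (f := fun s => e s * q s)
      (fun s hs => ?_) ((h1.const_mul _).add h2)
    rw [hI] at hs
    refine ((hasDerivAt_cexp_phase μ (hΦ s hs)).mul (hq s hs)).congr_deriv ?_
    simp only [he]; push_cast; ring
  rw [intervalIntegral.integral_add (h1.const_mul _) h2, intervalIntegral.integral_const_mul,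
    hqα, hqβ] at h3
  have hμ' : (μ : ℂ) ≠ 0 := by exact_mod_cast hμ
  have h4 : (Complex.I * μ) * ∫ s in α..β, e s * ((p s : ℂ) * q s) =
      - ∫ s in α..β, e s * q' s := by linear_combination h3
  have h5 : (Complex.I / μ) * ((Complex.I * μ) * ∫ s in α..β, e s * ((p s : ℂ) * q s)) =
      - ∫ s in α..β, e s * ((p s : ℂ) * q s) := by
    field_simp
    rw [Complex.I_sq]; ring
  rw [h4] at h5
  have h6 : ∫ s in α..β, e s * ((p s : ℂ) * q s) = Complex.I / μ * ∫ s in α..β, e s * q' s := by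
    linear_combination h5
  exact h6

/-- Quadratic decay of an oscillatory integral whose phase derivative is comparable to `θ`. -/
theorem norm_integral_cexp_phase_le {α β μ c C θ B : ℝ} (hαβ : α ≤ β) (hc : 0 < c)
    (hC : 0 ≤ C) (hθ : 0 ≤ θ) (hB : 0 ≤ B) {Φ p p₁ p₂ : ℝ → ℝ} {b b₁ b₂ : ℝ → ℂ}
    (hΦ : ∀ s ∈ Set.Icc α β, HasDerivAt Φ (p s) s)
    (hp : ∀ s ∈ Set.Icc α β, HasDerivAt p (p₁ s) s)
    (hp₁ : ∀ s ∈ Set.Icc α β, HasDerivAt p₁ (p₂ s) s) (hp₂ : ContinuousOn p₂ (Set.Icc α β))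
    (hb : ∀ s ∈ Set.Icc α β, HasDerivAt b (b₁ s) s)
    (hb₁ : ∀ s ∈ Set.Icc α β, HasDerivAt b₁ (b₂ s) s) (hb₂ : ContinuousOn b₂ (Set.Icc α β))
    (hbα : b α = 0) (hbβ : b β = 0) (hb₁α : b₁ α = 0) (hb₁β : b₁ β = 0)
    (hpl : ∀ s ∈ Set.Icc α β, c * θ ≤ |p s|) (hp₁u : ∀ s ∈ Set.Icc α β, |p₁ s| ≤ C * θ)
    (hp₂u : ∀ s ∈ Set.Icc α β, |p₂ s| ≤ C * θ)
    (hbu : ∀ s ∈ Set.Icc α β, ‖b s‖ ≤ B ∧ ‖b₁ s‖ ≤ B ∧ ‖b₂ s‖ ≤ B) :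
    ‖∫ s in α..β, Complex.exp (Complex.I * ((μ * Φ s : ℝ) : ℂ)) * b s‖ ≤
      (β - α) * B * (1 + 6 * (1 / c + C / c ^ 2 + 2 * C ^ 2 / c ^ 3) ^ 2) *
        (1 + (μ * θ) ^ 2)⁻¹ := by
  -- `G / θ` bounds `1 / p` and its first two derivatives: these are at most `1 / (cθ)`, `C / (c²θ)`
  -- and `(C / c² + 2C² / c³) / θ`.
  set G := 1 / c + C / c ^ 2 + 2 * C ^ 2 / c ^ 3 with hG
  have hG0 : 0 ≤ G := by positivity
  have hI : Set.uIoc α β ⊆ Set.Icc α β := by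
    rw [Set.uIoc_of_le hαβ]; exact Set.Ioc_subset_Icc_self
  have htriv : ‖∫ s in α..β, Complex.exp (Complex.I * ((μ * Φ s : ℝ) : ℂ)) * b s‖ ≤
      (β - α) * B := by
    have := intervalIntegral.norm_integral_le_of_norm_le_const (a := α) (b := β) (C := B)
      (f := fun s => Complex.exp (Complex.I * ((μ * Φ s : ℝ) : ℂ)) * b s) fun s hs => by
        rw [norm_mul, norm_cexp_phase, one_mul]; exact (hbu s (hI hs)).1
    rwa [abs_of_nonneg (sub_nonneg.2 hαβ), mul_comm] at this
  have hosc : ‖∫ s in α..β, Complex.exp (Complex.I * ((μ * Φ s : ℝ) : ℂ)) * b s‖ * (μ * θ) ^ 2 ≤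
      (β - α) * B * (6 * G ^ 2) := by
    rcases eq_or_ne (μ * θ) 0 with h0 | h0
    · rw [h0]
      have : 0 ≤ β - α := sub_nonneg.2 hαβ
      simp only [ne_eq, OfNat.ofNat_ne_zero, not_false_eq_true, zero_pow, mul_zero]
      positivity
    have hμ : μ ≠ 0 := left_ne_zero_of_mul h0
    have hθ0 : 0 < θ := lt_of_le_of_ne hθ (right_ne_zero_of_mul h0).symm
    have hp0 : ∀ s ∈ Set.Icc α β, p s ≠ 0 := fun s hs h => by
      have := hpl s hs
      rw [h, abs_zero] at this
      exact absurd this (not_le.2 (by positivity))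
    set g : ℝ → ℝ := fun s => (p s)⁻¹ with hg
    set g₁ : ℝ → ℝ := fun s => -p₁ s / p s ^ 2 with hg₁
    set g₂ : ℝ → ℝ := fun s => -p₂ s / p s ^ 2 + 2 * p₁ s ^ 2 / p s ^ 3 with hg₂
    have hgd : ∀ s ∈ Set.Icc α β, HasDerivAt g (g₁ s) s := fun s hs =>
      (hp s hs).inv (hp0 s hs)
    have hg₁d : ∀ s ∈ Set.Icc α β, HasDerivAt g₁ (g₂ s) s := fun s hs => by
      have hps := hp0 s hs
      refine ((hp₁ s hs).neg.div ((hp s hs).pow 2) (pow_ne_zero 2 hps)).congr_deriv ?_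
      simp only [hg₂]
      simp only [Pi.pow_apply, Pi.neg_apply]
      field_simp
      ring
    have hpc : ContinuousOn p (Set.Icc α β) := fun s hs =>
      (hp s hs).continuousAt.continuousWithinAt
    have hp₁c : ContinuousOn p₁ (Set.Icc α β) := fun s hs =>
      (hp₁ s hs).continuousAt.continuousWithinAt
    have hg₂c : ContinuousOn g₂ (Set.Icc α β) :=
      (hp₂.neg.div (hpc.pow 2) fun s hs => pow_ne_zero 2 (hp0 s hs)).add
        ((continuousOn_const.mul (hp₁c.pow 2)).div (hpc.pow 3)
          fun s hs => pow_ne_zero 3 (hp0 s hs))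
    have hginv : ∀ s ∈ Set.Icc α β, |p s|⁻¹ ≤ (c * θ)⁻¹ := fun s hs =>
      inv_anti₀ (by positivity) (hpl s hs)
    have hgu : ∀ s ∈ Set.Icc α β, |g s| ≤ G / θ := fun s hs => by
      rw [hg, abs_inv]
      refine (hginv s hs).trans ?_
      rw [mul_inv, div_eq_mul_inv, ← one_div c]
      gcongr
      rw [hG, add_assoc]
      exact le_add_of_nonneg_right (by positivity)
    have hp1t : ∀ s ∈ Set.Icc α β, |-p₁ s / p s ^ 2| ≤ (C / c ^ 2) / θ := fun s hs => by
      rw [abs_div, abs_neg, abs_pow, div_eq_mul_inv, ← inv_pow]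
      calc |p₁ s| * |p s|⁻¹ ^ 2 ≤ (C * θ) * ((c * θ)⁻¹) ^ 2 := by
            gcongr
            · exact hp₁u s hs
            · exact hpl s hs
        _ = (C / c ^ 2) / θ := by field_simp
    have hp2t : ∀ s ∈ Set.Icc α β, |-p₂ s / p s ^ 2| ≤ (C / c ^ 2) / θ := fun s hs => by
      rw [abs_div, abs_neg, abs_pow, div_eq_mul_inv, ← inv_pow]
      calc |p₂ s| * |p s|⁻¹ ^ 2 ≤ (C * θ) * ((c * θ)⁻¹) ^ 2 := by
            gcongr
            · exact hp₂u s hs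
            · exact hpl s hs
        _ = (C / c ^ 2) / θ := by field_simp
    have hg₁u : ∀ s ∈ Set.Icc α β, |g₁ s| ≤ G / θ := fun s hs => by
      refine (hp1t s hs).trans ?_
      gcongr
      rw [hG, add_right_comm]
      exact le_add_of_nonneg_left (by positivity)
    have hg₂u : ∀ s ∈ Set.Icc α β, |g₂ s| ≤ G / θ := fun s hs => by
      refine (abs_add_le _ _).trans ?_
      have h3 : |2 * p₁ s ^ 2 / p s ^ 3| ≤ (2 * C ^ 2 / c ^ 3) / θ := by
        rw [abs_div, abs_mul, abs_pow, abs_pow, abs_two, div_eq_mul_inv, ← inv_pow]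
        calc 2 * |p₁ s| ^ 2 * |p s|⁻¹ ^ 3 ≤ 2 * (C * θ) ^ 2 * ((c * θ)⁻¹) ^ 3 := by
              gcongr
              · exact hp₁u s hs
              · exact hpl s hs
          _ = (2 * C ^ 2 / c ^ 3) / θ := by field_simp
      calc _ ≤ (C / c ^ 2) / θ + (2 * C ^ 2 / c ^ 3) / θ := add_le_add (hp2t s hs) h3
        _ = (C / c ^ 2 + 2 * C ^ 2 / c ^ 3) / θ := by ring
        _ ≤ G / θ := by
          gcongr
          rw [hG, add_assoc]
          exact le_add_of_nonneg_left (by positivity)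
    -- With `g = 1 / p`, each integration by parts replaces the amplitude `b` by `(b g)'`, up to the
    -- factor `I / μ`. The result after two rounds is `r₁ = ((b g)' g)'`, a sum of six products of a
    -- derivative of `b` with two derivatives of `g`; hence the constant 6.
    set q : ℝ → ℂ := fun s => b s * (g s : ℂ) with hq
    set q₁ : ℝ → ℂ := fun s => b₁ s * (g s : ℂ) + b s * (g₁ s : ℂ) with hq₁
    set q₂ : ℝ → ℂ := fun s => b₂ s * (g s : ℂ) + b₁ s * (g₁ s : ℂ) +
      (b₁ s * (g₁ s : ℂ) + b s * (g₂ s : ℂ)) with hq₂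
    set r₁ : ℝ → ℂ := fun s => q₂ s * (g s : ℂ) + q₁ s * (g₁ s : ℂ) with hr₁
    have hqd : ∀ s ∈ Set.Icc α β, HasDerivAt q (q₁ s) s := fun s hs =>
      (hb s hs).mul (hgd s hs).ofReal_comp
    have hq₁d : ∀ s ∈ Set.Icc α β, HasDerivAt q₁ (q₂ s) s := fun s hs =>
      ((hb₁ s hs).mul (hgd s hs).ofReal_comp).add ((hb s hs).mul (hg₁d s hs).ofReal_comp)
    have hrd : ∀ s ∈ Set.Icc α β, HasDerivAt (fun s => q₁ s * (g s : ℂ)) (r₁ s) s := fun s hs =>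
      (hq₁d s hs).mul (hgd s hs).ofReal_comp
    have cont {f f' : ℝ → ℂ} (h : ∀ s ∈ Set.Icc α β, HasDerivAt f (f' s) s) :
        ContinuousOn f (Set.Icc α β) := fun s hs => (h s hs).continuousAt.continuousWithinAt
    have hgc : ContinuousOn (fun s => (g s : ℂ)) (Set.Icc α β) :=
      cont fun s hs => (hgd s hs).ofReal_comp
    have hg₁c : ContinuousOn (fun s => (g₁ s : ℂ)) (Set.Icc α β) :=
      cont fun s hs => (hg₁d s hs).ofReal_comp
    have hg₂c' : ContinuousOn (fun s => (g₂ s : ℂ)) (Set.Icc α β) :=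
      Complex.continuous_ofReal.comp_continuousOn hg₂c
    have hq₂c : ContinuousOn q₂ (Set.Icc α β) :=
      ((hb₂.mul hgc).add ((cont hb₁).mul hg₁c)).add
        (((cont hb₁).mul hg₁c).add ((cont hb).mul hg₂c'))
    have hr₁c : ContinuousOn r₁ (Set.Icc α β) :=
      (hq₂c.mul hgc).add ((cont hq₁d).mul hg₁c)
    have e1 := integral_cexp_phase_mul hαβ hμ hΦ hpc hqd (cont hq₁d)
      (by simp [hq, hbα]) (by simp [hq, hbβ])
    have e2 := integral_cexp_phase_mul hαβ hμ hΦ hpc hrd hr₁c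
      (by simp [hq₁, hbα, hb₁α]) (by simp [hq₁, hbβ, hb₁β])
    have hsw : ∀ f : ℝ → ℂ, (∫ s in α..β, Complex.exp (Complex.I * ((μ * Φ s : ℝ) : ℂ)) *
        ((p s : ℂ) * (f s * (g s : ℂ)))) =
        ∫ s in α..β, Complex.exp (Complex.I * ((μ * Φ s : ℝ) : ℂ)) * f s := fun f => by
      refine intervalIntegral.integral_congr fun s hs => ?_
      rw [Set.uIcc_of_le hαβ] at hs
      have : (p s : ℂ) ≠ 0 := by exact_mod_cast hp0 s hs
      simp only [hg, Complex.ofReal_inv]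
      field_simp
    rw [hsw] at e2
    rw [hsw, e2] at e1
    have hr₁u : ∀ s ∈ Set.Icc α β, ‖r₁ s‖ ≤ 6 * B * (G / θ) ^ 2 := fun s hs => by
      obtain ⟨k0, k1, k2⟩ := hbu s hs
      have m0 : ‖(g s : ℂ)‖ ≤ G / θ := by rw [Complex.norm_real]; exact hgu s hs
      have m1 : ‖(g₁ s : ℂ)‖ ≤ G / θ := by rw [Complex.norm_real]; exact hg₁u s hs
      have m2 : ‖(g₂ s : ℂ)‖ ≤ G / θ := by rw [Complex.norm_real]; exact hg₂u s hs
      have hGθ : 0 ≤ G / θ := by positivity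
      have mm {u v : ℂ} {U V : ℝ} (hu : ‖u‖ ≤ U) (hU : 0 ≤ U) (hv : ‖v‖ ≤ V) : ‖u * v‖ ≤ U * V := by
        rw [norm_mul]; exact mul_le_mul hu hv (norm_nonneg _) hU
      have l1 : ‖q₁ s‖ ≤ B * (G / θ) + B * (G / θ) :=
        (norm_add_le _ _).trans (add_le_add (mm k1 hB m0) (mm k0 hB m1))
      have l2 : ‖q₂ s‖ ≤ B * (G / θ) + B * (G / θ) + (B * (G / θ) + B * (G / θ)) :=
        (norm_add_le _ _).trans (add_le_add
          ((norm_add_le _ _).trans (add_le_add (mm k2 hB m0) (mm k1 hB m1)))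
          ((norm_add_le _ _).trans (add_le_add (mm k1 hB m1) (mm k0 hB m2))))
      refine ((norm_add_le _ _).trans (add_le_add (mm l2 (by positivity) m0)
        (mm l1 (by positivity) m1))).trans (le_of_eq ?_)
      ring
    have hfin := intervalIntegral.norm_integral_le_of_norm_le_const (a := α) (b := β)
      (C := 6 * B * (G / θ) ^ 2)
      (f := fun s => Complex.exp (Complex.I * ((μ * Φ s : ℝ) : ℂ)) * r₁ s) fun s hs => by
        rw [norm_mul, norm_cexp_phase, one_mul]; exact hr₁u s (hI hs)
    rw [abs_of_nonneg (sub_nonneg.2 hαβ)] at hfin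
    rw [e1, norm_mul, norm_mul, norm_div, Complex.norm_I, Complex.norm_real, Real.norm_eq_abs]
    calc _ ≤ 1 / |μ| * (1 / |μ| * (6 * B * (G / θ) ^ 2 * (β - α))) * (μ * θ) ^ 2 := by gcongr
      _ = (β - α) * B * (6 * G ^ 2) := by
        rw [mul_pow, ← sq_abs μ]
        have : |μ| ≠ 0 := abs_ne_zero.2 hμ
        field_simp
  -- Adding the trivial bound and the oscillatory one gives the factor `1 + (μθ)²` without
  -- separating cases.
  rw [← div_eq_mul_inv, le_div_iff₀ (by positivity)]
  nlinarith [htriv, hosc]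

/-! ### The `T T*` method and reduction to slices -/

section General

variable {X Y : Type*} [MeasureSpace X] [MeasureSpace Y]

/-- On a set of finite measure `L²` is contained in `L¹`. This supplies the absolute convergence
needed for Fubini below. -/
theorem integrable_indicator_of_memLp {J : Set Y} (hJ : MeasurableSet J)
    (hJf : volume J ≠ ⊤) {f : Y → ℂ} (hf2 : MemLp f 2 volume) :
    Integrable (J.indicator f) := by
  have : Fact (volume J < ⊤) := ⟨lt_top_iff_ne_top.2 hJf⟩
  rw [integrable_indicator_iff hJ]
  exact (hf2.restrict J).integrable (by norm_num)

/-- A bounded kernel supported over a set of finite measure in `y`. -/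
theorem integrable_kernel_mul {K : X → Y → ℂ} (hK : Measurable (Function.uncurry K)) {M : ℝ}
    (hM : ∀ x y, ‖K x y‖ ≤ M) {J : Set Y} (hJ : MeasurableSet J)
    (hJf : volume J ≠ ⊤) (hKJ : ∀ x y, y ∉ J → K x y = 0) {f : Y → ℂ}
    (hf2 : MemLp f 2 volume) (x : X) : Integrable fun y => K x y * f y := by
  have h : (fun y => K x y * f y) = fun y => K x y * J.indicator f y := by
    ext y
    by_cases hy : y ∈ J
    · rw [Set.indicator_of_mem hy]
    · rw [hKJ x y hy, zero_mul, zero_mul]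
  rw [h]
  exact (integrable_indicator_of_memLp hJ hJf hf2).bdd_mul
    (hK.comp measurable_prodMk_left).aestronglyMeasurable
    (Filter.Eventually.of_forall (hM x))

/-- The `T T*` method: an `L²` bound from a bound on the kernel `∫ K(x,y) conj K(x,y') dx`. -/
theorem kernelNormLE_of_conj_kernel [SigmaFinite (volume : Measure X)]
    [SigmaFinite (volume : Measure Y)] {K : X → Y → ℂ}
    (hK : Measurable (Function.uncurry K)) {M : ℝ}
    (hM : ∀ x y, ‖K x y‖ ≤ M) {I : Set X} (hI : MeasurableSet I) (hIf : volume I ≠ ⊤)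
    {J : Set Y} (hJ : MeasurableSet J)
    (hJf : volume J ≠ ⊤) (hKI : ∀ x y, x ∉ I → K x y = 0) (hKJ : ∀ x y, y ∉ J → K x y = 0)
    {H : Y → Y → ENNReal} (hH : Measurable (Function.uncurry H)) {B : ℝ} (hB : 0 ≤ B)
    (hKH : ∀ y y', ‖∫ x, K x y * conj (K x y')‖ₑ ≤ H y y')
    (hH1 : ∀ y, ∫⁻ y', H y y' ≤ ENNReal.ofReal B) (hH2 : ∀ y', ∫⁻ y, H y y' ≤ ENNReal.ofReal B) :
    KernelNormLE K (Real.sqrt B) := fun f hf hf2 => by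
  -- Truncating to `J` does not change the operator's value, and makes the triple integral for
  -- `|F|²` absolutely convergent.
  set g : Y → ℂ := J.indicator f with hg
  have hgm : Measurable g := hf.indicator hJ
  have hgi : Integrable g := integrable_indicator_of_memLp hJ hJf hf2
  set F : X → ℂ := fun x => ∫ y, K x y * g y with hF
  have hFf : (fun x => ∫ y, K x y * f y) = F := by
    ext x
    refine integral_congr_ae (Filter.Eventually.of_forall fun y => ?_)
    by_cases hy : y ∈ J
    · simp only [hg, Set.indicator_of_mem hy]
    · simp only [hKJ x y hy, zero_mul]
  rw [hFf]
  have hM0 : ∀ x y, ‖K x y‖ ≤ |M| := fun x y => (hM x y).trans (le_abs_self M)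
  have hprod : Integrable (Function.uncurry fun (x : X) (p : Y × Y) =>
      K x p.1 * conj (K x p.2) * (g p.1 * conj (g p.2))) := by
    have h1 : Integrable (fun q : X × Y × Y =>
        I.indicator (fun _ => (1 : ℂ)) q.1 * (g q.2.1 * conj (g q.2.2))) := by
      refine Integrable.mul_prod (f := I.indicator fun _ => (1 : ℂ))
        (g := fun p : Y × Y => g p.1 * conj (g p.2)) ?_ ?_
      · rw [integrable_indicator_iff hI]
        exact integrableOn_const hIf
      · refine Integrable.mul_prod (f := g) (g := fun y => conj (g y)) hgi ?_
        exact (Complex.conjCLE.integrable_comp_iff).2 hgi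
    have h2 : (Function.uncurry fun (x : X) (p : Y × Y) =>
        K x p.1 * conj (K x p.2) * (g p.1 * conj (g p.2))) = fun q : X × Y × Y =>
        (K q.1 q.2.1 * conj (K q.1 q.2.2)) *
          (I.indicator (fun _ => (1 : ℂ)) q.1 * (g q.2.1 * conj (g q.2.2))) := by
      ext ⟨x, y, y'⟩
      by_cases hx : x ∈ I
      · simp [Function.uncurry, Set.indicator_of_mem hx]
      · simp [Function.uncurry, hKI x _ hx]
    rw [h2]
    refine h1.bdd_mul (c := |M| * |M|) ?_ (Filter.Eventually.of_forall fun q => ?_)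
    · have k1 : Measurable fun q : X × Y × Y => K q.1 q.2.1 :=
        hK.comp (measurable_fst.prodMk (measurable_fst.comp measurable_snd))
      have k2 : Measurable fun q : X × Y × Y => K q.1 q.2.2 :=
        hK.comp (measurable_fst.prodMk (measurable_snd.comp measurable_snd))
      exact (k1.mul (Complex.continuous_conj.measurable.comp k2)).aestronglyMeasurable
    · rw [norm_mul, RCLike.norm_conj]
      exact mul_le_mul (hM0 _ _) (hM0 _ _) (norm_nonneg _) (abs_nonneg _)
  have hFF : ∀ x, F x * conj (F x) =
      ∫ p : Y × Y, K x p.1 * conj (K x p.2) * (g p.1 * conj (g p.2)) := fun x => by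
    rw [hF]
    simp only
    rw [← integral_conj, ← integral_prod_mul]
    refine integral_congr_ae (Filter.Eventually.of_forall fun p => ?_)
    simp only [map_mul]
    ring
  have hswap : ∫ x, F x * conj (F x) =
      ∫ p : Y × Y, (∫ x, K x p.1 * conj (K x p.2)) * (g p.1 * conj (g p.2)) := by
    simp only [hFF]
    rw [integral_integral_swap hprod]
    exact integral_congr_ae (Filter.Eventually.of_forall fun p => integral_mul_const _ _)
  have hFint : Integrable fun x => F x * conj (F x) := by
    simp only [hFF]
    exact hprod.integral_prod_left
  have hsq : ∀ x, F x * conj (F x) = ((‖F x‖ ^ 2 : ℝ) : ℂ) := fun x => by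
    rw [Complex.mul_conj, Complex.normSq_eq_norm_sq]
  have hl : ∫⁻ x, ‖F x‖ₑ ^ 2 = ‖∫ x, F x * conj (F x)‖ₑ := by
    have hi : Integrable fun x => ‖F x‖ ^ 2 := by
      have := hFint.norm
      simpa [hsq] using this
    simp only [hsq]
    rw [integral_complex_ofReal, ← ofReal_norm, Complex.norm_real,
      Real.norm_of_nonneg (integral_nonneg fun x => by positivity),
      ofReal_integral_eq_lintegral_ofReal hi (Filter.Eventually.of_forall fun x => by positivity)]
    refine lintegral_congr fun x => ?_
    rw [ENNReal.ofReal_pow (norm_nonneg _), ofReal_norm]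
  have hHS : (∫⁻ y, ‖g y‖ₑ * ∫⁻ y', H y y' * ‖g y'‖ₑ) ≤
      ENNReal.ofReal B * ∫⁻ y, ‖g y‖ₑ ^ 2 := by
    have h1 := lintegral_mul_sq_le volume (f := fun y => ‖g y‖ₑ)
      (g := fun y => ∫⁻ y', H y y' * ‖g y'‖ₑ) hgm.enorm.aemeasurable
      (Measurable.lintegral_prod_right (hH.mul (hgm.enorm.comp measurable_snd))).aemeasurable
    have h2 := lintegral_schur_test (volume : Measure Y) (volume : Measure Y) hH
      (v := fun _ => 1) measurable_const (w := fun _ => 1) measurable_const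
      (by simp) (A := ENNReal.ofReal B) (B := ENNReal.ofReal B)
      (Filter.Eventually.of_forall fun y => by simpa using hH1 y)
      (Filter.Eventually.of_forall fun y => by simpa using hH2 y) hgm.enorm
    refine (ENNReal.pow_right_strictMono two_ne_zero).le_iff_le.1 ?_
    refine h1.trans ((mul_le_mul' le_rfl h2).trans (le_of_eq ?_))
    ring
  refine eLpNorm_two_le_of_sq_le ?_
  rw [hl, hswap, ← ENNReal.ofReal_pow (Real.sqrt_nonneg B), Real.sq_sqrt hB]
  calc ‖∫ p : Y × Y, (∫ x, K x p.1 * conj (K x p.2)) * (g p.1 * conj (g p.2))‖ₑ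
      ≤ ∫⁻ p : Y × Y, ‖(∫ x, K x p.1 * conj (K x p.2)) * (g p.1 * conj (g p.2))‖ₑ :=
        enorm_integral_le_lintegral_enorm _
    _ ≤ ∫⁻ p : Y × Y, H p.1 p.2 * (‖g p.1‖ₑ * ‖g p.2‖ₑ) := by
        refine lintegral_mono fun p => ?_
        simp only [enorm_mul, RCLike.enorm_conj]
        exact mul_le_mul' (hKH _ _) le_rfl
    _ = ∫⁻ y, ∫⁻ y', H y y' * (‖g y‖ₑ * ‖g y'‖ₑ) := by
        refine lintegral_prod _ (Measurable.aemeasurable ?_)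
        exact hH.mul ((hgm.enorm.comp measurable_fst).mul (hgm.enorm.comp measurable_snd))
    _ = ∫⁻ y, ‖g y‖ₑ * ∫⁻ y', H y y' * ‖g y'‖ₑ := by
        refine lintegral_congr fun y => ?_
        rw [← lintegral_const_mul' _ _ enorm_ne_top]
        exact lintegral_congr fun y' => by ring
    _ ≤ ENNReal.ofReal B * ∫⁻ y, ‖g y‖ₑ ^ 2 := hHS
    _ ≤ ENNReal.ofReal B * ∫⁻ y, ‖f y‖ₑ ^ 2 := by
        gcongr with y
        exact enorm_indicator_le_enorm_self f y

end General

/-- An `L²` bound for a kernel in product variables from bounds for its slices. -/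
theorem KernelNormLE.of_slices {X₁ X₂ Y₁ Y₂ : Type*} [MeasureSpace X₁] [MeasureSpace X₂]
    [MeasureSpace Y₁] [MeasureSpace Y₂] [SigmaFinite (volume : Measure X₁)]
    [SigmaFinite (volume : Measure X₂)] [SigmaFinite (volume : Measure Y₁)]
    [SigmaFinite (volume : Measure Y₂)] {K : X₁ × X₂ → Y₁ × Y₂ → ℂ}
    (hK : Measurable (Function.uncurry K)) {M : ℝ} (hM : ∀ x y, ‖K x y‖ ≤ M)
    {I : Set X₂} (hI : MeasurableSet I) {J : Set Y₂} (hJ : MeasurableSet J)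
    {J₁ : Set Y₁} (hJ₁ : MeasurableSet J₁) (hJ₁f : volume J₁ ≠ ⊤)
    {a b : ℝ} (ha : 0 ≤ a) (hb : 0 ≤ b) (hIf : volume I ≤ ENNReal.ofReal (a ^ 2))
    (hJf : volume J ≤ ENNReal.ofReal (b ^ 2))
    (hKI : ∀ x y, x.2 ∉ I → K x y = 0) (hKJ : ∀ x y, y.2 ∉ J → K x y = 0)
    (hKJ₁ : ∀ x y, y.1 ∉ J₁ → K x y = 0) {A : ℝ}
    (h : ∀ x₂ ∈ I, ∀ y₂ ∈ J, KernelNormLE (fun x₁ y₁ => K (x₁, x₂) (y₁, y₂)) A) :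
    KernelNormLE K (a * b * A) := fun f hf hf2 => by
  have hJf' : volume J ≠ ⊤ := ne_top_of_le_ne_top ENNReal.ofReal_ne_top hJf
  have hint : ∀ x, Integrable fun y => K x y * f y :=
    integrable_kernel_mul hK hM (hJ₁.prod hJ)
      (by
        rw [Measure.volume_eq_prod, Measure.prod_prod]
        exact ENNReal.mul_ne_top hJ₁f hJf')
      (fun x y hy => by
        rw [Set.mem_prod, not_and_or] at hy
        exact hy.elim (hKJ₁ x y) (hKJ x y)) hf2
  set T : X₁ × X₂ → Y₂ → ℂ := fun x y₂ => ∫ y₁, K x (y₁, y₂) * f (y₁, y₂) with hT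
  have hTm : Measurable (Function.uncurry T) := by
    have h1 : Measurable (Function.uncurry fun (q : (X₁ × X₂) × Y₂) (y₁ : Y₁) =>
        K q.1 (y₁, q.2) * f (y₁, q.2)) := by
      have h2 : Measurable fun r : ((X₁ × X₂) × Y₂) × Y₁ => (r.2, r.1.2) :=
        measurable_snd.prodMk (measurable_snd.comp measurable_fst)
      exact (hK.comp ((measurable_fst.comp measurable_fst).prodMk h2)).mul (hf.comp h2)
    exact h1.stronglyMeasurable.integral_prod_right.measurable
  have hT0 : ∀ x y₂, y₂ ∉ J → T x y₂ = 0 := fun x y₂ hy => by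
    simp only [hT]
    simp [fun y₁ => hKJ x (y₁, y₂) hy]
  have hT0' : ∀ x y₂, x.2 ∉ I → T x y₂ = 0 := fun x y₂ hx => by
    simp only [hT]
    simp [fun y₁ => hKI x (y₁, y₂) hx]
  -- Cauchy–Schwarz in the frozen variable `y₂` against the indicator of `J` costs `volume J`. The
  -- frozen `x₂` costs `volume I` later, when a bound uniform in `x₂` is integrated over `I`.
  have hpt : ∀ x, ‖∫ y, K x y * f y‖ₑ ^ 2 ≤ ENNReal.ofReal (b ^ 2) * ∫⁻ y₂, ‖T x y₂‖ₑ ^ 2 := by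
    intro x
    have e1 : ∫ y, K x y * f y = ∫ y₂, T x y₂ := integral_prod_symm _ (hint x)
    have e2 : ∫⁻ y₂, ‖T x y₂‖ₑ = ∫⁻ y₂, J.indicator (fun _ => 1) y₂ * ‖T x y₂‖ₑ := by
      refine lintegral_congr fun y₂ => ?_
      by_cases hy : y₂ ∈ J
      · simp [hy]
      · simp [hT0 x y₂ hy]
    have e3 : ∫⁻ y₂, (J.indicator (fun _ => (1 : ENNReal)) y₂) ^ 2 = volume J := by
      rw [← lintegral_indicator_one hJ]
      refine lintegral_congr fun y₂ => ?_
      by_cases hy : y₂ ∈ J <;> simp [hy]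
    calc ‖∫ y, K x y * f y‖ₑ ^ 2 ≤ (∫⁻ y₂, ‖T x y₂‖ₑ) ^ 2 := by
          rw [e1]; gcongr; exact enorm_integral_le_lintegral_enorm _
      _ ≤ (∫⁻ y₂, (J.indicator (fun _ => (1 : ENNReal)) y₂) ^ 2) * ∫⁻ y₂, ‖T x y₂‖ₑ ^ 2 := by
          rw [e2]
          exact lintegral_mul_sq_le volume (measurable_const.indicator hJ).aemeasurable
            (hTm.comp measurable_prodMk_left).enorm.aemeasurable
      _ ≤ _ := by rw [e3]; gcongr
  have hTsq : Measurable (Function.uncurry fun x y₂ => ‖T x y₂‖ₑ ^ 2) := hTm.enorm.pow_const 2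
  have hf2' : ∫⁻ y, ‖f y‖ₑ ^ 2 = ∫⁻ y₂, ∫⁻ y₁, ‖f (y₁, y₂)‖ₑ ^ 2 :=
    lintegral_prod_symm' _ (hf.enorm.pow_const 2)
  have hf2ae : ∀ᵐ y₂, ∫⁻ y₁, ‖f (y₁, y₂)‖ₑ ^ 2 < ⊤ := by
    refine ae_lt_top ?_ ?_
    · exact Measurable.lintegral_prod_left (hf.enorm.pow_const 2)
    · rw [← hf2', ← eLpNorm_two_sq]
      exact ENNReal.pow_ne_top hf2.eLpNorm_ne_top
  have hslice : ∀ x₂ ∈ I, ∫⁻ x₁, ∫⁻ y₂, ‖T (x₁, x₂) y₂‖ₑ ^ 2 ≤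
      ENNReal.ofReal A ^ 2 * ∫⁻ y, ‖f y‖ₑ ^ 2 := by
    intro x₂ hx₂
    rw [lintegral_lintegral_swap (f := fun x₁ y₂ => ‖T (x₁, x₂) y₂‖ₑ ^ 2) (hTsq.comp
      ((measurable_fst.prodMk measurable_const).prodMk measurable_snd)).aemeasurable, hf2',
      ← lintegral_const_mul' _ _ (ENNReal.pow_ne_top ENNReal.ofReal_ne_top)]
    refine lintegral_mono_ae ?_
    filter_upwards [hf2ae] with y₂ hy₂
    by_cases hy : y₂ ∈ J
    · have hfm : Measurable fun y₁ => f (y₁, y₂) := hf.comp measurable_prodMk_right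
      have hfl : MemLp (fun y₁ => f (y₁, y₂)) 2 volume := by
        refine ⟨hfm.aestronglyMeasurable, ?_⟩
        rw [← eLpNorm_two_sq] at hy₂
        rw [lt_top_iff_ne_top]
        intro h3
        rw [h3] at hy₂
        simp at hy₂
      have := pow_le_pow_left₀ zero_le (h x₂ hx₂ y₂ hy _ hfm hfl) 2
      rwa [mul_pow, eLpNorm_two_sq, eLpNorm_two_sq] at this
    · simp [hT0 _ y₂ hy]
  refine eLpNorm_two_le_of_sq_le ?_
  calc ∫⁻ x, ‖∫ y, K x y * f y‖ₑ ^ 2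
      ≤ ∫⁻ x, ENNReal.ofReal (b ^ 2) * ∫⁻ y₂, ‖T x y₂‖ₑ ^ 2 := lintegral_mono hpt
    _ = ENNReal.ofReal (b ^ 2) * ∫⁻ x₂, ∫⁻ x₁, ∫⁻ y₂, ‖T (x₁, x₂) y₂‖ₑ ^ 2 := by
        rw [lintegral_const_mul' _ _ ENNReal.ofReal_ne_top]
        congr 1
        exact lintegral_prod_symm' _ (Measurable.lintegral_prod_right hTsq)
    _ ≤ ENNReal.ofReal (b ^ 2) * ∫⁻ x₂, I.indicator
          (fun _ => ENNReal.ofReal A ^ 2 * ∫⁻ y, ‖f y‖ₑ ^ 2) x₂ := by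
        refine mul_le_mul' le_rfl (lintegral_mono fun x₂ => ?_)
        by_cases hx : x₂ ∈ I
        · rw [Set.indicator_of_mem hx]; exact hslice x₂ hx
        · simp [fun x₁ y₂ => hT0' (x₁, x₂) y₂ hx]
    _ ≤ ENNReal.ofReal (b ^ 2) * ((ENNReal.ofReal A ^ 2 * ∫⁻ y, ‖f y‖ₑ ^ 2) *
          ENNReal.ofReal (a ^ 2)) := by
        rw [lintegral_indicator_const hI]
        gcongr
    _ = _ := by
        rw [ENNReal.ofReal_mul (by positivity), ENNReal.ofReal_mul ha, ENNReal.ofReal_pow ha,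
          ENNReal.ofReal_pow hb]
        ring

/-! ### One-dimensional oscillatory operators -/

/-- The quadratic decay of the `T T*` kernel makes it integrable with mass of order `1 / |μ|`; the
square root of this is the decay `|μ| ^ (-1/2)`. One integration by parts would lose a logarithm
here. -/
theorem lintegral_inv_one_add_sq_mul_sub {B μ : ℝ} (hB : 0 ≤ B) (hμ : μ ≠ 0) (t : ℝ) :
    ∫⁻ t' : ℝ, ENNReal.ofReal (B * (1 + (μ * |t - t'|) ^ 2)⁻¹) =
      ENNReal.ofReal (B * (Real.pi / |μ|)) := by
  have h1 : ∀ t' : ℝ, B * (1 + (μ * |t - t'|) ^ 2)⁻¹ = B * (1 + (μ * (t - t')) ^ 2)⁻¹ :=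
    fun t' => by rw [mul_pow, sq_abs, mul_pow]
  simp only [h1]
  have hi : Integrable fun t' : ℝ => (1 + (μ * (t - t')) ^ 2)⁻¹ :=
    ((integrable_inv_one_add_sq.comp_mul_left' hμ).comp_sub_left t)
  rw [← ofReal_integral_eq_lintegral_ofReal (hi.const_mul B)
    (Filter.Eventually.of_forall fun t' => by positivity), integral_const_mul,
    integral_sub_left_eq_self (fun u => (1 + (μ * u) ^ 2)⁻¹) volume t,
    Measure.integral_comp_mul_left (fun u => (1 + u ^ 2)⁻¹) μ, integral_univ_inv_one_add_sq,
    smul_eq_mul, abs_inv]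
  congr 2
  ring

/-- One-dimensional oscillatory integral operators whose phase has a nonvanishing mixed
derivative. -/
theorem kernelNormLE_oscillatory {α β γ κ μ c C A : ℝ} (hαβ : α ≤ β) (hc : 0 < c)
    (hC : 0 ≤ C) (hA : 0 ≤ A) (hμ : μ ≠ 0) {P P₁ P₂ P₃ : ℝ → ℝ → ℝ} {a a₁ a₂ : ℝ → ℝ → ℂ}
    (hK : Measurable (Function.uncurry fun s t =>
      Complex.exp (Complex.I * ((μ * P s t : ℝ) : ℂ)) * a s t))
    (has : ∀ s t, s ∉ Set.Icc α β → a s t = 0) (hat : ∀ s t, t ∉ Set.Icc γ κ → a s t = 0)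
    (ha : ∀ t ∈ Set.Icc γ κ, ∀ s ∈ Set.Icc α β, HasDerivAt (fun s => a s t) (a₁ s t) s)
    (ha₁ : ∀ t ∈ Set.Icc γ κ, ∀ s ∈ Set.Icc α β, HasDerivAt (fun s => a₁ s t) (a₂ s t) s)
    (ha₂ : ∀ t ∈ Set.Icc γ κ, ContinuousOn (fun s => a₂ s t) (Set.Icc α β))
    (hb : ∀ t ∈ Set.Icc γ κ, a α t = 0 ∧ a β t = 0 ∧ a₁ α t = 0 ∧ a₁ β t = 0)
    (hau : ∀ t ∈ Set.Icc γ κ, ∀ s ∈ Set.Icc α β, ‖a s t‖ ≤ A ∧ ‖a₁ s t‖ ≤ A ∧ ‖a₂ s t‖ ≤ A)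
    (hP : ∀ t ∈ Set.Icc γ κ, ∀ s ∈ Set.Icc α β, HasDerivAt (fun s => P s t) (P₁ s t) s)
    (hP₁ : ∀ t ∈ Set.Icc γ κ, ∀ s ∈ Set.Icc α β, HasDerivAt (fun s => P₁ s t) (P₂ s t) s)
    (hP₂ : ∀ t ∈ Set.Icc γ κ, ∀ s ∈ Set.Icc α β, HasDerivAt (fun s => P₂ s t) (P₃ s t) s)
    (hP₃ : ∀ t ∈ Set.Icc γ κ, ContinuousOn (fun s => P₃ s t) (Set.Icc α β))
    (hPl : ∀ t ∈ Set.Icc γ κ, ∀ t' ∈ Set.Icc γ κ, ∀ s ∈ Set.Icc α β,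
      c * |t - t'| ≤ |P₁ s t - P₁ s t'| ∧ |P₂ s t - P₂ s t'| ≤ C * |t - t'| ∧
        |P₃ s t - P₃ s t'| ≤ C * |t - t'|) :
    KernelNormLE (fun s t => Complex.exp (Complex.I * ((μ * P s t : ℝ) : ℂ)) * a s t)
      (Real.sqrt ((β - α) * 4 * (1 + 6 * (1 / c + C / c ^ 2 + 2 * C ^ 2 / c ^ 3) ^ 2) * Real.pi) *
        A * |μ| ^ (-(1 / 2) : ℝ)) := by
  set G := 1 / c + C / c ^ 2 + 2 * C ^ 2 / c ^ 3 with hG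
  have hβα : 0 ≤ β - α := sub_nonneg.2 hαβ
  -- The amplitude of the `T T*` kernel is `a(·, t) · conj a(·, t')`; its second derivative has four
  -- Leibniz terms, each at most `A²`.
  set B : ℝ := (β - α) * (4 * A ^ 2) * (1 + 6 * G ^ 2) with hB
  have hB0 : 0 ≤ B := by positivity
  have hμ0 : 0 < |μ| := abs_pos.2 hμ
  have hconst : Real.sqrt ((β - α) * 4 * (1 + 6 * G ^ 2) * Real.pi) * A * |μ| ^ (-(1 / 2) : ℝ) =
      Real.sqrt (B * (Real.pi / |μ|)) := by
    have h1 : B * (Real.pi / |μ|) =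
        ((β - α) * 4 * (1 + 6 * G ^ 2) * Real.pi) * A ^ 2 * |μ|⁻¹ := by
      rw [hB]; ring
    rw [h1, Real.sqrt_mul (x := _ * A ^ 2) (by positivity),
      Real.sqrt_mul (y := A ^ 2) (by positivity), Real.sqrt_sq hA,
      Real.rpow_neg hμ0.le, ← Real.sqrt_eq_rpow, Real.sqrt_inv]
  rw [hconst]
  have hnorm : ∀ s t, ‖Complex.exp (Complex.I * ((μ * P s t : ℝ) : ℂ)) * a s t‖ = ‖a s t‖ :=
    fun s t => by rw [norm_mul, norm_cexp_phase, one_mul]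
  refine kernelNormLE_of_conj_kernel hK (M := A) (fun s t => ?_) (I := Set.Icc α β)
    measurableSet_Icc (by simp) (J := Set.Icc γ κ) measurableSet_Icc (by simp)
    (fun s t hs => by rw [has s t hs, mul_zero]) (fun s t ht => by rw [hat s t ht, mul_zero])
    (H := fun t t' => ENNReal.ofReal (B * (1 + (μ * |t - t'|) ^ 2)⁻¹)) ?_ (by positivity)
    (fun t t' => ?_) (fun t => (lintegral_inv_one_add_sq_mul_sub hB0 hμ t).le) (fun t => ?_)
  · rw [hnorm]
    by_cases hs : s ∈ Set.Icc α β
    · by_cases ht : t ∈ Set.Icc γ κ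
      · exact (hau t ht s hs).1
      · simpa [hat s t ht] using hA
    · simpa [has s t hs] using hA
  · refine Measurable.ennreal_ofReal (Continuous.measurable ?_)
    refine continuous_const.mul (Continuous.inv₀ ?_ fun p => by positivity)
    fun_prop
  · rw [← ofReal_norm]
    refine ENNReal.ofReal_le_ofReal ?_
    by_cases ht : t ∈ Set.Icc γ κ
    swap
    · simp only [hat _ t ht, mul_zero, zero_mul, integral_zero, norm_zero]; positivity
    by_cases ht' : t' ∈ Set.Icc γ κ
    swap
    · simp only [hat _ t' ht', mul_zero, map_zero, integral_zero, norm_zero]; positivity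
    have hcj {f : ℝ → ℂ} {f' : ℂ} {s : ℝ} (hf : HasDerivAt f f' s) :
        HasDerivAt (fun s => conj (f s)) (conj f') s := hf.star
    have e1 : ∫ s, Complex.exp (Complex.I * ((μ * P s t : ℝ) : ℂ)) * a s t *
        conj (Complex.exp (Complex.I * ((μ * P s t' : ℝ) : ℂ)) * a s t') =
        ∫ s in α..β, Complex.exp (Complex.I * ((μ * (P s t - P s t') : ℝ) : ℂ)) *
          (a s t * conj (a s t')) := by
      rw [intervalIntegral.integral_of_le hαβ, ← integral_Icc_eq_integral_Ioc,
        setIntegral_eq_integral_of_forall_compl_eq_zero fun s hs => by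
          rw [has s t hs, zero_mul, mul_zero]]
      refine integral_congr_ae (Filter.Eventually.of_forall fun s => ?_)
      simp only [map_mul, ← Complex.exp_conj, Complex.conj_I, Complex.conj_ofReal]
      have : Complex.exp (Complex.I * ((μ * (P s t - P s t') : ℝ) : ℂ)) =
          Complex.exp (Complex.I * ((μ * P s t : ℝ) : ℂ)) *
            Complex.exp (-Complex.I * ((μ * P s t' : ℝ) : ℂ)) := by
        rw [← Complex.exp_add]; congr 1; push_cast; ring
      rw [this]; ring
    rw [e1]
    refine (norm_integral_cexp_phase_le hαβ hc hC (abs_nonneg (t - t')) (B := 4 * A ^ 2)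
      (by positivity) (Φ := fun s => P s t - P s t') (p := fun s => P₁ s t - P₁ s t')
      (p₁ := fun s => P₂ s t - P₂ s t') (p₂ := fun s => P₃ s t - P₃ s t')
      (b := fun s => a s t * conj (a s t'))
      (b₁ := fun s => a₁ s t * conj (a s t') + a s t * conj (a₁ s t'))
      (b₂ := fun s => a₂ s t * conj (a s t') + a₁ s t * conj (a₁ s t') +
        (a₁ s t * conj (a₁ s t') + a s t * conj (a₂ s t')))
      (fun s hs => (hP t ht s hs).sub (hP t' ht' s hs))
      (fun s hs => (hP₁ t ht s hs).sub (hP₁ t' ht' s hs))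
      (fun s hs => (hP₂ t ht s hs).sub (hP₂ t' ht' s hs))
      ((hP₃ t ht).sub (hP₃ t' ht'))
      (fun s hs => (ha t ht s hs).mul (hcj (ha t' ht' s hs)))
      (fun s hs => ((ha₁ t ht s hs).mul (hcj (ha t' ht' s hs))).add
        ((ha t ht s hs).mul (hcj (ha₁ t' ht' s hs)))) ?_ ?_ ?_ ?_ ?_
      (fun s hs => (hPl t ht t' ht' s hs).1)
      (fun s hs => (hPl t ht t' ht' s hs).2.1)
      (fun s hs => (hPl t ht t' ht' s hs).2.2) ?_)
    · have cont {f f' : ℝ → ℂ} (h : ∀ s ∈ Set.Icc α β, HasDerivAt f (f' s) s) :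
          ContinuousOn f (Set.Icc α β) := fun s hs => (h s hs).continuousAt.continuousWithinAt
      have hcc {f : ℝ → ℂ} (h : ContinuousOn f (Set.Icc α β)) :
          ContinuousOn (fun s => conj (f s)) (Set.Icc α β) :=
        Complex.continuous_conj.comp_continuousOn h
      exact (((ha₂ t ht).mul (hcc (cont (ha t' ht')))).add
        ((cont (ha₁ t ht)).mul (hcc (cont (ha₁ t' ht'))))).add
        (((cont (ha₁ t ht)).mul (hcc (cont (ha₁ t' ht')))).add
        ((cont (ha t ht)).mul (hcc (ha₂ t' ht'))))
    · simp [(hb t ht).1]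
    · simp [(hb t ht).2.1]
    · simp [(hb t ht).1, (hb t ht).2.2.1]
    · simp [(hb t ht).2.1, (hb t ht).2.2.2]
    · intro s hs
      obtain ⟨u0, u1, u2⟩ := hau t ht s hs
      obtain ⟨v0, v1, v2⟩ := hau t' ht' s hs
      have mm {u v : ℂ} (hu : ‖u‖ ≤ A) (hv : ‖v‖ ≤ A) : ‖u * conj v‖ ≤ A ^ 2 := by
        rw [norm_mul, RCLike.norm_conj, sq]; exact mul_le_mul hu hv (norm_nonneg _) hA
      have hA2 : 0 ≤ A ^ 2 := by positivity
      refine ⟨(mm u0 v0).trans (by linarith), ?_, ?_⟩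
      · exact (norm_add_le_of_le (mm u1 v0) (mm u0 v1)).trans (by linarith)
      · exact (norm_add_le_of_le (norm_add_le_of_le (mm u2 v0) (mm u1 v1))
          (norm_add_le_of_le (mm u1 v1) (mm u0 v2))).trans (by linarith)
  · simp only [fun y : ℝ => abs_sub_comm y t]
    exact (lintegral_inv_one_add_sq_mul_sub hB0 hμ t).le

theorem KernelNormLE.of_measurePreserving {X X' Y Y' : Type*} [MeasureSpace X] [MeasureSpace X']
    [MeasureSpace Y] [MeasureSpace Y'] (e : X ≃ᵐ X') (he : MeasurePreserving e) (g : Y ≃ᵐ Y')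
    (hg : MeasurePreserving g) [SFinite (volume : Measure Y)] {K : X → Y → ℂ}
    (hK : Measurable (Function.uncurry K)) {A : ℝ}
    (h : KernelNormLE (fun x y => K (e.symm x) (g.symm y)) A) :
    KernelNormLE K A := fun f hf hf2 => by
  have hg' : MeasurePreserving g.symm := hg.symm g
  have he' : MeasurePreserving e.symm := he.symm e
  have h1 := h (f ∘ g.symm) (hf.comp g.symm.measurable) (hf2.comp_measurePreserving hg')
  rw [eLpNorm_comp_measurePreserving hf2.aestronglyMeasurable hg'] at h1
  have h2 : (fun x => ∫ y, K (e.symm x) (g.symm y) * (f ∘ g.symm) y) =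
      (fun x => ∫ y, K x y * f y) ∘ e.symm := by
    ext x
    exact hg'.integral_comp' (g := fun y => K (e.symm x) y * f y)
  rwa [h2, eLpNorm_comp_measurePreserving
    (measurable_integral_kernel hK hf).aestronglyMeasurable he'] at h1

/-- Mean value theorem. Applied in `t` to `s`-derivatives of the phase, it turns bounds on mixed
derivatives into comparability with `θ = |t - t'|`. -/
theorem mul_abs_sub_le_abs_sub {f f' : ℝ → ℝ} {γ κ : ℝ}
    (hf : ∀ t ∈ Set.Icc γ κ, HasDerivAt f (f' t) t) {c C : ℝ}
    (hc : ∀ t ∈ Set.Icc γ κ, c ≤ |f' t| ∧ |f' t| ≤ C) {t t' : ℝ} (ht : t ∈ Set.Icc γ κ)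
    (ht' : t' ∈ Set.Icc γ κ) :
    c * |t - t'| ≤ |f t - f t'| ∧ |f t - f t'| ≤ C * |t - t'| := by
  wlog hlt : t < t' generalizing t t'
  · rcases eq_or_lt_of_le (not_lt.1 hlt) with h | h
    · simp [h]
    · have := this ht' ht h
      rwa [abs_sub_comm t t', abs_sub_comm (f t)]
  have hsub : Set.Icc t t' ⊆ Set.Icc γ κ := Set.Icc_subset_Icc ht.1 ht'.2
  obtain ⟨ξ, hξ, hξ'⟩ := exists_hasDerivAt_eq_slope f f' hlt
    (fun u hu => (hf u (hsub hu)).continuousAt.continuousWithinAt)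
    (fun u hu => hf u (hsub (Set.Ioo_subset_Icc_self hu)))
  have hpos : 0 < t' - t := sub_pos.2 hlt
  have h1 : |f t - f t'| = |f' ξ| * |t - t'| := by
    rw [hξ', abs_div, abs_sub_comm t, abs_sub_comm (f t), div_mul_cancel₀]
    exact (abs_pos.2 hpos.ne').ne'
  obtain ⟨k1, k2⟩ := hc ξ (hsub (Set.Ioo_subset_Icc_self hξ))
  rw [h1]
  exact ⟨by gcongr, by gcongr⟩

/-! ### Polynomials and kernels along coordinate lines -/

section Polynomial

theorem hasDerivAt_eval_of_coord {σ : Type*} [DecidableEq σ] (P : MvPolynomial σ ℝ) (a : σ)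
    {v : ℝ → σ → ℝ} {s : ℝ} (hv : ∀ k, HasDerivAt (fun s => v s k) (if k = a then 1 else 0) s) :
    HasDerivAt (fun s => MvPolynomial.eval (v s) P)
      (MvPolynomial.eval (v s) (MvPolynomial.pderiv a P)) s := by
  induction P using MvPolynomial.induction_on with
  | C r => simpa using hasDerivAt_const s r
  | add p q hp hq =>
    simp only [map_add]
    exact hp.add hq
  | mul_X p k hp =>
    simp only [map_mul, MvPolynomial.eval_X]
    refine (hp.mul (hv k)).congr_deriv ?_
    rw [Derivation.leibniz, MvPolynomial.pderiv_X]
    by_cases h : k = a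
    · subst h; simp; ring
    · simp [h]; ring

variable {m n : ℕ}

theorem continuous_polyEval (P : MvPolynomial (Fin m ⊕ Fin n) ℝ) :
    Continuous fun v : (Fin m → ℝ) × (Fin n → ℝ) => polyEval P v.1 v.2 := by
  refine P.continuous_eval.comp (continuous_pi fun k => ?_)
  cases k with
  | inl k => exact (continuous_apply k).comp continuous_fst
  | inr k => exact (continuous_apply k).comp continuous_snd

theorem hasDerivAt_insertNth (i : Fin (m + 1)) (x' : Fin m → ℝ) (s : ℝ) (k : Fin (m + 1)) :
    HasDerivAt (fun s => (i.insertNth s x' : Fin (m + 1) → ℝ) k) (if k = i then 1 else 0) s := by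
  rcases Fin.eq_self_or_eq_succAbove i k with rfl | ⟨l, rfl⟩
  · simpa using hasDerivAt_id' s
  · simpa using hasDerivAt_const s (x' l)

theorem hasDerivAt_polyEval_inl (P : MvPolynomial (Fin (m + 1) ⊕ Fin n) ℝ) (i : Fin (m + 1))
    (x' : Fin m → ℝ) (y : Fin n → ℝ) (s : ℝ) :
    HasDerivAt (fun s => polyEval P (i.insertNth s x') y)
      (polyEval (MvPolynomial.pderiv (Sum.inl i) P) (i.insertNth s x') y) s := by
  refine hasDerivAt_eval_of_coord P (Sum.inl i)
    (v := fun s => Sum.elim (i.insertNth s x' : Fin (m + 1) → ℝ) y) fun k => ?_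
  cases k with
  | inl k => simpa using hasDerivAt_insertNth i x' s k
  | inr k => simpa using hasDerivAt_const s (y k)

theorem hasDerivAt_polyEval_inr (P : MvPolynomial (Fin m ⊕ Fin (n + 1)) ℝ) (j : Fin (n + 1))
    (x : Fin m → ℝ) (y' : Fin n → ℝ) (t : ℝ) :
    HasDerivAt (fun t => polyEval P x (j.insertNth t y'))
      (polyEval (MvPolynomial.pderiv (Sum.inr j) P) x (j.insertNth t y')) t := by
  refine hasDerivAt_eval_of_coord P (Sum.inr j)
    (v := fun t => Sum.elim x (j.insertNth t y' : Fin (n + 1) → ℝ)) fun k => ?_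
  cases k with
  | inl k => simpa using hasDerivAt_const t (x k)
  | inr k => simpa using hasDerivAt_insertNth j y' t k

/-- Balls of the sup norm are boxes, so the interval allowed for the distinguished coordinate does
not depend on the frozen ones. -/
theorem insertNth_mem_closedBall {i : Fin (m + 1)} {s ε : ℝ} (hε : 0 ≤ ε) {x' : Fin m → ℝ}
    {x₀ : Fin (m + 1) → ℝ} :
    (i.insertNth s x' : Fin (m + 1) → ℝ) ∈ Metric.closedBall x₀ ε ↔
      s ∈ Set.Icc (x₀ i - ε) (x₀ i + ε) ∧
        x' ∈ Metric.closedBall (fun k => x₀ (i.succAbove k)) ε := by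
  rw [closedBall_pi _ hε, closedBall_pi _ hε, ← Real.closedBall_eq_Icc]
  simp only [Set.mem_pi, Set.mem_univ, true_implies]
  rw [Fin.forall_iff_succAbove i]
  simp

end Polynomial

/-- The commutator of two derivations is a derivation, and this one kills every variable. -/
theorem pderiv_pderiv_comm {σ : Type*} (i j : σ) (P : MvPolynomial σ ℝ) :
    MvPolynomial.pderiv i (MvPolynomial.pderiv j P) =
      MvPolynomial.pderiv j (MvPolynomial.pderiv i P) := by
  classical
  have h : ⁅(MvPolynomial.pderiv i : Derivation ℝ (MvPolynomial σ ℝ) (MvPolynomial σ ℝ)),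
      (MvPolynomial.pderiv j : Derivation ℝ (MvPolynomial σ ℝ) (MvPolynomial σ ℝ))⁆ = 0 := by
    refine MvPolynomial.derivation_ext fun k => ?_
    rw [Derivation.commutator_apply]
    simp only [MvPolynomial.pderiv_X, Pi.single_apply]
    split_ifs <;> simp
  have h2 := congrArg (fun d => d P) h
  simpa [Derivation.commutator_apply, sub_eq_zero] using h2

section

variable {m n : ℕ}

theorem measurable_dampedKernel (S D : MvPolynomial (Fin m ⊕ Fin n) ℝ)
    {φ : (Fin m → ℝ) × (Fin n → ℝ) → ℂ} (hφ : Measurable φ) (lam : ℝ) (z : ℂ) :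
    Measurable (Function.uncurry (dampedKernel S D φ lam z)) := by
  have hS := (continuous_polyEval S).measurable
  have hD := (continuous_polyEval D).measurable
  have h1 : Measurable fun v : (Fin m → ℝ) × (Fin n → ℝ) =>
      Complex.exp (Complex.I * ((lam * polyEval S v.1 v.2 : ℝ) : ℂ)) :=
    Complex.measurable_exp.comp
      ((Complex.measurable_ofReal.comp (hS.const_mul lam)).const_mul Complex.I)
  have h2 : Measurable fun v : (Fin m → ℝ) × (Fin n → ℝ) =>
      ((|polyEval D v.1 v.2| : ℝ) : ℂ) ^ z :=
    (Complex.measurable_ofReal.comp hD.abs).pow_const z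
  exact (h1.mul h2).mul hφ

/-- Since `Real.log` ignores signs, `|D| ^ z` becomes `exp (z log D)`, which can be differentiated
without absolute values. At zeros of `D` the two forms may differ, but there the amplitude vanishes.
-/
theorem dampedKernel_eq_exp {S D : MvPolynomial (Fin m ⊕ Fin n) ℝ}
    {φ : (Fin m → ℝ) × (Fin n → ℝ) → ℂ} {lam : ℝ} {z : ℂ} {x : Fin m → ℝ} {y : Fin n → ℝ}
    (h : polyEval D x y = 0 → φ (x, y) = 0) :
    dampedKernel S D φ lam z x y = Complex.exp (Complex.I * ((lam * polyEval S x y : ℝ) : ℂ)) *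
      (Complex.exp (z * (Real.log (polyEval D x y) : ℂ)) * φ (x, y)) := by
  unfold dampedKernel
  by_cases hD : polyEval D x y = 0
  · simp [h hD]
  · have h0 : ((|polyEval D x y| : ℝ) : ℂ) ≠ 0 := by
      exact_mod_cast (abs_pos.2 hD).ne'
    rw [Complex.cpow_def_of_ne_zero h0, ← Complex.ofReal_log (abs_nonneg _), Real.log_abs,
      mul_comm z, mul_assoc]

end

/-- The first two derivatives of `e^{zL} h` along a curve, and their size. -/
theorem amplitude_bound {z : ℂ} {L L₁ L₂ b σ : ℝ} {h h₁ h₂ : ℂ} (hb : 1 ≤ b)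
    (hz : |z.re| ≤ σ) (hL : |L| ≤ b) (hL₁ : |L₁| ≤ b) (hL₂ : |L₂| ≤ b)
    (hh : ‖h‖ ≤ b) (hh₁ : ‖h₁‖ ≤ b) (hh₂ : ‖h₂‖ ≤ b) :
    ‖Complex.exp (z * L) * h‖ ≤ Real.exp (σ * b) * (2 * b ^ 3 * (1 + ‖z‖) ^ 2) ∧
    ‖Complex.exp (z * L) * (z * L₁ * h + h₁)‖ ≤
      Real.exp (σ * b) * (2 * b ^ 3 * (1 + ‖z‖) ^ 2) ∧
    ‖Complex.exp (z * L) * (z * L₁ * (z * L₁ * h + h₁) + (z * L₂ * h + z * L₁ * h₁ + h₂))‖ ≤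
      Real.exp (σ * b) * (2 * b ^ 3 * (1 + ‖z‖) ^ 2) := by
  have hE : ‖Complex.exp (z * L)‖ ≤ Real.exp (σ * b) := by
    rw [Complex.norm_exp]
    refine Real.exp_le_exp.2 ?_
    have : (z * L).re = z.re * L := by simp
    rw [this]
    refine (le_abs_self _).trans ?_
    rw [abs_mul]
    exact mul_le_mul hz hL (abs_nonneg _) ((abs_nonneg _).trans hz)
  have hb0 : 0 ≤ b := by linarith
  set Z := ‖z‖ with hZ
  have hZ0 : 0 ≤ Z := norm_nonneg z
  have nL₁ : ‖(L₁ : ℂ)‖ ≤ b := by rw [Complex.norm_real]; exact hL₁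
  have nL₂ : ‖(L₂ : ℂ)‖ ≤ b := by rw [Complex.norm_real]; exact hL₂
  have mm {u v : ℂ} {U V : ℝ} (hU : 0 ≤ U) (hu : ‖u‖ ≤ U) (hv : ‖v‖ ≤ V) : ‖u * v‖ ≤ U * V := by
    rw [norm_mul]; exact mul_le_mul hu hv (norm_nonneg _) hU
  have zL₁ : ‖z * L₁‖ ≤ Z * b := mm hZ0 le_rfl nL₁
  have zL₂ : ‖z * L₂‖ ≤ Z * b := mm hZ0 le_rfl nL₂
  have hZb : 0 ≤ Z * b := by positivity
  have t1 : ‖z * L₁ * h + h₁‖ ≤ Z * b * b + b := norm_add_le_of_le (mm hZb zL₁ hh) hh₁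
  have b12 : b ≤ b ^ 2 := by nlinarith
  have b23 : b ^ 2 ≤ b ^ 3 := by nlinarith [sq_nonneg b]
  have hZb2 : Z * b ^ 2 ≤ Z * b ^ 3 := by gcongr
  have hZZ : 0 ≤ Z ^ 2 * b ^ 3 := by positivity
  have hZ3 : 0 ≤ Z * b ^ 3 := by positivity
  have fin : 2 * b ^ 3 * (1 + Z) ^ 2 = 2 * b ^ 3 + 4 * (Z * b ^ 3) + 2 * (Z ^ 2 * b ^ 3) := by ring
  refine ⟨mm (by positivity) hE (hh.trans ?_), mm (by positivity) hE (t1.trans ?_),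
    mm (by positivity) hE ((norm_add_le_of_le (mm hZb zL₁ t1)
      (norm_add_le_of_le (norm_add_le_of_le (mm hZb zL₂ hh) (mm hZb zL₁ hh₁)) hh₂)).trans ?_)⟩
  · rw [fin]; nlinarith
  · rw [fin]; nlinarith
  · rw [fin]; nlinarith

/-- The form `e^{zL} h` is stable under differentiation, so this one rule yields both derivatives of
the amplitude; each costs one factor of `z`. -/
theorem hasDerivAt_amplitude {z : ℂ} {L L₁ : ℝ → ℝ} {h h₁ : ℝ → ℂ} {s : ℝ}
    (hL : HasDerivAt L (L₁ s) s) (hh : HasDerivAt h (h₁ s) s) :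
    HasDerivAt (fun s => Complex.exp (z * L s) * h s)
      (Complex.exp (z * L s) * (z * L₁ s * h s + h₁ s)) s := by
  refine (((hL.ofReal_comp.const_mul z).cexp).mul hh).congr_deriv ?_
  ring

/-! ### Slices of the kernel over a box -/

section Box

attribute [local irreducible] polyEval

variable {m n : ℕ}

/-- The derivative in the variable `x_i` of a function of `(r, x, y)`. -/
def partialX (i : Fin m) (h : ℝ × (Fin m → ℝ) × (Fin n → ℝ) → ℂ) :
    ℝ × (Fin m → ℝ) × (Fin n → ℝ) → ℂ :=
  fun q => fderiv ℝ h q (0, (Pi.single i 1, 0))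

theorem contDiff_partialX (i : Fin m) {h : ℝ × (Fin m → ℝ) × (Fin n → ℝ) → ℂ}
    (hh : ContDiff ℝ ∞ h) : ContDiff ℝ ∞ (partialX i h) :=
  (hh.fderiv_right (by simp)).clm_apply contDiff_const

theorem partialX_eq_zero (i : Fin m) {h : ℝ × (Fin m → ℝ) × (Fin n → ℝ) → ℂ}
    {T : Set ((Fin m → ℝ) × (Fin n → ℝ))} (hT : IsClosed T) (hhT : ∀ r, ∀ v ∉ T, h (r, v) = 0)
    (r : ℝ) (v : (Fin m → ℝ) × (Fin n → ℝ)) (hv : v ∉ T) : partialX i h (r, v) = 0 := by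
  have hev : h =ᶠ[nhds (r, v)] fun _ => 0 := by
    have : (Prod.snd ⁻¹' Tᶜ : Set (ℝ × (Fin m → ℝ) × (Fin n → ℝ))) ∈
        nhds (r, v) := (hT.isOpen_compl.preimage continuous_snd).mem_nhds hv
    filter_upwards [this] with q hq using hhT q.1 q.2 hq
  unfold partialX
  rw [hev.fderiv_eq]
  simp

theorem hasDerivAt_insertNth_partialX (i : Fin (m + 1))
    {g : ℝ × (Fin (m + 1) → ℝ) × (Fin n → ℝ) → ℂ} (hg : ContDiff ℝ ∞ g) (r : ℝ)
    (x' : Fin m → ℝ) (y : Fin n → ℝ) (s : ℝ) :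
    HasDerivAt (fun s => g (r, (i.insertNth s x', y)))
      (partialX i g (r, (i.insertNth s x', y))) s := by
  have hVd : HasDerivAt (fun s => (r, ((i.insertNth s x' : Fin (m + 1) → ℝ), y)))
      (0, (Pi.single i 1, 0)) s := by
    refine (hasDerivAt_const s r).prodMk (HasDerivAt.prodMk ?_ (hasDerivAt_const s _))
    refine hasDerivAt_pi.2 fun k => ?_
    rw [Pi.single_apply]
    exact hasDerivAt_insertNth i x' s k
  exact ((hg.differentiable (by simp)) _).hasFDerivAt.comp_hasDerivAt s hVd

theorem continuous_insertNth_left (i : Fin (m + 1)) (x' : Fin m → ℝ) :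
    Continuous fun s : ℝ => (i.insertNth s x' : Fin (m + 1) → ℝ) := by
  refine continuous_pi fun k => ?_
  rw [continuous_iff_continuousAt]
  exact fun s => (hasDerivAt_insertNth i x' s k).continuousAt

/-- Normalising bounds to be at least one lets them be merged by addition and lets a higher power of
the bound absorb a lower one. -/
theorem exists_bound_one_le {X : Type*} [TopologicalSpace X] {Q : Set X}
    (hQ : IsCompact Q) {f : X → ℝ} (hf : ContinuousOn f Q) :
    ∃ b : ℝ, 1 ≤ b ∧ ∀ v ∈ Q, |f v| ≤ b := by
  obtain ⟨b, hb⟩ := hQ.exists_bound_of_continuousOn hf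
  exact ⟨1 + |b|, by linarith [abs_nonneg b], fun v hv =>
    (hb v hv).trans (by linarith [le_abs_self b])⟩

/-- The quantities controlling the kernel `e^{iμS} |D|^z h` on a box, in the directions `x_i` and
`y_j`: lower bound `c` for the mixed derivative of the phase and upper bound `b` for the rest. -/
structure BoxBounds (S D : MvPolynomial (Fin m ⊕ Fin n) ℝ) (i : Fin m) (j : Fin n)
    (Q : Set ((Fin m → ℝ) × (Fin n → ℝ))) (c b : ℝ) : Prop where
  pos : 0 < c
  one_le : 1 ≤ b
  ne_zero : ∀ x y, (x, y) ∈ Q → polyEval D x y ≠ 0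
  log_le : ∀ x y, (x, y) ∈ Q → |Real.log (polyEval D x y)| ≤ b
  log_deriv_le : ∀ x y, (x, y) ∈ Q →
    |polyEval (MvPolynomial.pderiv (Sum.inl i) D) x y / polyEval D x y| ≤ b
  log_deriv_two_le : ∀ x y, (x, y) ∈ Q →
    |(polyEval (MvPolynomial.pderiv (Sum.inl i) (MvPolynomial.pderiv (Sum.inl i) D)) x y *
      polyEval D x y - polyEval (MvPolynomial.pderiv (Sum.inl i) D) x y *
      polyEval (MvPolynomial.pderiv (Sum.inl i) D) x y) / polyEval D x y ^ 2| ≤ b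
  le_mixed : ∀ x y, (x, y) ∈ Q → c ≤ |polyEval (MvPolynomial.pderiv (Sum.inr j)
    (MvPolynomial.pderiv (Sum.inl i) S)) x y|
  mixed_le : ∀ x y, (x, y) ∈ Q → |polyEval (MvPolynomial.pderiv (Sum.inr j)
    (MvPolynomial.pderiv (Sum.inl i) S)) x y| ≤ b
  mixed_two_le : ∀ x y, (x, y) ∈ Q → |polyEval (MvPolynomial.pderiv (Sum.inr j)
    (MvPolynomial.pderiv (Sum.inl i) (MvPolynomial.pderiv (Sum.inl i) S))) x y| ≤ b
  mixed_three_le : ∀ x y, (x, y) ∈ Q → |polyEval (MvPolynomial.pderiv (Sum.inr j)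
    (MvPolynomial.pderiv (Sum.inl i) (MvPolynomial.pderiv (Sum.inl i)
      (MvPolynomial.pderiv (Sum.inl i) S)))) x y| ≤ b

theorem exists_boxBounds {S D : MvPolynomial (Fin m ⊕ Fin n) ℝ} {i : Fin m} {j : Fin n}
    {Q : Set ((Fin m → ℝ) × (Fin n → ℝ))} (hQ : IsCompact Q) (hQ0 : Q.Nonempty)
    (hS : ∀ v ∈ Q, polyEval (MvPolynomial.pderiv (Sum.inl i)
      (MvPolynomial.pderiv (Sum.inr j) S)) v.1 v.2 ≠ 0)
    (hD : ∀ v ∈ Q, polyEval D v.1 v.2 ≠ 0) :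
    ∃ c b, BoxBounds S D i j Q c b := by
  have ev := fun P : MvPolynomial (Fin m ⊕ Fin n) ℝ => continuous_polyEval P
  rw [pderiv_pderiv_comm] at hS
  obtain ⟨v₀, hv₀, hmin⟩ := hQ.exists_isMinOn hQ0
    (ev (MvPolynomial.pderiv (Sum.inr j) (MvPolynomial.pderiv (Sum.inl i) S))).abs.continuousOn
  have cD := (ev D).continuousOn (s := Q)
  obtain ⟨b₁, h1, hb₁⟩ := exists_bound_one_le hQ
    (f := fun v => Real.log (polyEval D v.1 v.2)) (cD.log hD)
  obtain ⟨b₂, h2, hb₂⟩ := exists_bound_one_le hQ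
    (f := fun v => polyEval (MvPolynomial.pderiv (Sum.inl i) D) v.1 v.2 / polyEval D v.1 v.2)
    ((ev (MvPolynomial.pderiv (Sum.inl i) D)).continuousOn.div cD hD)
  obtain ⟨b₃, h3, hb₃⟩ := exists_bound_one_le hQ
    (f := fun v => (polyEval (MvPolynomial.pderiv (Sum.inl i)
        (MvPolynomial.pderiv (Sum.inl i) D)) v.1 v.2 *
      polyEval D v.1 v.2 - polyEval (MvPolynomial.pderiv (Sum.inl i) D) v.1 v.2 *
      polyEval (MvPolynomial.pderiv (Sum.inl i) D) v.1 v.2) / polyEval D v.1 v.2 ^ 2)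
    ((((ev (MvPolynomial.pderiv (Sum.inl i) (MvPolynomial.pderiv (Sum.inl i) D))).mul
      (ev D)).sub ((ev (MvPolynomial.pderiv (Sum.inl i) D)).mul
      (ev (MvPolynomial.pderiv (Sum.inl i) D)))).continuousOn.div (cD.pow 2)
        fun v hv => pow_ne_zero 2 (hD v hv))
  have hP := fun P : MvPolynomial (Fin m ⊕ Fin n) ℝ =>
    exists_bound_one_le hQ (ev P).continuousOn
  obtain ⟨b₄, h4, hb₄⟩ := hP (MvPolynomial.pderiv (Sum.inr j) (MvPolynomial.pderiv (Sum.inl i) S))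
  obtain ⟨b₅, h5, hb₅⟩ := hP (MvPolynomial.pderiv (Sum.inr j)
    (MvPolynomial.pderiv (Sum.inl i) (MvPolynomial.pderiv (Sum.inl i) S)))
  obtain ⟨b₆, h6, hb₆⟩ := hP (MvPolynomial.pderiv (Sum.inr j)
    (MvPolynomial.pderiv (Sum.inl i) (MvPolynomial.pderiv (Sum.inl i)
      (MvPolynomial.pderiv (Sum.inl i) S))))
  obtain ⟨b, hb⟩ : ∃ b, b = b₁ + b₂ + b₃ + b₄ + b₅ + b₆ := ⟨_, rfl⟩
  have k : 1 ≤ b ∧ b₁ ≤ b ∧ b₂ ≤ b ∧ b₃ ≤ b ∧ b₄ ≤ b ∧ b₅ ≤ b ∧ b₆ ≤ b := by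
    refine ⟨?_, ?_, ?_, ?_, ?_, ?_, ?_⟩ <;> linarith
  obtain ⟨k0, k1, k2, k3, k4, k5, k6⟩ := k
  exact ⟨_, b,
    { pos := abs_pos.2 (hS v₀ hv₀)
      one_le := k0
      ne_zero := fun x y hv => hD (x, y) hv
      log_le := fun x y hv => (hb₁ (x, y) hv).trans k1
      log_deriv_le := fun x y hv => (hb₂ (x, y) hv).trans k2
      log_deriv_two_le := fun x y hv => (hb₃ (x, y) hv).trans k3
      le_mixed := fun x y hv => hmin hv
      mixed_le := fun x y hv => (hb₄ (x, y) hv).trans k4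
      mixed_two_le := fun x y hv => (hb₅ (x, y) hv).trans k5
      mixed_three_le := fun x y hv => (hb₆ (x, y) hv).trans k6 }⟩

/-- The one-dimensional slices of a damped oscillatory kernel on a box. -/
theorem kernelNormLE_slice {S D : MvPolynomial (Fin (m + 1) ⊕ Fin (n + 1)) ℝ}
    {i : Fin (m + 1)} {j : Fin (n + 1)} {x' : Fin m → ℝ} {y' : Fin n → ℝ}
    {Q T : Set ((Fin (m + 1) → ℝ) × (Fin (n + 1) → ℝ))} {b c α β γ κ σ r μ : ℝ} {z : ℂ}
    {h : ℝ × (Fin (m + 1) → ℝ) × (Fin (n + 1) → ℝ) → ℂ} (hαβ : α ≤ β)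
    (hB : BoxBounds S D i j Q c b) (hT : IsClosed T)
    (hVQ : ∀ t ∈ Set.Icc γ κ, ∀ s ∈ Set.Icc α β,
      ((i.insertNth s x' : Fin (m + 1) → ℝ), (j.insertNth t y' : Fin (n + 1) → ℝ)) ∈ Q)
    (hVT : ∀ s t, ((i.insertNth s x' : Fin (m + 1) → ℝ), (j.insertNth t y' : Fin (n + 1) → ℝ)) ∈ T
      → s ∈ Set.Ioo α β ∧ t ∈ Set.Icc γ κ)
    (hh : ContDiff ℝ ∞ h) (hhT : ∀ r, ∀ v ∉ T, h (r, v) = 0)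
    (hhb : ∀ v ∈ Q, ‖h (r, v)‖ ≤ b ∧ ‖partialX i h (r, v)‖ ≤ b ∧
      ‖partialX i (partialX i h) (r, v)‖ ≤ b) (hμ : μ ≠ 0) (hz : |z.re| ≤ σ)
    (hKs : Measurable (Function.uncurry fun s t => Complex.exp (Complex.I *
        ((μ * polyEval S (i.insertNth s x') (j.insertNth t y') : ℝ) : ℂ)) *
      (Complex.exp (z * (Real.log (polyEval D (i.insertNth s x') (j.insertNth t y')) : ℂ)) *
        h (r, (i.insertNth s x', j.insertNth t y'))))) :
    KernelNormLE (fun s t => Complex.exp (Complex.I *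
        ((μ * polyEval S (i.insertNth s x') (j.insertNth t y') : ℝ) : ℂ)) *
      (Complex.exp (z * (Real.log (polyEval D (i.insertNth s x') (j.insertNth t y')) : ℂ)) *
        h (r, (i.insertNth s x', j.insertNth t y'))))
      (Real.sqrt ((β - α) * 4 * (1 + 6 * (1 / c + b / c ^ 2 + 2 * b ^ 2 / c ^ 3) ^ 2) * Real.pi) *
        (Real.exp (σ * b) * (2 * b ^ 3 * (1 + ‖z‖) ^ 2)) * |μ| ^ (-(1 / 2) : ℝ)) := by
  have ev := fun P : MvPolynomial (Fin (m + 1) ⊕ Fin (n + 1)) ℝ => continuous_polyEval P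
  have hb0 : 0 ≤ b := by linarith [hB.one_le]
  have hzero := partialX_eq_zero i hT hhT
  have hh₁ := contDiff_partialX i hh
  have hVc : ∀ t, Continuous fun s => ((i.insertNth s x' : Fin (m + 1) → ℝ),
      (j.insertNth t y' : Fin (n + 1) → ℝ)) := fun t =>
    (continuous_insertNth_left i x').prodMk continuous_const
  have hpd := fun (P : MvPolynomial (Fin (m + 1) ⊕ Fin (n + 1)) ℝ) (s t : ℝ) =>
    hasDerivAt_polyEval_inl P i x' (j.insertNth t y') s
  have hpdt := fun (P : MvPolynomial (Fin (m + 1) ⊕ Fin (n + 1)) ℝ) (s t : ℝ) =>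
    hasDerivAt_polyEval_inr P j (i.insertNth s x') y' t
  obtain ⟨L, hL⟩ : ∃ L : ℝ → ℝ → ℝ, ∀ s t, L s t =
    Real.log (polyEval D (i.insertNth s x') (j.insertNth t y')) := ⟨_, fun _ _ => rfl⟩
  obtain ⟨L₁, hL₁⟩ : ∃ L : ℝ → ℝ → ℝ, ∀ s t, L s t =
    polyEval (MvPolynomial.pderiv (Sum.inl i) D) (i.insertNth s x') (j.insertNth t y') /
      polyEval D (i.insertNth s x') (j.insertNth t y') := ⟨_, fun _ _ => rfl⟩
  obtain ⟨L₂, hL₂⟩ : ∃ L : ℝ → ℝ → ℝ, ∀ s t, L s t =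
    (polyEval (MvPolynomial.pderiv (Sum.inl i) (MvPolynomial.pderiv (Sum.inl i) D))
        (i.insertNth s x') (j.insertNth t y') *
      polyEval D (i.insertNth s x') (j.insertNth t y') -
      polyEval (MvPolynomial.pderiv (Sum.inl i) D) (i.insertNth s x') (j.insertNth t y') *
      polyEval (MvPolynomial.pderiv (Sum.inl i) D) (i.insertNth s x') (j.insertNth t y')) /
      polyEval D (i.insertNth s x') (j.insertNth t y') ^ 2 := ⟨_, fun _ _ => rfl⟩
  obtain ⟨g, hg⟩ : ∃ g : ℝ → ℝ → ℂ, ∀ s t, g s t =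
    h (r, (i.insertNth s x', j.insertNth t y')) := ⟨_, fun _ _ => rfl⟩
  obtain ⟨g₁, hg₁⟩ : ∃ g : ℝ → ℝ → ℂ, ∀ s t, g s t =
    partialX i h (r, (i.insertNth s x', j.insertNth t y')) := ⟨_, fun _ _ => rfl⟩
  obtain ⟨g₂, hg₂⟩ : ∃ g : ℝ → ℝ → ℂ, ∀ s t, g s t =
    partialX i (partialX i h) (r, (i.insertNth s x', j.insertNth t y')) := ⟨_, fun _ _ => rfl⟩
  obtain ⟨P, hP⟩ : ∃ P : ℝ → ℝ → ℝ, ∀ s t, P s t =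
    polyEval S (i.insertNth s x') (j.insertNth t y') := ⟨_, fun _ _ => rfl⟩
  simp only [← hL, ← hg, ← hP] at hKs ⊢
  have hLd : ∀ t ∈ Set.Icc γ κ, ∀ s ∈ Set.Icc α β,
      HasDerivAt (fun s => L s t) (L₁ s t) s := fun t ht s hs => by
    simp only [hL, hL₁]
    exact (hpd D s t).log (hB.ne_zero _ _ (hVQ t ht s hs))
  have hL₁d : ∀ t ∈ Set.Icc γ κ, ∀ s ∈ Set.Icc α β,
      HasDerivAt (fun s => L₁ s t) (L₂ s t) s := fun t ht s hs => by
    simp only [hL₁, hL₂]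
    exact (hpd _ s t).div (hpd D s t) (hB.ne_zero _ _ (hVQ t ht s hs))
  have hgd : ∀ s t, HasDerivAt (fun s => g s t) (g₁ s t) s := fun s t => by
    simp only [hg, hg₁]
    exact hasDerivAt_insertNth_partialX i hh r x' _ s
  have hg₁d : ∀ s t, HasDerivAt (fun s => g₁ s t) (g₂ s t) s := fun s t => by
    simp only [hg₂, hg₁]
    exact hasDerivAt_insertNth_partialX i hh₁ r x' _ s
  have hcL₂ : ∀ t ∈ Set.Icc γ κ, ContinuousOn (fun s => L₂ s t) (Set.Icc α β) := fun t ht => by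
    have cP := fun P : MvPolynomial (Fin (m + 1) ⊕ Fin (n + 1)) ℝ =>
      ((ev P).comp (hVc t)).continuousOn (s := Set.Icc α β)
    simp only [hL₂]
    exact (((cP _).mul (cP D)).sub ((cP _).mul (cP _))).div ((cP D).pow 2)
      fun s hs => pow_ne_zero 2 (hB.ne_zero _ _ (hVQ t ht s hs))
  have hcg₂ : ∀ t, Continuous fun s => g₂ s t := fun t => by
    simp only [hg₂]
    exact (contDiff_partialX i hh₁).continuous.comp (continuous_const.prodMk (hVc t))
  have hu : ∀ t ∈ Set.Icc γ κ, ∀ s ∈ Set.Icc α β,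
      (|L s t| ≤ b ∧ |L₁ s t| ≤ b ∧ |L₂ s t| ≤ b) ∧ ‖g s t‖ ≤ b ∧ ‖g₁ s t‖ ≤ b ∧ ‖g₂ s t‖ ≤ b :=
    fun t ht s hs => by
      have hv := hVQ t ht s hs
      rw [hL, hL₁, hL₂, hg, hg₁, hg₂]
      exact ⟨⟨hB.log_le _ _ hv, hB.log_deriv_le _ _ hv, hB.log_deriv_two_le _ _ hv⟩, hhb _ hv⟩
  have hg0 : ∀ s t, ¬(s ∈ Set.Ioo α β ∧ t ∈ Set.Icc γ κ) → g s t = 0 := fun s t hn => by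
    rw [hg]; exact hhT r _ fun hc => hn (hVT s t hc)
  have hg₁0 : ∀ s t, ¬(s ∈ Set.Ioo α β ∧ t ∈ Set.Icc γ κ) → g₁ s t = 0 := fun s t hn => by
    rw [hg₁]; exact hzero r _ fun hc => hn (hVT s t hc)
  refine kernelNormLE_oscillatory (γ := γ) (κ := κ) hαβ hB.pos hb0 (by positivity) hμ
    (P := P) (a := fun s t => Complex.exp (z * L s t) * g s t)
    (P₁ := fun s t => polyEval (MvPolynomial.pderiv (Sum.inl i) S)
      (i.insertNth s x') (j.insertNth t y'))
    (P₂ := fun s t => polyEval (MvPolynomial.pderiv (Sum.inl i)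
      (MvPolynomial.pderiv (Sum.inl i) S)) (i.insertNth s x') (j.insertNth t y'))
    (P₃ := fun s t => polyEval (MvPolynomial.pderiv (Sum.inl i) (MvPolynomial.pderiv (Sum.inl i)
      (MvPolynomial.pderiv (Sum.inl i) S))) (i.insertNth s x') (j.insertNth t y'))
    (a₁ := fun s t => Complex.exp (z * L s t) * (z * L₁ s t * g s t + g₁ s t))
    (a₂ := fun s t => Complex.exp (z * L s t) * (z * L₁ s t * (z * L₁ s t * g s t + g₁ s t) +
        (z * L₂ s t * g s t + z * L₁ s t * g₁ s t + g₂ s t)))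
    hKs (fun s t hs => ?_) (fun s t ht => ?_) (fun t ht s hs => ?_) (fun t ht s hs => ?_)
    (fun t ht => ?_) (fun t ht => ?_) (fun t ht s hs => ?_)
    (fun t ht s hs => by simp only [hP]; exact hpd S s t)
    (fun t ht s hs => hpd _ s t) (fun t ht s hs => hpd _ s t)
    (fun t ht => ((ev _).comp (hVc t)).continuousOn) (fun t ht t' ht' s hs => ?_)
  · rw [hg0 s t fun hc => hs (Set.Ioo_subset_Icc_self hc.1), mul_zero]
  · rw [hg0 s t fun hc => ht hc.2, mul_zero]
  · exact hasDerivAt_amplitude (L := fun s => L s t) (L₁ := fun s => L₁ s t)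
      (h := fun s => g s t) (h₁ := fun s => g₁ s t) (hLd t ht s hs) (hgd s t)
  · refine hasDerivAt_amplitude (L := fun s => L s t) (L₁ := fun s => L₁ s t)
      (h := fun s => z * L₁ s t * g s t + g₁ s t)
      (h₁ := fun s => z * L₂ s t * g s t + z * L₁ s t * g₁ s t + g₂ s t) (hLd t ht s hs) ?_
    exact (((hL₁d t ht s hs).ofReal_comp.const_mul z).mul (hgd s t)).add (hg₁d s t)
  · have cofR {f : ℝ → ℝ} (hf : ContinuousOn f (Set.Icc α β)) :
        ContinuousOn (fun s => z * (f s : ℂ)) (Set.Icc α β) :=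
      continuousOn_const.mul (Complex.continuous_ofReal.comp_continuousOn hf)
    have cL : ContinuousOn (fun s => L s t) (Set.Icc α β) := fun s hs =>
      (hLd t ht s hs).continuousAt.continuousWithinAt
    have cL₁ : ContinuousOn (fun s => L₁ s t) (Set.Icc α β) := fun s hs =>
      (hL₁d t ht s hs).continuousAt.continuousWithinAt
    have c0 : ContinuousOn (fun s => g s t) (Set.Icc α β) := fun s hs =>
      (hgd s t).continuousAt.continuousWithinAt
    have c1 : ContinuousOn (fun s => g₁ s t) (Set.Icc α β) := fun s hs =>
      (hg₁d s t).continuousAt.continuousWithinAt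
    exact (Complex.continuous_exp.comp_continuousOn (cofR cL)).mul
      (((cofR cL₁).mul (((cofR cL₁).mul c0).add c1)).add
        ((((cofR (hcL₂ t ht)).mul c0).add ((cofR cL₁).mul c1)).add (hcg₂ t).continuousOn))
  -- The support lies over the open interval, so the amplitude and its derivative vanish at both
  -- endpoints: no boundary terms.
  · have hα : ¬(α ∈ Set.Ioo α β ∧ t ∈ Set.Icc γ κ) := fun hc => lt_irrefl _ hc.1.1
    have hβ : ¬(β ∈ Set.Ioo α β ∧ t ∈ Set.Icc γ κ) := fun hc => lt_irrefl _ hc.1.2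
    simp [hg0 _ _ hα, hg0 _ _ hβ, hg₁0 _ _ hα, hg₁0 _ _ hβ]
  · obtain ⟨⟨q1, q2, q3⟩, k1, k2, k3⟩ := hu t ht s hs
    exact amplitude_bound hB.one_le hz q1 q2 q3 k1 k2 k3
  -- Only the first phase difference needs a lower bound; it comes from the mixed derivative of `S`.
  · have hq := fun t ht => hVQ t ht s hs
    exact ⟨(mul_abs_sub_le_abs_sub (fun t _ => hpdt _ s t)
        (fun t ht => ⟨hB.le_mixed _ _ (hq t ht), hB.mixed_le _ _ (hq t ht)⟩) ht ht').1,
      (mul_abs_sub_le_abs_sub (fun t _ => hpdt _ s t)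
        (fun t ht => ⟨abs_nonneg _, hB.mixed_two_le _ _ (hq t ht)⟩) ht ht').2,
      (mul_abs_sub_le_abs_sub (fun t _ => hpdt _ s t)
        (fun t ht => ⟨abs_nonneg _, hB.mixed_three_le _ _ (hq t ht)⟩) ht ht').2⟩

theorem BoxBounds.mono {S D : MvPolynomial (Fin m ⊕ Fin n) ℝ} {i : Fin m} {j : Fin n}
    {Q : Set ((Fin m → ℝ) × (Fin n → ℝ))} {c b b' : ℝ} (h : BoxBounds S D i j Q c b)
    (hb : b ≤ b') : BoxBounds S D i j Q c b' where
  pos := h.pos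
  one_le := h.one_le.trans hb
  ne_zero := h.ne_zero
  log_le x y hv := (h.log_le x y hv).trans hb
  log_deriv_le x y hv := (h.log_deriv_le x y hv).trans hb
  log_deriv_two_le x y hv := (h.log_deriv_two_le x y hv).trans hb
  le_mixed := h.le_mixed
  mixed_le x y hv := (h.mixed_le x y hv).trans hb
  mixed_two_le x y hv := (h.mixed_two_le x y hv).trans hb
  mixed_three_le x y hv := (h.mixed_three_le x y hv).trans hb

end Box

/-! ### From slices to a box -/

section BoxOperator

attribute [local irreducible] polyEval

variable {m n : ℕ}

theorem measurable_uncurry_comp {X X' Y Y' : Type*} [MeasurableSpace X] [MeasurableSpace X']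
    [MeasurableSpace Y] [MeasurableSpace Y'] {K : X → Y → ℂ}
    (hK : Measurable (Function.uncurry K)) {f : X' → X} (hf : Measurable f) {g : Y' → Y}
    (hg : Measurable g) : Measurable (Function.uncurry fun x y => K (f x) (g y)) :=
  hK.comp ((hf.comp measurable_fst).prodMk (hg.comp measurable_snd))

theorem measurable_insertNth (i : Fin (m + 1)) :
    Measurable fun p : ℝ × (Fin m → ℝ) => (i.insertNth p.1 p.2 : Fin (m + 1) → ℝ) :=
  (MeasurableEquiv.piFinSuccAbove (fun _ => ℝ) i).symm.measurable

theorem KernelNormLE.of_insertNth {i : Fin (m + 1)} {j : Fin (n + 1)}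
    {K : (Fin (m + 1) → ℝ) → (Fin (n + 1) → ℝ) → ℂ} (hK : Measurable (Function.uncurry K)) {A : ℝ}
    (h : KernelNormLE (fun (x : ℝ × (Fin m → ℝ)) (y : ℝ × (Fin n → ℝ)) =>
      K (i.insertNth x.1 x.2) (j.insertNth y.1 y.2)) A) : KernelNormLE K A :=
  KernelNormLE.of_measurePreserving
    (MeasurableEquiv.piFinSuccAbove (fun _ => ℝ) i)
    (volume_preserving_piFinSuccAbove (fun _ => ℝ) i)
    (MeasurableEquiv.piFinSuccAbove (fun _ => ℝ) j)
    (volume_preserving_piFinSuccAbove (fun _ => ℝ) j) hK h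

/-- `L²` bound for a damped oscillatory kernel supported in a box on which one mixed second
derivative of the phase, and the damping factor, do not vanish. -/
theorem exists_kernelNormLE_box_succ {S D : MvPolynomial (Fin (m + 1) ⊕ Fin (n + 1)) ℝ}
    {i : Fin (m + 1)} {j : Fin (n + 1)} {x₀ : Fin (m + 1) → ℝ} {y₀ : Fin (n + 1) → ℝ} {ε : ℝ}
    (hε : 0 < ε)
    (hS : ∀ v ∈ Metric.closedBall (x₀, y₀) ε, polyEval (MvPolynomial.pderiv (Sum.inl i)
      (MvPolynomial.pderiv (Sum.inr j) S)) v.1 v.2 ≠ 0)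
    (hD : ∀ v ∈ Metric.closedBall (x₀, y₀) ε, polyEval D v.1 v.2 ≠ 0)
    {h : ℝ × (Fin (m + 1) → ℝ) × (Fin (n + 1) → ℝ) → ℂ} (hh : ContDiff ℝ ∞ h)
    {T : Set ((Fin (m + 1) → ℝ) × (Fin (n + 1) → ℝ))} (hT : IsClosed T)
    (hTb : T ⊆ Metric.ball (x₀, y₀) ε) (hhT : ∀ r, ∀ v ∉ T, h (r, v) = 0) (R σ : ℝ) :
    ∃ C : ℝ, 0 < C ∧ ∀ r ∈ Set.Icc 0 R, ∀ μ : ℝ, μ ≠ 0 → ∀ z : ℂ, |z.re| ≤ σ →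
      KernelNormLE (dampedKernel S D (fun v => h (r, v)) μ z)
        (C * (1 + ‖z‖) ^ 2 * |μ| ^ (-(1 / 2) : ℝ)) := by
  obtain ⟨Q, hQ⟩ : ∃ Q, Q = Metric.closedBall (x₀, y₀) ε := ⟨_, rfl⟩
  have hQc : IsCompact Q := hQ ▸ isCompact_closedBall _ _
  obtain ⟨c, b₁, hB₁⟩ := exists_boxBounds (Q := Q) hQc
    ⟨(x₀, y₀), hQ ▸ Metric.mem_closedBall_self hε.le⟩ (hQ ▸ hS) (hQ ▸ hD)
  -- Compactness of `[0, R] × Q`, with `r = 0` included, makes the amplitude bounds uniform over all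
  -- small scales `r`.
  obtain ⟨b₂, h2, hb₂⟩ := exists_bound_one_le ((isCompact_Icc (a := (0 : ℝ)) (b := R)).prod hQc)
    (f := fun q => ‖h q‖ + ‖partialX i h q‖ + ‖partialX i (partialX i h) q‖)
    ((hh.continuous.norm.add (contDiff_partialX i hh).continuous.norm).add
      (contDiff_partialX i (contDiff_partialX i hh)).continuous.norm).continuousOn
  obtain ⟨b, hb⟩ : ∃ b, b = b₁ + b₂ := ⟨_, rfl⟩
  have hB : BoxBounds S D i j Q c b := hB₁.mono (by linarith)
  have hb0 : 0 < b := by linarith [hB.one_le]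
  have hc := hB.pos
  have hhb : ∀ r ∈ Set.Icc 0 R, ∀ v ∈ Q, ‖h (r, v)‖ ≤ b ∧ ‖partialX i h (r, v)‖ ≤ b ∧
      ‖partialX i (partialX i h) (r, v)‖ ≤ b := fun r hr v hv => by
    have h1 := (le_abs_self _).trans (hb₂ (r, v) ⟨hr, hv⟩)
    have h3 := hB₁.one_le
    have n0 := norm_nonneg (h (r, v))
    have n1 := norm_nonneg (partialX i h (r, v))
    have n2 := norm_nonneg (partialX i (partialX i h) (r, v))
    refine ⟨?_, ?_, ?_⟩ <;> linarith
  obtain ⟨I, hI⟩ : ∃ I, I = Metric.closedBall (fun k => x₀ (i.succAbove k)) ε := ⟨_, rfl⟩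
  obtain ⟨J, hJ⟩ : ∃ J, J = Metric.closedBall (fun k => y₀ (j.succAbove k)) ε := ⟨_, rfl⟩
  have hIm : MeasurableSet I := hI ▸ measurableSet_closedBall
  have hJm : MeasurableSet J := hJ ▸ measurableSet_closedBall
  have hIf : volume I ≠ ⊤ := hI ▸ (isCompact_closedBall _ _).measure_ne_top
  have hJf : volume J ≠ ⊤ := hJ ▸ (isCompact_closedBall _ _).measure_ne_top
  obtain ⟨a₀, ha₀⟩ : ∃ a, a = Real.sqrt (volume I).toReal := ⟨_, rfl⟩
  obtain ⟨b₀, hb₀⟩ : ∃ a, a = Real.sqrt (volume J).toReal := ⟨_, rfl⟩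
  have ha₀0 : 0 ≤ a₀ := ha₀ ▸ Real.sqrt_nonneg _
  have hb₀0 : 0 ≤ b₀ := hb₀ ▸ Real.sqrt_nonneg _
  have hvolI : volume I ≤ ENNReal.ofReal (a₀ ^ 2) := by
    rw [ha₀, Real.sq_sqrt ENNReal.toReal_nonneg, ENNReal.ofReal_toReal hIf]
  have hvolJ : volume J ≤ ENNReal.ofReal (b₀ ^ 2) := by
    rw [hb₀, Real.sq_sqrt ENNReal.toReal_nonneg, ENNReal.ofReal_toReal hJf]
  obtain ⟨C₀, hC₀⟩ : ∃ C₀, C₀ = Real.sqrt ((x₀ i + ε - (x₀ i - ε)) * 4 *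
    (1 + 6 * (1 / c + b / c ^ 2 + 2 * b ^ 2 / c ^ 3) ^ 2) * Real.pi) := ⟨_, rfl⟩
  have hC₀0 : 0 ≤ C₀ := hC₀ ▸ Real.sqrt_nonneg _
  -- The summand 1 only secures strict positivity of the constant.
  refine ⟨a₀ * b₀ * (C₀ * (Real.exp (σ * b) * (2 * b ^ 3))) + 1, by positivity,
    fun r hr μ hμ z hz => ?_⟩
  have hTQ : T ⊆ Q := hQ ▸ hTb.trans Metric.ball_subset_closedBall
  have hhm : Measurable fun v => h (r, v) :=
    (hh.continuous.comp (continuous_const.prodMk continuous_id)).measurable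
  have hKm := measurable_dampedKernel S D hhm μ z
  have hQ' : ∀ s x' t y', ((i.insertNth s x' : Fin (m + 1) → ℝ),
      (j.insertNth t y' : Fin (n + 1) → ℝ)) ∈ Q ↔
      (s ∈ Set.Icc (x₀ i - ε) (x₀ i + ε) ∧ x' ∈ I) ∧
        (t ∈ Set.Icc (y₀ j - ε) (y₀ j + ε) ∧ y' ∈ J) := fun s x' t y' => by
    rw [hQ, ← closedBall_prod_same, Set.mem_prod, insertNth_mem_closedBall hε.le,
      insertNth_mem_closedBall hε.le, hI, hJ]
  have hKexp : ∀ x y, dampedKernel S D (fun v => h (r, v)) μ z x y =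
      Complex.exp (Complex.I * ((μ * polyEval S x y : ℝ) : ℂ)) *
      (Complex.exp (z * (Real.log (polyEval D x y) : ℂ)) * h (r, (x, y))) := fun x y =>
    dampedKernel_eq_exp fun h0 => by
      by_contra hne
      have hxy : (x, y) ∈ T := by
        by_contra hT'
        exact hne (hhT r _ hT')
      exact hB.ne_zero x y (hTQ hxy) h0
  have hK0 : ∀ s x' t y', ¬((s ∈ Set.Icc (x₀ i - ε) (x₀ i + ε) ∧ x' ∈ I) ∧
        (t ∈ Set.Icc (y₀ j - ε) (y₀ j + ε) ∧ y' ∈ J)) →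
      h (r, ((i.insertNth s x' : Fin (m + 1) → ℝ), (j.insertNth t y' : Fin (n + 1) → ℝ))) = 0 :=
    fun s x' t y' hn => hhT r _ fun hmem => hn ((hQ' s x' t y').1 (hTQ hmem))
  refine KernelNormLE.mono (A := a₀ * b₀ * (C₀ * (Real.exp (σ * b) *
    (2 * b ^ 3 * (1 + ‖z‖) ^ 2)) * |μ| ^ (-(1 / 2) : ℝ))) ?_ ?_
  swap
  · have hp : 0 ≤ (1 + ‖z‖) ^ 2 * |μ| ^ (-(1 / 2) : ℝ) := by positivity
    have : a₀ * b₀ * (C₀ * (Real.exp (σ * b) *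
        (2 * b ^ 3 * (1 + ‖z‖) ^ 2)) * |μ| ^ (-(1 / 2) : ℝ)) =
      a₀ * b₀ * (C₀ * (Real.exp (σ * b) * (2 * b ^ 3))) *
        ((1 + ‖z‖) ^ 2 * |μ| ^ (-(1 / 2) : ℝ)) := by ring
    rw [this, mul_assoc (_ + 1)]
    exact mul_le_mul_of_nonneg_right (by linarith) hp
  obtain ⟨K, hK⟩ : ∃ K, K = dampedKernel S D (fun v => h (r, v)) μ z := ⟨_, rfl⟩
  rw [← hK] at hKm hKexp ⊢
  refine KernelNormLE.of_insertNth (i := i) (j := j) hKm ?_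
  have hKm' := measurable_uncurry_comp hKm (measurable_insertNth i) (measurable_insertNth j)
  refine KernelNormLE.of_slices hKm'
    (M := Real.exp (σ * b) * (2 * b ^ 3 * (1 + ‖z‖) ^ 2)) (fun x y => ?_) hIm hJm
    (J₁ := Set.Icc (y₀ j - ε) (y₀ j + ε)) measurableSet_Icc (by simp) ha₀0
    hb₀0 hvolI hvolJ (fun x y hx => ?_) (fun x y hy => ?_) (fun x y hy => ?_)
    (fun x' hx' y' hy' => ?_)
  · rw [hKexp, norm_mul, norm_cexp_phase, one_mul]
    by_cases hv : ((i.insertNth x.1 x.2 : Fin (m + 1) → ℝ),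
      (j.insertNth y.1 y.2 : Fin (n + 1) → ℝ)) ∈ Q
    · obtain ⟨k1, k2, k3⟩ := hhb r hr _ hv
      exact (amplitude_bound hB.one_le hz (hB.log_le _ _ hv) (hB.log_deriv_le _ _ hv)
        (hB.log_deriv_two_le _ _ hv) k1 k2 k3).1
    · rw [hhT r _ fun hmem => hv (hTQ hmem), mul_zero, norm_zero]
      positivity
  · rw [hKexp, hK0 _ _ _ _ (fun hc => hx hc.1.2), mul_zero, mul_zero]
  · rw [hKexp, hK0 _ _ _ _ (fun hc => hy hc.2.2), mul_zero, mul_zero]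
  · rw [hKexp, hK0 _ _ _ _ (fun hc => hy hc.2.1), mul_zero, mul_zero]
  · rw [hC₀]
    have hKs := measurable_uncurry_comp hKm'
      (measurable_id.prodMk (measurable_const (a := x')))
      (measurable_id.prodMk (measurable_const (a := y')))
    simp only [hKexp, id_eq] at hKs ⊢
    refine kernelNormLE_slice (γ := y₀ j - ε) (κ := y₀ j + ε) (by linarith) hB hT
      (fun t ht s hs => (hQ' s x' t y').2 ⟨⟨hs, hx'⟩, ⟨ht, hy'⟩⟩) (fun s t hmem => ?_) hh hhT
      (hhb r hr) hμ hz hKs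
    refine ⟨?_, ((hQ' s x' t y').1 (hTQ hmem)).2.1⟩
    have h1 := hTb hmem
    rw [Metric.mem_ball, Prod.dist_eq, max_lt_iff, dist_pi_lt_iff hε] at h1
    have h2 := h1.1 i
    simp only [Fin.insertNth_apply_same, Real.dist_eq] at h2
    rw [abs_lt] at h2
    exact ⟨by linarith [h2.1], by linarith [h2.2]⟩

theorem exists_kernelNormLE_box {S D : MvPolynomial (Fin m ⊕ Fin n) ℝ}
    {i : Fin m} {j : Fin n} {v₀ : (Fin m → ℝ) × (Fin n → ℝ)} {ε : ℝ} (hε : 0 < ε)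
    (hS : ∀ v ∈ Metric.closedBall v₀ ε, polyEval (MvPolynomial.pderiv (Sum.inl i)
      (MvPolynomial.pderiv (Sum.inr j) S)) v.1 v.2 ≠ 0)
    (hD : ∀ v ∈ Metric.closedBall v₀ ε, polyEval D v.1 v.2 ≠ 0)
    {h : ℝ × (Fin m → ℝ) × (Fin n → ℝ) → ℂ} (hh : ContDiff ℝ ∞ h)
    {T : Set ((Fin m → ℝ) × (Fin n → ℝ))} (hT : IsClosed T)
    (hTb : T ⊆ Metric.ball v₀ ε) (hhT : ∀ r, ∀ v ∉ T, h (r, v) = 0) (R σ : ℝ) :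
    ∃ C : ℝ, 0 < C ∧ ∀ r ∈ Set.Icc 0 R, ∀ μ : ℝ, μ ≠ 0 → ∀ z : ℂ, |z.re| ≤ σ →
      KernelNormLE (dampedKernel S D (fun v => h (r, v)) μ z)
        (C * (1 + ‖z‖) ^ 2 * |μ| ^ (-(1 / 2) : ℝ)) := by
  obtain _ | m := m
  · exact i.elim0
  obtain _ | n := n
  · exact j.elim0
  exact exists_kernelNormLE_box_succ hε hS hD hh hT hTb hhT R σ

end BoxOperator

/-! ### Homogeneity, the size estimate and the annulus -/

theorem eval_smul_of_isHomogeneous {σ : Type*} {P : MvPolynomial σ ℝ} {d : ℕ}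
    (hP : P.IsHomogeneous d) (r : ℝ) (v : σ → ℝ) :
    MvPolynomial.eval (r • v) P = r ^ d * MvPolynomial.eval v P := by
  rw [MvPolynomial.eval_eq, MvPolynomial.eval_eq, Finset.mul_sum]
  refine Finset.sum_congr rfl fun e he => ?_
  have hd : ∑ i ∈ e.support, e i = d := by
    have h : e.degree = d := by
      rw [Finsupp.degree_eq_weight_one]
      exact hP (MvPolynomial.mem_support_iff.1 he)
    exact h
  simp only [Pi.smul_apply, smul_eq_mul, mul_pow, Finset.prod_mul_distrib]
  rw [Finset.prod_pow_eq_pow_sum, hd]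
  ring

variable {m n : ℕ}

theorem polyEval_smul {P : MvPolynomial (Fin m ⊕ Fin n) ℝ} {d : ℕ}
    (hP : P.IsHomogeneous d) (r : ℝ) (x : Fin m → ℝ) (y : Fin n → ℝ) :
    polyEval P (r • x) (r • y) = r ^ d * polyEval P x y := by
  unfold polyEval
  rw [← eval_smul_of_isHomogeneous hP]
  congr 2
  ext k
  cases k <;> rfl

section Damping

attribute [local irreducible] polyEval

/-- A homogeneous polynomial without nonzero real zeros is comparable to a power of the norm. -/
theorem exists_abs_polyEval_comparable {D : MvPolynomial (Fin m ⊕ Fin n) ℝ} {dD : ℕ}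
    (hD : D.IsHomogeneous dD) (hDnv : NonvanishingAwayFromOrigin D) :
    ∃ Γ : ℝ, 1 ≤ Γ ∧ ∀ (x : Fin m → ℝ) (y : Fin n → ℝ), x ≠ 0 →
      Γ⁻¹ * max ‖x‖ ‖y‖ ^ dD ≤ |polyEval D x y| ∧
        |polyEval D x y| ≤ Γ * max ‖x‖ ‖y‖ ^ dD := by
  have hK : IsCompact (Metric.sphere (0 : (Fin m → ℝ) × (Fin n → ℝ)) 1) := isCompact_sphere _ _
  have hc := (continuous_polyEval D).continuousOn
    (s := Metric.sphere (0 : (Fin m → ℝ) × (Fin n → ℝ)) 1)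
  have hne : ∀ v ∈ Metric.sphere (0 : (Fin m → ℝ) × (Fin n → ℝ)) 1, polyEval D v.1 v.2 ≠ 0 :=
    fun v hv h0 => by
      obtain ⟨h1, h2⟩ := hDnv _ _ h0
      have : v = 0 := Prod.ext h1 h2
      simp [this] at hv
  obtain ⟨b₁, h1, hb₁⟩ := exists_bound_one_le hK hc
  obtain ⟨b₂, h2, hb₂⟩ := exists_bound_one_le hK
    (f := fun v => (polyEval D v.1 v.2)⁻¹) (hc.inv₀ hne)
  refine ⟨b₁ + b₂, by linarith, fun x y hx => ?_⟩
  have hr : 0 < max ‖x‖ ‖y‖ := lt_max_of_lt_left (norm_pos_iff.2 hx)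
  obtain ⟨r, hrdef⟩ : ∃ r, r = max ‖x‖ ‖y‖ := ⟨_, rfl⟩
  rw [← hrdef] at hr ⊢
  have hmem : (r⁻¹ • x, r⁻¹ • y) ∈ Metric.sphere (0 : (Fin m → ℝ) × (Fin n → ℝ)) 1 := by
    rw [mem_sphere_zero_iff_norm, ← Prod.smul_mk, norm_smul, Prod.norm_mk, ← hrdef, norm_inv,
      Real.norm_of_nonneg hr.le, inv_mul_cancel₀ hr.ne']
  have hsc : polyEval D x y = r ^ dD * polyEval D (r⁻¹ • x) (r⁻¹ • y) := by
    rw [← polyEval_smul hD, smul_inv_smul₀ hr.ne', smul_inv_smul₀ hr.ne']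
  have k1 := hb₁ _ hmem
  have k2 := hb₂ _ hmem
  have k3 := hne _ hmem
  obtain ⟨q, hq⟩ : ∃ q, q = polyEval D (r⁻¹ • x) (r⁻¹ • y) := ⟨_, rfl⟩
  simp only [← hq] at k1 k2 k3 hsc
  rw [hsc, abs_mul, abs_of_pos (pow_pos hr dD), abs_inv] at *
  have hq0 : 0 < |q| := abs_pos.2 k3
  constructor
  · rw [mul_comm]
    gcongr
    exact inv_le_of_inv_le₀ hq0 (by linarith)
  · rw [mul_comm]
    gcongr
    linarith

theorem rpow_le_rpow_mul_of_comparable {q ρ Γ p σ : ℝ} {k : ℕ} (hΓ : 1 ≤ Γ) (hρ : 0 < ρ)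
    (h1 : Γ⁻¹ * ρ ^ k ≤ q) (h2 : q ≤ Γ * ρ ^ k) (hp : |p| ≤ σ) :
    q ^ p ≤ Γ ^ σ * ρ ^ (k * p) := by
  have hΓ0 : 0 < Γ := by linarith
  have hρk : 0 < ρ ^ k := pow_pos hρ k
  have hq : 0 < q := lt_of_lt_of_le (by positivity) h1
  have hpow : ρ ^ (k * p) = (ρ ^ k) ^ p := by rw [Real.rpow_mul hρ.le, Real.rpow_natCast]
  rw [hpow]
  -- The sign of the exponent decides which side of the comparability is used; since `1 ≤ Γ`, either
  -- case costs at most `Γ ^ σ`.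
  rcases le_or_gt 0 p with h0 | h0
  · rw [abs_of_nonneg h0] at hp
    calc q ^ p ≤ (Γ * ρ ^ k) ^ p := Real.rpow_le_rpow hq.le h2 h0
      _ = Γ ^ p * (ρ ^ k) ^ p := Real.mul_rpow hΓ0.le hρk.le
      _ ≤ _ := by gcongr
  · rw [abs_of_neg h0] at hp
    calc q ^ p ≤ (Γ⁻¹ * ρ ^ k) ^ p :=
          Real.rpow_le_rpow_of_nonpos (by positivity) h1 h0.le
      _ = Γ ^ (-p) * (ρ ^ k) ^ p := by
          rw [Real.mul_rpow (by positivity) hρk.le, Real.inv_rpow hΓ0.le, Real.rpow_neg hΓ0.le]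
      _ ≤ _ := by gcongr

/-- The size estimate for damped kernels supported in a ball of radius `ρ`. -/
theorem exists_kernelNormLE_size (hm : 0 < m) (hn : 0 < n)
    (S : MvPolynomial (Fin m ⊕ Fin n) ℝ) {D : MvPolynomial (Fin m ⊕ Fin n) ℝ}
    {dD : ℕ} (hD : D.IsHomogeneous dD) (hDnv : NonvanishingAwayFromOrigin D) (σ : ℝ) :
    ∃ C : ℝ, 0 < C ∧ ∀ (F ρ lam : ℝ) (φ : (Fin m → ℝ) × (Fin n → ℝ) → ℂ) (z : ℂ), 0 ≤ F → 0 < ρ →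
      Measurable φ → (∀ v, ‖φ v‖ ≤ F) → (∀ v, ρ < ‖v‖ → φ v = 0) → |z.re| ≤ σ →
      0 ≤ dD * z.re + ((m : ℝ) + n) / 2 →
      KernelNormLE (dampedKernel S D φ lam z) (C * F * ρ ^ (dD * z.re + ((m : ℝ) + n) / 2)) ∧
        KernelIntegrable (dampedKernel S D φ lam z) := by
  obtain ⟨Γ, hΓ, hcomp⟩ := exists_abs_polyEval_comparable hD hDnv
  obtain ⟨C, hC, hH⟩ := exists_kernelNormLE_of_norm_le hm hn
  refine ⟨C * Γ ^ σ, by positivity, fun F ρ lam φ z hF hρ hφm hφF hφρ hz hγ => ?_⟩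
  have h := hH (dampedKernel S D φ lam z)
    (Γ ^ σ * F * ρ ^ (dD * z.re + ((m : ℝ) + n) / 2)) (by positivity)
    (measurable_dampedKernel S D hφm lam z) (fun x y hx => ?_)
  · have e : C * Γ ^ σ * F * ρ ^ (dD * z.re + ((m : ℝ) + n) / 2) =
        C * (Γ ^ σ * F * ρ ^ (dD * z.re + ((m : ℝ) + n) / 2)) := by ring
    rw [e]; exact h
  · have hr : 0 < max ‖x‖ ‖y‖ := lt_max_of_lt_left (norm_pos_iff.2 hx)
    by_cases hv : ρ < ‖((x, y) : (Fin m → ℝ) × (Fin n → ℝ))‖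
    · unfold dampedKernel
      rw [hφρ _ hv, mul_zero, norm_zero]
      positivity
    · rw [not_lt, Prod.norm_mk] at hv
      obtain ⟨h1, h2⟩ := hcomp x y hx
      have hDpos : 0 < |polyEval D x y| := lt_of_lt_of_le (by positivity) h1
      unfold dampedKernel
      rw [norm_mul, norm_mul, norm_cexp_phase, one_mul,
        Complex.norm_cpow_eq_rpow_re_of_pos hDpos]
      obtain ⟨r, hrdef⟩ : ∃ r, r = max ‖x‖ ‖y‖ := ⟨_, rfl⟩
      rw [← hrdef] at hr hv h1 h2 ⊢
      -- Split `r ^ (dD Re z)` into `r ^ γ * r ^ (-(m + n)/2)`; as `γ ≥ 0` and `r ≤ ρ` on the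
      -- support, `r ^ γ` is replaced by `ρ ^ γ`.
      calc |polyEval D x y| ^ z.re * ‖φ (x, y)‖
          ≤ (Γ ^ σ * r ^ (dD * z.re)) * F := by
            gcongr
            · exact rpow_le_rpow_mul_of_comparable hΓ hr h1 h2 hz
            · exact hφF _
        _ = Γ ^ σ * F * (r ^ (dD * z.re + ((m : ℝ) + n) / 2) *
              r ^ (-(((m : ℝ) + n) / 2))) := by
            rw [← Real.rpow_add hr, add_neg_cancel_right]; ring
        _ ≤ Γ ^ σ * F * (ρ ^ (dD * z.re + ((m : ℝ) + n) / 2) *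
              r ^ (-(((m : ℝ) + n) / 2))) := by
            gcongr
        _ = _ := by ring

/-- Finite smooth decompositions on an annulus into functions supported in balls where some mixed
derivative of the phase and the damping factor do not vanish. -/
theorem exists_annulus_partition {S D : MvPolynomial (Fin m ⊕ Fin n) ℝ} (hS : RankOne S)
    (hDnv : NonvanishingAwayFromOrigin D) {K : Set ((Fin m → ℝ) × (Fin n → ℝ))}
    (hK : IsCompact K) (hK0 : (0 : (Fin m → ℝ) × (Fin n → ℝ)) ∉ K) :
    ∃ (t : Finset ((Fin m → ℝ) × (Fin n → ℝ))) (f : t → (Fin m → ℝ) × (Fin n → ℝ) → ℝ),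
      (∀ p, ContDiff ℝ ∞ (f p)) ∧ (∀ p v, |f p v| ≤ 1) ∧ (∀ v ∈ K, ∑ p, f p v = 1) ∧
      ∀ p, ∃ (i : Fin m) (j : Fin n) (v₀ : (Fin m → ℝ) × (Fin n → ℝ)) (ε : ℝ), 0 < ε ∧
        (∀ v ∈ Metric.closedBall v₀ ε, polyEval (MvPolynomial.pderiv (Sum.inl i)
          (MvPolynomial.pderiv (Sum.inr j) S)) v.1 v.2 ≠ 0) ∧
        (∀ v ∈ Metric.closedBall v₀ ε, polyEval D v.1 v.2 ≠ 0) ∧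
        tsupport (f p) ⊆ Metric.ball v₀ ε := by
  have hloc : ∀ v₀ : (Fin m → ℝ) × (Fin n → ℝ), v₀ ∈ K → ∃ ε : ℝ, 0 < ε ∧
      ∃ (i : Fin m) (j : Fin n),
        (∀ v ∈ Metric.closedBall v₀ ε, polyEval (MvPolynomial.pderiv (Sum.inl i)
          (MvPolynomial.pderiv (Sum.inr j) S)) v.1 v.2 ≠ 0) ∧
        (∀ v ∈ Metric.closedBall v₀ ε, polyEval D v.1 v.2 ≠ 0) := by
    intro v₀ hv₀
    have hne : ¬(v₀.1 = 0 ∧ v₀.2 = 0) := fun hc => hK0 (by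
      have : v₀ = 0 := Prod.ext hc.1 hc.2
      rwa [this] at hv₀)
    have hD0 : polyEval D v₀.1 v₀.2 ≠ 0 := fun h0 => hne (hDnv _ _ h0)
    -- The rank one condition is used exactly here; the pair `(i, j)` may vary from ball to ball.
    obtain ⟨i, j, hij⟩ : ∃ i j, polyEval (MvPolynomial.pderiv (Sum.inl i)
          (MvPolynomial.pderiv (Sum.inr j) S)) v₀.1 v₀.2 ≠ 0 := by
      by_contra hc
      push Not at hc
      exact hne (hS _ _ hc)
    have hev := ((continuous_polyEval (MvPolynomial.pderiv (Sum.inl i)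
      (MvPolynomial.pderiv (Sum.inr j) S))).continuousAt.eventually_ne hij).and
      ((continuous_polyEval D).continuousAt.eventually_ne hD0)
    obtain ⟨ε, hε, hsub⟩ := Metric.nhds_basis_closedBall.eventually_iff.1 hev
    exact ⟨ε, hε, i, j, fun v hv => (hsub hv).1, fun v hv => (hsub hv).2⟩
  choose! ε hε hloc using hloc
  obtain ⟨t, htK, hcov⟩ := hK.elim_nhds_subcover (fun v => Metric.ball v (ε v))
    fun v hv => Metric.ball_mem_nhds v (hε v hv)
  obtain ⟨f, hf⟩ := SmoothPartitionOfUnity.exists_isSubordinate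
    𝓘(ℝ, (Fin m → ℝ) × (Fin n → ℝ)) hK.isClosed
    (fun p : t => Metric.ball (p : (Fin m → ℝ) × (Fin n → ℝ)) (ε p))
    (fun p => Metric.isOpen_ball) (fun v hv => by
      obtain ⟨p, hp, hvp⟩ := Set.mem_iUnion₂.1 (hcov hv)
      exact Set.mem_iUnion.2 ⟨⟨p, hp⟩, hvp⟩)
  refine ⟨t, fun p => f p, fun p => (f p).contMDiff.contDiff, fun p v => ?_, fun v hv => ?_,
    fun p => ?_⟩
  · rw [abs_of_nonneg (f.nonneg p v)]
    exact f.le_one p v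
  · rw [← finsum_eq_sum_of_fintype]
    exact f.sum_eq_one hv
  · obtain ⟨i, j, h1, h2⟩ := hloc p (htK p p.2)
    exact ⟨i, j, p, ε p, hε p (htK p p.2), h1, h2, hf p⟩

theorem dampedKernel_sum {ι : Type*} (s : Finset ι) (S D : MvPolynomial (Fin m ⊕ Fin n) ℝ)
    (φ : ι → (Fin m → ℝ) × (Fin n → ℝ) → ℂ) (lam : ℝ) (z : ℂ) :
    dampedKernel S D (fun v => ∑ k ∈ s, φ k v) lam z =
      fun x y => ∑ k ∈ s, dampedKernel S D (φ k) lam z x y := by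
  ext x y
  simp only [dampedKernel, Finset.mul_sum]

/-- The oscillatory estimate on an annulus. -/
theorem exists_kernelNormLE_annulus (hm : 0 < m) (hn : 0 < n)
    {S D : MvPolynomial (Fin m ⊕ Fin n) ℝ} (hS : RankOne S) {dD : ℕ} (hD : D.IsHomogeneous dD)
    (hDnv : NonvanishingAwayFromOrigin D) {K : Set ((Fin m → ℝ) × (Fin n → ℝ))}
    (hK : IsCompact K) (hK0 : (0 : (Fin m → ℝ) × (Fin n → ℝ)) ∉ K)
    {h : ℝ × (Fin m → ℝ) × (Fin n → ℝ) → ℂ} (hh : ContDiff ℝ ∞ h)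
    (hhK : ∀ r, ∀ v ∉ K, h (r, v) = 0) (R σ : ℝ) :
    ∃ C : ℝ, 0 < C ∧ ∀ r ∈ Set.Icc 0 R, ∀ μ : ℝ, μ ≠ 0 → ∀ z : ℂ, |z.re| ≤ σ →
      0 ≤ dD * z.re + ((m : ℝ) + n) / 2 →
      KernelNormLE (dampedKernel S D (fun v => h (r, v)) μ z)
        (C * (1 + ‖z‖) ^ 2 * |μ| ^ (-(1 / 2) : ℝ)) := by
  obtain ⟨t, f, hfs, hf1, hfK, hft⟩ := exists_annulus_partition hS hDnv hK hK0
  have hbox : ∀ p : t, ∃ C : ℝ, 0 < C ∧ ∀ r ∈ Set.Icc 0 R, ∀ μ : ℝ, μ ≠ 0 → ∀ z : ℂ,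
      |z.re| ≤ σ → KernelNormLE (dampedKernel S D (fun v => (f p v : ℂ) * h (r, v)) μ z)
        (C * (1 + ‖z‖) ^ 2 * |μ| ^ (-(1 / 2) : ℝ)) := fun p => by
    obtain ⟨i, j, v₀, ε, hε, h1, h2, h3⟩ := hft p
    have hsm : ContDiff ℝ ∞ fun q : ℝ × (Fin m → ℝ) × (Fin n → ℝ) => (f p q.2 : ℂ) * h q :=
      (Complex.ofRealCLM.contDiff.comp ((hfs p).comp contDiff_snd)).mul hh
    exact exists_kernelNormLE_box hε h1 h2 hsm (isClosed_tsupport (f p)) h3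
      (fun r v hv => by simp [image_eq_zero_of_notMem_tsupport hv]) R σ
  choose C hC hbox using hbox
  obtain ⟨C', hC', hsize⟩ := exists_kernelNormLE_size hm hn S hD hDnv σ
  obtain ⟨ρ, hρ, hKρ⟩ := hK.isBounded.exists_pos_norm_le
  refine ⟨∑ p, C p + 1, add_pos_of_nonneg_of_pos (Finset.sum_nonneg fun p _ => (hC p).le) one_pos,
    fun r hr μ hμ z hz hγ => ?_⟩
  have hhm : Measurable fun v => h (r, v) :=
    (hh.continuous.comp (continuous_const.prodMk continuous_id)).measurable
  have hfhm : ∀ p : t, Measurable fun v => (f p v : ℂ) * h (r, v) := fun p =>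
    (Complex.measurable_ofReal.comp (hfs p).continuous.measurable).mul hhm
  obtain ⟨F, hF1, hF⟩ := exists_bound_one_le hK (f := fun v => ‖h (r, v)‖)
    (hh.continuous.comp (continuous_const.prodMk continuous_id)).norm.continuousOn
  have hFall : ∀ v, ‖h (r, v)‖ ≤ F := fun v => by
    by_cases hv : v ∈ K
    · exact (le_abs_self _).trans (hF v hv)
    · rw [hhK r v hv, norm_zero]; linarith
  have hint : ∀ p : t, KernelIntegrable (dampedKernel S D (fun v => (f p v : ℂ) * h (r, v)) μ z) :=
    fun p => by
      refine (hsize F ρ μ (fun v => (f p v : ℂ) * h (r, v)) z (by linarith) hρ (hfhm p)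
        (fun v => ?_) (fun v hv => ?_) hz hγ).2
      · rw [norm_mul, Complex.norm_real, Real.norm_eq_abs]
        calc |f p v| * ‖h (r, v)‖ ≤ 1 * F := by
              gcongr
              · exact hf1 p v
              · exact hFall v
          _ = F := one_mul F
      · rw [hhK r v fun hc => absurd (hKρ v hc) (not_le.2 hv), mul_zero]
  have hsum := (KernelNormLE.sum (Finset.univ : Finset t)
    (K := fun p => dampedKernel S D (fun v => (f p v : ℂ) * h (r, v)) μ z)
    (A := fun p => C p * (1 + ‖z‖) ^ 2 * |μ| ^ (-(1 / 2) : ℝ))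
    (fun p _ => hbox p r hr μ hμ z hz)
    (fun p _ => by have := hC p; positivity)
    (fun p _ => measurable_dampedKernel S D (hfhm p) μ z) (fun p _ => hint p)).1
  have hdec : (fun v => h (r, v)) = fun v => ∑ p, (f p v : ℂ) * h (r, v) := by
    ext v
    rw [← Finset.sum_mul, ← Complex.ofReal_sum]
    by_cases hv : v ∈ K
    · rw [hfK v hv, Complex.ofReal_one, one_mul]
    · rw [hhK r v hv, mul_zero]
  rw [hdec, dampedKernel_sum]
  refine hsum.mono ?_
  rw [← Finset.sum_mul, ← Finset.sum_mul]
  gcongr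
  linarith

end Damping

theorem KernelNormLE.const_mul {X Y : Type*} [MeasureSpace X] [MeasureSpace Y] {K : X → Y → ℂ}
    {A : ℝ} (h : KernelNormLE K A) (c : ℂ) :
    KernelNormLE (fun x y => c * K x y) (‖c‖ * A) := fun f hf hf2 => by
  have : (fun x => ∫ y, c * K x y * f y) = c • fun x => ∫ y, K x y * f y := by
    ext x
    simp only [mul_assoc, Pi.smul_apply, smul_eq_mul]
    exact integral_const_mul _ _
  rw [this, eLpNorm_const_smul, ENNReal.ofReal_mul (norm_nonneg c), ofReal_norm, mul_assoc]
  exact mul_le_mul' le_rfl (h f hf hf2)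


/-! ### Dyadic decomposition -/

section Scaling

attribute [local irreducible] polyEval

theorem dampedKernel_smul {S D : MvPolynomial (Fin m ⊕ Fin n) ℝ} {d dD : ℕ}
    (hS : S.IsHomogeneous d) (hD : D.IsHomogeneous dD) {r : ℝ} (hr : 0 < r)
    (φ : (Fin m → ℝ) × (Fin n → ℝ) → ℂ) (lam : ℝ) (z : ℂ) (x : Fin m → ℝ) (y : Fin n → ℝ) :
    dampedKernel S D φ lam z (r • x) (r • y) = ((r ^ dD : ℝ) : ℂ) ^ z *
      dampedKernel S D (fun v => φ (r • v)) (lam * r ^ d) z x y := by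
  unfold dampedKernel
  rw [polyEval_smul hS, polyEval_smul hD, abs_mul, abs_of_pos (pow_pos hr dD),
    Complex.ofReal_mul (r ^ dD), Complex.mul_cpow_ofReal_nonneg (pow_pos hr dD).le (abs_nonneg _),
    mul_assoc lam]
  simp only [Prod.smul_mk]
  ring

/-- The dyadic pieces: an amplitude `φ(v) χ(v/r)` with `χ` supported in an annulus. -/
theorem exists_kernelNormLE_dyadic (hm : 0 < m) (hn : 0 < n)
    {S D : MvPolynomial (Fin m ⊕ Fin n) ℝ} {d dD : ℕ} (hSd : S.IsHomogeneous d) (hS : RankOne S)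
    (hD : D.IsHomogeneous dD) (hDnv : NonvanishingAwayFromOrigin D)
    {K : Set ((Fin m → ℝ) × (Fin n → ℝ))}
    (hK : IsCompact K) (hK0 : (0 : (Fin m → ℝ) × (Fin n → ℝ)) ∉ K)
    {χ φ : (Fin m → ℝ) × (Fin n → ℝ) → ℂ} (hχ : ContDiff ℝ ∞ χ) (hχK : ∀ v ∉ K, χ v = 0)
    (hφ : ContDiff ℝ ∞ φ) (R σ : ℝ) :
    ∃ C : ℝ, 0 < C ∧ ∀ r : ℝ, 0 < r → r ≤ R → ∀ lam : ℝ, lam ≠ 0 → ∀ z : ℂ, |z.re| ≤ σ →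
      0 ≤ dD * z.re + ((m : ℝ) + n) / 2 →
      KernelNormLE (dampedKernel S D (fun v => φ v * χ (r⁻¹ • v)) lam z)
        (C * (1 + ‖z‖) ^ 2 * (|lam| ^ (-(1 / 2) : ℝ) *
          r ^ (dD * z.re - ((d : ℝ) - m - n) / 2))) := by
  -- The rescaled amplitude `φ(r v) χ(v)` is jointly smooth in `(r, v)` down to `r = 0`. This is why
  -- amplitudes carry the extra variable `r`.
  have hh : ContDiff ℝ ∞ fun q : ℝ × (Fin m → ℝ) × (Fin n → ℝ) => φ (q.1 • q.2) * χ q.2 :=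
    (hφ.comp (contDiff_fst.smul contDiff_snd)).mul (hχ.comp contDiff_snd)
  obtain ⟨C, hC, hann⟩ := exists_kernelNormLE_annulus hm hn hS hD hDnv hK hK0 hh
    (fun r v hv => by simp [hχK v hv]) R σ
  refine ⟨C, hC, fun r hr hrR lam hlam z hz hγ => ?_⟩
  have hrd : 0 < r ^ d := pow_pos hr d
  have h1 := (hann r ⟨hr.le, hrR⟩ (lam * r ^ d) (mul_ne_zero hlam hrd.ne') z hz hγ).const_mul
    (((r ^ dD : ℝ) : ℂ) ^ z)
  have hmeas : Measurable (Function.uncurry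
      (dampedKernel S D (fun v => φ v * χ (r⁻¹ • v)) lam z)) :=
    measurable_dampedKernel S D
      (hφ.continuous.mul (hχ.continuous.comp (continuous_const_smul r⁻¹))).measurable lam z
  have h2 : KernelNormLE (fun x y =>
      dampedKernel S D (fun v => φ v * χ (r⁻¹ • v)) lam z (r • x) (r • y))
      (‖((r ^ dD : ℝ) : ℂ) ^ z‖ * (C * (1 + ‖z‖) ^ 2 * |lam * r ^ d| ^ (-(1 / 2) : ℝ))) := by
    simp only [dampedKernel_smul hSd hD hr, inv_smul_smul₀ hr.ne']
    exact h1
  refine (KernelNormLE.of_scaled hr hmeas h2).mono (le_of_eq ?_)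
  rw [Complex.norm_cpow_eq_rpow_re_of_pos (pow_pos hr dD), abs_mul, abs_of_pos hrd,
    Real.mul_rpow (abs_nonneg _) hrd.le, ← Real.rpow_natCast r dD, ← Real.rpow_natCast r d,
    ← Real.rpow_mul hr.le, ← Real.rpow_mul hr.le]
  -- The three factors come from the change of variables, the damping, and the frequency `λ r ^ d`.
  have e : r ^ (dD * z.re - ((d : ℝ) - m - n) / 2) =
      r ^ (((m : ℝ) + n) / 2) * r ^ ((dD : ℝ) * z.re) * r ^ ((d : ℝ) * (-(1 / 2))) := by
    rw [← Real.rpow_add hr, ← Real.rpow_add hr]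
    congr 1; ring
  rw [e]; ring

/-- The bound for the damped operator obtained from the first `N` dyadic scales and the size
estimate for the remainder. -/
theorem exists_kernelNormLE_dampedKernel (hm : 0 < m) (hn : 0 < n)
    {S D : MvPolynomial (Fin m ⊕ Fin n) ℝ} {d dD : ℕ} (hSd : S.IsHomogeneous d) (hS : RankOne S)
    (hD : D.IsHomogeneous dD) (hDnv : NonvanishingAwayFromOrigin D)
    {φ : (Fin m → ℝ) × (Fin n → ℝ) → ℂ} (hφ : ContDiff ℝ ∞ φ) (hφc : HasCompactSupport φ) (σ : ℝ) :
    ∃ C R : ℝ, 0 < C ∧ 1 ≤ R ∧ ∀ lam : ℝ, lam ≠ 0 → ∀ z : ℂ, |z.re| ≤ σ →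
      0 ≤ dD * z.re + ((m : ℝ) + n) / 2 →
      KernelIntegrable (dampedKernel S D φ lam z) ∧ ∀ N : ℕ,
      KernelNormLE (dampedKernel S D φ lam z) (C * (1 + ‖z‖) ^ 2 *
        (|lam| ^ (-(1 / 2) : ℝ) *
          ∑ k ∈ Finset.range N, (R / 2 ^ k) ^ (dD * z.re - ((d : ℝ) - m - n) / 2) +
        (R / 2 ^ N) ^ (dD * z.re + ((m : ℝ) + n) / 2))) := by
  obtain ⟨R₀, hR₀⟩ := hφc.isCompact.isBounded.exists_norm_le
  obtain ⟨R, hRdef⟩ : ∃ R, R = 1 + |R₀| := ⟨_, rfl⟩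
  have hR1 : 1 ≤ R := by rw [hRdef]; linarith [abs_nonneg R₀]
  have hR0 : 0 < R := by linarith
  have hφR : ∀ v, R < ‖v‖ → φ v = 0 := fun v hv => by
    by_contra hne
    have := hR₀ v (subset_tsupport φ hne)
    rw [hRdef] at hv
    linarith [le_abs_self R₀]
  obtain ⟨F, hF1, hF⟩ := exists_bound_one_le (isCompact_closedBall (0 : (Fin m → ℝ) × (Fin n → ℝ)) R)
    (f := fun v => ‖φ v‖) hφ.continuous.norm.continuousOn
  have hFall : ∀ v, ‖φ v‖ ≤ F := fun v => by
    by_cases hv : R < ‖v‖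
    · rw [hφR v hv, norm_zero]; linarith
    · exact (le_abs_self _).trans (hF v (mem_closedBall_zero_iff.2 (not_lt.1 hv)))
  -- The bump is 1 on the unit ball and 0 beyond radius 2, so `χ = η - η(2 ·)` vanishes outside the
  -- annulus `1/2 ≤ ‖v‖ ≤ 2` and its dilates telescope.
  let B : ContDiffBump (0 : (Fin m → ℝ) × (Fin n → ℝ)) := ⟨1, 2, one_pos, one_lt_two⟩
  obtain ⟨η, hη⟩ : ∃ η : (Fin m → ℝ) × (Fin n → ℝ) → ℂ, η = fun v => ((B v : ℝ) : ℂ) := ⟨_, rfl⟩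
  have hηs : ContDiff ℝ ∞ η := hη ▸ Complex.ofRealCLM.contDiff.comp B.contDiff
  have hη1 : ∀ v, ‖v‖ ≤ 1 → η v = 1 := fun v hv => by
    have : B v = 1 := B.one_of_mem_closedBall (mem_closedBall_zero_iff.2 hv)
    simp [hη, this]
  have hη0 : ∀ v, 2 ≤ ‖v‖ → η v = 0 := fun v hv => by
    have : B v = 0 := B.zero_of_le_dist (by simpa using hv)
    simp [hη, this]
  have hηn : ∀ v, ‖η v‖ ≤ 1 := fun v => by
    rw [hη, Complex.norm_real, Real.norm_of_nonneg B.nonneg]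
    exact B.le_one
  obtain ⟨χ, hχ⟩ : ∃ χ : (Fin m → ℝ) × (Fin n → ℝ) → ℂ,
    χ = fun v => η v - η ((2 : ℝ) • v) := ⟨_, rfl⟩
  have hχs : ContDiff ℝ ∞ χ := hχ ▸ hηs.sub (hηs.comp (contDiff_const_smul _))
  obtain ⟨K, hK⟩ : ∃ K : Set ((Fin m → ℝ) × (Fin n → ℝ)),
    K = Metric.closedBall 0 2 \ Metric.ball 0 (1 / 2) := ⟨_, rfl⟩
  have hKc : IsCompact K := hK ▸ (isCompact_closedBall _ _).diff Metric.isOpen_ball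
  have hK0 : (0 : (Fin m → ℝ) × (Fin n → ℝ)) ∉ K := by
    rw [hK]; simp
  have hχK : ∀ v ∉ K, χ v = 0 := fun v hv => by
    have h2 : ‖(2 : ℝ) • v‖ = 2 * ‖v‖ := by rw [norm_smul, Real.norm_of_nonneg zero_le_two]
    rw [hK, Set.mem_sdiff, mem_closedBall_zero_iff, mem_ball_zero_iff, not_and_or, not_not,
      not_le] at hv
    rcases hv with hv | hv
    · simp only [hχ]
      rw [hη0 v hv.le, hη0 _ (by rw [h2]; linarith), sub_zero]
    · simp only [hχ]
      rw [hη1 v (by linarith), hη1 _ (by rw [h2]; linarith), sub_self]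
  obtain ⟨C₁, hC₁, hdy⟩ := exists_kernelNormLE_dyadic hm hn hSd hS hD hDnv hKc hK0 hχs hχK hφ R σ
  obtain ⟨C₂, hC₂, hsz⟩ := exists_kernelNormLE_size hm hn S hD hDnv σ
  have hσ2 : 0 < (2 : ℝ) ^ (dD * σ + ((m : ℝ) + n) / 2) := by positivity
  refine ⟨C₁ + C₂ * F * 2 ^ (dD * σ + ((m : ℝ) + n) / 2), R, by positivity, hR1,
    fun lam hlam z hz hγ => ?_⟩
  have hint := (hsz F R lam φ z (by linarith) hR0 hφ.continuous.measurable hFall hφR hz hγ).2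
  refine ⟨hint, fun N => ?_⟩
  have hrpos : ∀ k : ℕ, 0 < R / 2 ^ k := fun k => by positivity
  have hrle : ∀ k : ℕ, R / 2 ^ k ≤ R := fun k =>
    div_le_self hR0.le (one_le_pow₀ one_le_two)
  have hinv : ∀ k : ℕ, (2 : ℝ) * (R / 2 ^ k)⁻¹ = (R / 2 ^ (k + 1))⁻¹ := fun k => by
    rw [pow_succ]; field_simp
  have hχk : ∀ (k : ℕ) v, χ ((R / 2 ^ k)⁻¹ • v) =
      η ((R / 2 ^ k)⁻¹ • v) - η ((R / 2 ^ (k + 1))⁻¹ • v) := fun k v => by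
    simp only [hχ]; rw [smul_smul, hinv]
  have hdec : φ = fun v => ∑ k ∈ Finset.range N, φ v * χ ((R / 2 ^ k)⁻¹ • v) +
      φ v * η ((R / 2 ^ N)⁻¹ • v) := by
    ext v
    rw [← Finset.mul_sum]
    simp only [hχk]
    rw [Finset.sum_range_sub' (fun k => η ((R / 2 ^ k)⁻¹ • v)), pow_zero, div_one]
    by_cases hv : R < ‖v‖
    · rw [hφR v hv]; ring
    · rw [hη1 (R⁻¹ • v)]
      · ring
      · rw [norm_smul, norm_inv, Real.norm_of_nonneg hR0.le, inv_mul_le_iff₀ hR0, mul_one]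
        exact not_lt.1 hv
  have hηm : ∀ k : ℕ, Continuous fun v => η ((R / 2 ^ k)⁻¹ • v) := fun k =>
    hηs.continuous.comp (continuous_const_smul _)
  have hψm : ∀ k : ℕ, Measurable fun v => φ v * χ ((R / 2 ^ k)⁻¹ • v) := fun k => by
    simp only [hχk]
    exact (hφ.continuous.mul ((hηm k).sub (hηm (k + 1)))).measurable
  have hψi : ∀ k : ℕ,
      KernelIntegrable (dampedKernel S D (fun v => φ v * χ ((R / 2 ^ k)⁻¹ • v)) lam z) := fun k => by
    refine (hsz (F * 2) R lam _ z (by linarith) hR0 (hψm k) (fun v => ?_)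
      (fun v hv => by rw [hφR v hv, zero_mul]) hz hγ).2
    rw [norm_mul, hχk]
    have := norm_sub_le_of_le (hηn ((R / 2 ^ k)⁻¹ • v)) (hηn ((R / 2 ^ (k + 1))⁻¹ • v))
    have h3 : ‖η ((R / 2 ^ k)⁻¹ • v) - η ((R / 2 ^ (k + 1))⁻¹ • v)‖ ≤ 2 := by linarith
    exact mul_le_mul (hFall v) h3 (norm_nonneg _) (by linarith)
  have hsum := KernelNormLE.sum (Finset.range N)
    (K := fun k => dampedKernel S D (fun v => φ v * χ ((R / 2 ^ k)⁻¹ • v)) lam z)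
    (A := fun k => C₁ * (1 + ‖z‖) ^ 2 * (|lam| ^ (-(1 / 2) : ℝ) *
          (R / 2 ^ k) ^ (dD * z.re - ((d : ℝ) - m - n) / 2)))
    (fun k _ => hdy _ (hrpos k) (hrle k) lam hlam z hz hγ)
    (fun k _ => by have := hrpos k; positivity)
    (fun k _ => measurable_dampedKernel S D (hψm k) lam z) (fun k _ => hψi k)
  -- The remainder lives in the ball of radius `2 * (R / 2 ^ N)`; this 2 produces the power of two
  -- in the constant.
  have hrem := hsz F (2 * (R / 2 ^ N)) lam (fun v => φ v * η ((R / 2 ^ N)⁻¹ • v)) z (by linarith)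
    (by positivity) (hφ.continuous.mul (hηm N)).measurable (fun v => ?_) (fun v hv => ?_) hz hγ
  rotate_left
  · rw [norm_mul]
    calc _ ≤ F * 1 := mul_le_mul (hFall v) (hηn _) (norm_nonneg _) (by linarith)
      _ = F := mul_one F
  · have := hrpos N
    rw [hη0, mul_zero]
    rw [norm_smul, norm_inv, Real.norm_of_nonneg this.le, le_inv_mul_iff₀ this, mul_comm]
    exact hv.le
  have hadd : dampedKernel S D φ lam z = fun x y =>
      (∑ k ∈ Finset.range N, dampedKernel S D (fun v => φ v * χ ((R / 2 ^ k)⁻¹ • v)) lam z x y) +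
      dampedKernel S D (fun v => φ v * η ((R / 2 ^ N)⁻¹ • v)) lam z x y := by
    conv_lhs => rw [hdec]
    ext x y
    simp only [dampedKernel, mul_add, Finset.mul_sum]
  have hsm : Measurable (Function.uncurry fun x y =>
      ∑ k ∈ Finset.range N, dampedKernel S D (fun v => φ v * χ ((R / 2 ^ k)⁻¹ • v)) lam z x y) := by
    rw [← dampedKernel_sum]
    exact measurable_dampedKernel S D (Finset.measurable_fun_sum _ fun k _ => hψm k) lam z
  rw [hadd]
  refine (hsum.1.add hrem.1 (Finset.sum_nonneg fun k _ => by have := hrpos k; positivity)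
    (by positivity) hsm
    (measurable_dampedKernel S D (hφ.continuous.mul (hηm N)).measurable lam z) hsum.2
    hrem.2).mono ?_
  have hX : 0 ≤ |lam| ^ (-(1 / 2) : ℝ) *
      ∑ k ∈ Finset.range N, (R / 2 ^ k) ^ (dD * z.re - ((d : ℝ) - m - n) / 2) :=
    mul_nonneg (by positivity) (Finset.sum_nonneg fun k _ => (Real.rpow_pos_of_pos (hrpos k) _).le)
  have hY : 0 ≤ (R / 2 ^ N) ^ (dD * z.re + ((m : ℝ) + n) / 2) :=
    (Real.rpow_pos_of_pos (hrpos N) _).le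
  have h2γ : (2 : ℝ) ^ (dD * z.re + ((m : ℝ) + n) / 2) ≤ 2 ^ (dD * σ + ((m : ℝ) + n) / 2) := by
    refine Real.rpow_le_rpow_of_exponent_le one_le_two ?_
    gcongr
    exact (le_abs_self _).trans hz
  have hZ : 1 ≤ (1 + ‖z‖) ^ 2 := one_le_pow₀ (by linarith [norm_nonneg z])
  rw [← Finset.mul_sum, ← Finset.mul_sum, Real.mul_rpow zero_le_two (hrpos N).le]
  obtain ⟨X, hXd⟩ : ∃ X, X = |lam| ^ (-(1 / 2) : ℝ) *
      ∑ k ∈ Finset.range N, (R / 2 ^ k) ^ (dD * z.re - ((d : ℝ) - m - n) / 2) := ⟨_, rfl⟩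
  rw [← hXd] at hX ⊢
  obtain ⟨Y, hYd⟩ : ∃ Y, Y = (R / 2 ^ N) ^ (dD * z.re + ((m : ℝ) + n) / 2) := ⟨_, rfl⟩
  rw [← hYd] at hY ⊢
  obtain ⟨W, hWd⟩ : ∃ W, W = C₂ * F * (2 : ℝ) ^ (dD * σ + ((m : ℝ) + n) / 2) := ⟨_, rfl⟩
  have hW : 0 ≤ W := by rw [hWd]; positivity
  rw [← hWd]
  have h5 : C₂ * F * ((2 : ℝ) ^ (dD * z.re + ((m : ℝ) + n) / 2) * Y) ≤ W * Y := by
    rw [hWd, ← mul_assoc]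
    gcongr
  have h6 : W * Y ≤ W * (1 + ‖z‖) ^ 2 * Y := by
    gcongr
    exact le_mul_of_one_le_right hW hZ
  have h7 : 0 ≤ C₁ * (1 + ‖z‖) ^ 2 * Y := by positivity
  have h8 : 0 ≤ W * (1 + ‖z‖) ^ 2 * X := by positivity
  linarith

/-- The kernel estimates concern measurable `f`; passing to a measurable representative changes `f`
on a null set only, hence none of the integrals in `y`. -/
theorem dampedNormLE_of_kernelNormLE {S D : MvPolynomial (Fin m ⊕ Fin n) ℝ}
    {φ : (Fin m → ℝ) × (Fin n → ℝ) → ℂ} (hφ : Measurable φ) {lam : ℝ} {z : ℂ} {A : ℝ}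
    (hi : KernelIntegrable (dampedKernel S D φ lam z))
    (hA : KernelNormLE (dampedKernel S D φ lam z) A) : DampedNormLE S D φ lam z A := fun f hf => by
  obtain ⟨g, hg⟩ : ∃ g, g = hf.aestronglyMeasurable.mk f := ⟨_, rfl⟩
  have hgm : Measurable g := hg ▸ hf.aestronglyMeasurable.stronglyMeasurable_mk.measurable
  have hfg : f =ᵐ[volume] g := hg ▸ hf.aestronglyMeasurable.ae_eq_mk
  have hg2 : MemLp g 2 volume := hf.ae_eq hfg
  have hKfg : ∀ x, (fun y => dampedKernel S D φ lam z x y * f y) =ᵐ[volume]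
      fun y => dampedKernel S D φ lam z x y * g y := fun x => by
    filter_upwards [hfg] with y hy
    rw [hy]
  have hop : dampedOp S D φ lam z f = fun x => ∫ y, dampedKernel S D φ lam z x y * g y := by
    ext x
    exact integral_congr_ae (hKfg x)
  have hle := hA g hgm hg2
  refine ⟨?_, ?_, ?_⟩
  · filter_upwards [hi g hgm hg2] with x hx
    exact hx.congr (hKfg x).symm
  · rw [hop]
    exact ⟨(measurable_integral_kernel (measurable_dampedKernel S D hφ lam z)
      hgm).aestronglyMeasurable, lt_of_le_of_lt hle
        (ENNReal.mul_lt_top ENNReal.ofReal_lt_top hg2.eLpNorm_lt_top)⟩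
  · rw [hop, eLpNorm_congr_ae hfg]
    exact hle

end Scaling

/-! ### Sums over dyadic scales -/

section DyadicSums

/-- `N` is the least index whose scale is at most `1 / L`; minimality keeps all earlier scales above
`1 / L`. -/
theorem exists_dyadic_cutoff (R : ℝ) {L : ℝ} (hL : 0 < L) :
    ∃ N : ℕ, R / 2 ^ N ≤ L⁻¹ ∧ ∀ k < N, 1 < R / 2 ^ k * L := by
  classical
  have hex : ∃ N : ℕ, R / 2 ^ N * L ≤ 1 := by
    obtain ⟨N, hN⟩ := pow_unbounded_of_one_lt (R * L) (one_lt_two (α := ℝ))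
    refine ⟨N, ?_⟩
    rw [div_mul_eq_mul_div, div_le_one (by positivity)]
    exact hN.le
  refine ⟨Nat.find hex, ?_, fun k hk => not_le.1 (Nat.find_min hex hk)⟩
  rw [← one_div, le_div_iff₀ hL]
  exact Nat.find_spec hex

theorem sum_range_geometric_le {q : ℝ} (hq0 : 0 ≤ q) (hq1 : q < 1) (N : ℕ) :
    ∑ k ∈ Finset.range N, q ^ k ≤ (1 - q)⁻¹ := by
  rw [← tsum_geometric_of_lt_one hq0 hq1]
  exact (summable_geometric_of_lt_one hq0 hq1).sum_le_tsum _ fun k _ => pow_nonneg hq0 k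

theorem two_rpow_neg_lt_one {a : ℝ} (ha : 0 < a) : (2 : ℝ) ^ (-a) < 1 :=
  Real.rpow_lt_one_of_one_lt_of_neg one_lt_two (by linarith)

theorem two_pow_rpow_le {a β : ℝ} (h : β ≤ -a) (k : ℕ) :
    ((2 : ℝ) ^ k) ^ β ≤ ((2 : ℝ) ^ (-a)) ^ k := by
  calc ((2 : ℝ) ^ k) ^ β ≤ ((2 : ℝ) ^ k) ^ (-a) :=
        Real.rpow_le_rpow_of_exponent_le (one_le_pow₀ one_le_two) h
    _ = ((2 : ℝ) ^ (-a)) ^ k := by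
        rw [← Real.rpow_natCast, ← Real.rpow_natCast, ← Real.rpow_mul zero_le_two,
          ← Real.rpow_mul zero_le_two, mul_comm]

/-- The sum of a positive power over dyadic scales. -/
theorem sum_dyadic_rpow_le_of_pos {R a b β : ℝ} (hR : 1 ≤ R) (ha : 0 < a) (haβ : a ≤ β)
    (hβb : β ≤ b) (N : ℕ) :
    ∑ k ∈ Finset.range N, (R / 2 ^ k) ^ β ≤ R ^ b * (1 - (2 : ℝ) ^ (-a))⁻¹ := by
  have hR0 : 0 < R := by linarith
  calc ∑ k ∈ Finset.range N, (R / 2 ^ k) ^ β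
      ≤ ∑ k ∈ Finset.range N, R ^ b * ((2 : ℝ) ^ (-a)) ^ k := by
        refine Finset.sum_le_sum fun k _ => ?_
        rw [Real.div_rpow hR0.le (by positivity), div_eq_mul_inv, ← Real.rpow_neg (by positivity)]
        gcongr
        exact two_pow_rpow_le (by linarith) k
    _ ≤ R ^ b * (1 - (2 : ℝ) ^ (-a))⁻¹ := by
        rw [← Finset.mul_sum]
        gcongr
        exact sum_range_geometric_le (by positivity) (two_rpow_neg_lt_one ha) N

/-- The sum of a negative power over dyadic scales is governed by the smallest scale. -/
theorem sum_dyadic_rpow_le_of_neg {R L a β : ℝ} (hR : 0 < R) (hL : 0 < L) (ha : 0 < a)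
    (hβ : β ≤ -a) {N : ℕ} (hN : ∀ k < N, 1 < R / 2 ^ k * L) :
    ∑ k ∈ Finset.range N, (R / 2 ^ k) ^ β ≤ L ^ (-β) * (1 - (2 : ℝ) ^ (-a))⁻¹ := by
  calc ∑ k ∈ Finset.range N, (R / 2 ^ k) ^ β
      ≤ ∑ k ∈ Finset.range N, L ^ (-β) * ((2 : ℝ) ^ (-a)) ^ (N - 1 - k) := by
        refine Finset.sum_le_sum fun k hk => ?_
        have hkN : k < N := Finset.mem_range.1 hk
        -- The last retained scale exceeds `1 / L`, so scale `k` is at least `2 ^ (N - 1 - k) / L`: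
        -- a geometric series read backwards from the cutoff.
        have hlast := hN (N - 1) (by omega)
        have hpow : (2 : ℝ) ^ (N - 1) = 2 ^ (N - 1 - k) * 2 ^ k := by
          rw [← pow_add]; congr 1; omega
        have hge : (2 : ℝ) ^ (N - 1 - k) ≤ R / 2 ^ k * L := by
          rw [hpow, div_mul_eq_mul_div, one_lt_div (by positivity)] at hlast
          rw [div_mul_eq_mul_div, le_div_iff₀ (by positivity)]
          exact hlast.le
        have e : (R / 2 ^ k) ^ β = L ^ (-β) * (R / 2 ^ k * L) ^ β := by
          rw [Real.mul_rpow (by positivity) hL.le, mul_left_comm, ← Real.rpow_add hL]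
          simp
        rw [e]
        gcongr
        exact (Real.rpow_le_rpow_of_nonpos (by positivity) hge (by linarith)).trans
          (two_pow_rpow_le hβ _)
    _ ≤ L ^ (-β) * (1 - (2 : ℝ) ^ (-a))⁻¹ := by
        rw [← Finset.mul_sum, Finset.sum_range_reflect (fun k => ((2 : ℝ) ^ (-a)) ^ k)]
        gcongr
        exact sum_range_geometric_le (by positivity) (two_rpow_neg_lt_one ha) N

/-- The number of dyadic scales is logarithmic. -/
theorem dyadic_cutoff_le_log {R L X : ℝ} (hR : 1 ≤ R) (hX : 2 ≤ X) (hLX : L ≤ X)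
    {N : ℕ} (hN : ∀ k < N, 1 < R / 2 ^ k * L) :
    (N : ℝ) ≤ (Real.log (2 * R) / Real.log 2 + 1) / Real.log 2 * Real.log X := by
  have h2 : 0 < Real.log 2 := Real.log_pos one_lt_two
  have hlX : Real.log 2 ≤ Real.log X := Real.log_le_log two_pos hX
  have hlR : 0 ≤ Real.log (2 * R) := Real.log_nonneg (by linarith)
  rcases Nat.eq_zero_or_pos N with rfl | hpos
  · have : 0 ≤ Real.log X := h2.le.trans hlX
    simp only [Nat.cast_zero]
    positivity
  have h1 := hN (N - 1) (by omega)
  have hR0 : 0 < R := by linarith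
  rw [div_mul_eq_mul_div, one_lt_div (by positivity)] at h1
  have h3 : (2 : ℝ) ^ N ≤ 2 * R * X := by
    have : (2 : ℝ) ^ N = 2 * 2 ^ (N - 1) := by
      rw [← pow_succ']; congr 1; omega
    rw [this]
    nlinarith [mul_le_mul_of_nonneg_left hLX hR0.le]
  have h4 := Real.log_le_log (by positivity) h3
  rw [Real.log_pow, Real.log_mul (by positivity) (by linarith)] at h4
  -- From `N log 2 ≤ log (2R) + log X`, the constant `log (2R)` is absorbed into `log X` because
  -- `log X ≥ log 2`.
  rw [div_mul_eq_mul_div, le_div_iff₀ h2, add_mul, one_mul]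
  refine h4.trans (add_le_add ?_ le_rfl)
  rw [div_mul_eq_mul_div, le_div_iff₀ h2]
  gcongr

end DyadicSums

end DampedOIO

end

/-! ### The three ranges of the real part -/

theorem theorem3p2 (nX nY d dD : ℕ) (hnX : 0 < nX) (hnY : 0 < nY)
    (hd : nX + nY < d) (hdD : 0 < dD)
    (S D : MvPolynomial (Fin nX ⊕ Fin nY) ℝ)
    (hS : S.IsHomogeneous d) (hSrank : DampedOIO.RankOne S)
    (hD : D.IsHomogeneous dD) (hDnv : DampedOIO.NonvanishingAwayFromOrigin D)
    (φ : (Fin nX → ℝ) × (Fin nY → ℝ) → ℂ) (hφ : ContDiff ℝ ∞ φ) (hφc : HasCompactSupport φ)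
    (δ : ℝ) (hδ : 0 < δ) (M : ℝ) :
    ∃ C : ℝ, 0 < C ∧ ∀ (lam : ℝ) (z : ℂ), lam ≠ 0 →
      (DampedOIO.critExp nX nY d dD + δ ≤ z.re → z.re ≤ M →
        DampedOIO.DampedNormLE S D φ lam z
          (C * (1 + ‖z‖) ^ 2 * |lam| ^ (-(1 / 2) : ℝ))) ∧
      (z.re = DampedOIO.critExp nX nY d dD →
        DampedOIO.DampedNormLE S D φ lam z
          (C * (1 + ‖z‖) ^ 2 * (|lam| ^ (-(1 / 2) : ℝ) * Real.log (2 + |lam|)))) ∧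
      (-((min nX nY : ℕ) : ℝ) / dD < z.re → z.re ≤ DampedOIO.critExp nX nY d dD - δ →
        DampedOIO.DampedNormLE S D φ lam z
          (C * (1 + ‖z‖) ^ 2 *
            |lam| ^ (-((dD : ℝ) / d) * z.re - ((nX : ℝ) + nY) / (2 * d)))) := by
  have hdD0 : (0 : ℝ) < dD := by exact_mod_cast hdD
  have hdD1 : (1 : ℝ) ≤ dD := by exact_mod_cast hdD
  have hd' : (nX : ℝ) + nY < d := by exact_mod_cast hd
  have hnX0 : (0 : ℝ) < nX := by exact_mod_cast hnX
  have hnY0 : (0 : ℝ) < nY := by exact_mod_cast hnY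
  have hd0 : (0 : ℝ) < d := by linarith
  have hd1 : (1 : ℝ) ≤ d := by exact_mod_cast (show 1 ≤ d by omega)
  have hcrit : dD * DampedOIO.critExp nX nY d dD = ((d : ℝ) - nX - nY) / 2 := by
    unfold DampedOIO.critExp; field_simp
  have hcrit0 : 0 < DampedOIO.critExp nX nY d dD := by
    unfold DampedOIO.critExp
    exact div_pos (by linarith) (by linarith)
  obtain ⟨s₀, hs₀⟩ : ∃ s, s = DampedOIO.critExp nX nY d dD := ⟨_, rfl⟩
  rw [← hs₀] at hcrit hcrit0 ⊢
  -- The bound `|M| + s₀ + nX + nY` dominates `|Re z|` in all three ranges at once.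
  obtain ⟨C₀, R, hC₀, hR1, hmain⟩ := DampedOIO.exists_kernelNormLE_dampedKernel hnX hnY hS hSrank
    hD hDnv hφ hφc (|M| + s₀ + nX + nY)
  have hR0 : 0 < R := by linarith
  have ha : 0 < dD * δ := by positivity
  obtain ⟨g, hg⟩ : ∃ g, g = (1 - (2 : ℝ) ^ (-(dD * δ)))⁻¹ := ⟨_, rfl⟩
  have hg0 : 0 < g := hg ▸ inv_pos.2 (sub_pos.2 (DampedOIO.two_rpow_neg_lt_one ha))
  have h2 : 0 < Real.log 2 := Real.log_pos one_lt_two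
  have hlR : 0 ≤ Real.log (2 * R) := Real.log_nonneg (by linarith)
  obtain ⟨b, hb⟩ : ∃ b, b = dD * M - ((d : ℝ) - nX - nY) / 2 := ⟨_, rfl⟩
  obtain ⟨c₂, hc₂⟩ : ∃ c, c = (Real.log (2 * R) / Real.log 2 + 1) / Real.log 2 +
    1 / Real.log 2 := ⟨_, rfl⟩
  have hc₂0 : 0 < c₂ := by rw [hc₂]; positivity
  obtain ⟨c₁, hc₁⟩ : ∃ c, c = R ^ b * g + R ^ b := ⟨_, rfl⟩
  have hc₁0 : 0 < c₁ := by rw [hc₁]; positivity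
  refine ⟨C₀ * (c₁ + c₂ + (g + 1)), by positivity, fun lam z hlam => ?_⟩
  have hl0 : 0 < |lam| := abs_pos.2 hlam
  -- `1 / L` is the scale at which the rescaled frequency `|λ| r ^ d` equals one and oscillation
  -- stops helping.
  obtain ⟨L, hL⟩ : ∃ L, L = |lam| ^ ((d : ℝ)⁻¹) := ⟨_, rfl⟩
  have hL0 : 0 < L := hL ▸ Real.rpow_pos_of_pos hl0 _
  have hLpow : ∀ p : ℝ, |lam| ^ p = L ^ (d * p) := fun p => by
    rw [hL, ← Real.rpow_mul hl0.le, ← mul_assoc, inv_mul_cancel₀ hd0.ne', one_mul]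
  obtain ⟨N, hN1, hN2⟩ := DampedOIO.exists_dyadic_cutoff R hL0
  have hrN : 0 < R / 2 ^ N := by positivity
  have hrNR : R / 2 ^ N ≤ R := div_le_self hR0.le (one_le_pow₀ one_le_two)
  have hφm : Measurable φ := hφ.continuous.measurable
  -- Every range reduces to a scalar inequality: `B` is the dependence on `λ`, `c` the constant of
  -- that range.
  have key : ∀ B c : ℝ, 0 ≤ B → c ≤ c₁ + c₂ + (g + 1) → |z.re| ≤ |M| + s₀ + nX + nY →
      0 ≤ dD * z.re + ((nX : ℝ) + nY) / 2 →
      |lam| ^ (-(1 / 2) : ℝ) *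
          ∑ k ∈ Finset.range N, (R / 2 ^ k) ^ (dD * z.re - ((d : ℝ) - nX - nY) / 2) +
        (R / 2 ^ N) ^ (dD * z.re + ((nX : ℝ) + nY) / 2) ≤ c * B →
      DampedOIO.DampedNormLE S D φ lam z (C₀ * (c₁ + c₂ + (g + 1)) * (1 + ‖z‖) ^ 2 * B) := by
    intro B c hB hc hz hγ hle
    obtain ⟨hint, hnorm⟩ := hmain lam hlam z hz hγ
    refine DampedOIO.dampedNormLE_of_kernelNormLE hφm hint ((hnorm N).mono ?_)
    calc _ ≤ C₀ * (1 + ‖z‖) ^ 2 * (c * B) := by gcongr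
      _ ≤ C₀ * (1 + ‖z‖) ^ 2 * ((c₁ + c₂ + (g + 1)) * B) := by gcongr
      _ = _ := by ring
  have hhalf : |lam| ^ (-(1 / 2) : ℝ) = L ^ (-((d : ℝ) / 2)) := by
    rw [hLpow]; congr 1; ring
  have hγβ : dD * z.re + ((nX : ℝ) + nY) / 2 =
      d / 2 + (dD * z.re - ((d : ℝ) - nX - nY) / 2) := by ring
  have hrhalf : (R / 2 ^ N) ^ ((d : ℝ) / 2) ≤ L ^ (-((d : ℝ) / 2)) := by
    rw [Real.rpow_neg hL0.le, ← Real.inv_rpow hL0.le]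
    exact Real.rpow_le_rpow hrN.le hN1 (by positivity)
  refine ⟨fun h1 h3 => ?_, fun h1 => ?_, fun h1 h3 => ?_⟩
  · have hβ1 : dD * δ ≤ dD * z.re - ((d : ℝ) - nX - nY) / 2 := by
      rw [← hcrit, ← mul_sub]; gcongr; linarith
    have hβ2 : dD * z.re - ((d : ℝ) - nX - nY) / 2 ≤ b := by
      rw [hb]; gcongr
    have hz0 : 0 < z.re := by linarith
    refine key _ c₁ (by positivity) (by linarith) ?_ (by positivity) ?_
    · rw [abs_of_pos hz0]; linarith [le_abs_self M]
    · have hsum := DampedOIO.sum_dyadic_rpow_le_of_pos hR1 ha hβ1 hβ2 N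
      rw [← hg] at hsum
      -- Split `γ = d/2 + β`: at the cutoff scale the first power is at most `|λ| ^ (-1/2)`, and the
      -- second at most `R ^ b` since `0 ≤ β ≤ b` and `1 ≤ R`.
      have hrem : (R / 2 ^ N) ^ (dD * z.re + ((nX : ℝ) + nY) / 2) ≤
          |lam| ^ (-(1 / 2) : ℝ) * R ^ b := by
        rw [hγβ, Real.rpow_add hrN, hhalf]
        gcongr
        exact (Real.rpow_le_rpow hrN.le hrNR (ha.le.trans hβ1)).trans
          (Real.rpow_le_rpow_of_exponent_le hR1 hβ2)
      calc _ ≤ |lam| ^ (-(1 / 2) : ℝ) * (R ^ b * g) + |lam| ^ (-(1 / 2) : ℝ) * R ^ b := by gcongr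
        _ = c₁ * |lam| ^ (-(1 / 2) : ℝ) := by rw [hc₁]; ring
  -- On the critical line every shell contributes equally, so the sum is `N`.
  · have hβ : dD * z.re - ((d : ℝ) - nX - nY) / 2 = 0 := by rw [h1, hcrit, sub_self]
    have hlog : Real.log 2 ≤ Real.log (2 + |lam|) := Real.log_le_log two_pos (by linarith)
    have hlog0 : 0 < Real.log (2 + |lam|) := by linarith
    refine key _ c₂ (by positivity) (by linarith) ?_ (by rw [h1]; positivity) ?_
    · rw [h1, abs_of_pos hcrit0]; linarith [abs_nonneg M]
    · have hLX : L ≤ 2 + |lam| := by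
        calc L ≤ (2 + |lam|) ^ ((d : ℝ)⁻¹) := by
              rw [hL]; exact Real.rpow_le_rpow hl0.le (by linarith) (by positivity)
          _ ≤ (2 + |lam|) ^ (1 : ℝ) :=
              Real.rpow_le_rpow_of_exponent_le (by linarith) (inv_le_one_of_one_le₀ hd1)
          _ = 2 + |lam| := Real.rpow_one _
      have hNlog := DampedOIO.dyadic_cutoff_le_log hR1 (X := 2 + |lam|) (by linarith) hLX hN2
      have hone : 1 ≤ 1 / Real.log 2 * Real.log (2 + |lam|) := by
        rw [div_mul_eq_mul_div, one_mul, one_le_div h2]; exact hlog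
      rw [hγβ, hβ, add_zero]
      simp only [Real.rpow_zero, Finset.sum_const, Finset.card_range, nsmul_eq_mul, mul_one]
      have hp : 0 ≤ |lam| ^ (-(1 / 2) : ℝ) := by positivity
      calc |lam| ^ (-(1 / 2) : ℝ) * (N : ℝ) + (R / 2 ^ N) ^ ((d : ℝ) / 2)
          ≤ |lam| ^ (-(1 / 2) : ℝ) * ((Real.log (2 * R) / Real.log 2 + 1) / Real.log 2 *
              Real.log (2 + |lam|)) +
            |lam| ^ (-(1 / 2) : ℝ) * (1 / Real.log 2 * Real.log (2 + |lam|)) := by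
            refine add_le_add (mul_le_mul_of_nonneg_left hNlog hp) ?_
            rw [← hhalf] at hrhalf
            exact hrhalf.trans (le_mul_of_one_le_right hp hone)
        _ = c₂ * (|lam| ^ (-(1 / 2) : ℝ) * Real.log (2 + |lam|)) := by rw [hc₂]; ring
  -- The minimum is at most the mean, so the stated lower limit on `Re z` implies `γ ≥ 0`, which is
  -- all the size estimate needs.
  · have hmin : ((min nX nY : ℕ) : ℝ) ≤ ((nX : ℝ) + nY) / 2 := by
      have e1 : ((min nX nY : ℕ) : ℝ) ≤ nX := by exact_mod_cast min_le_left _ _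
      have e2 : ((min nX nY : ℕ) : ℝ) ≤ nY := by exact_mod_cast min_le_right _ _
      linarith
    have hdz : -((min nX nY : ℕ) : ℝ) < dD * z.re := by
      rw [div_lt_iff₀ hdD0] at h1; linarith
    have hγ : 0 ≤ dD * z.re + ((nX : ℝ) + nY) / 2 := by linarith
    have hβ : dD * z.re - ((d : ℝ) - nX - nY) / 2 ≤ -(dD * δ) := by
      rw [← hcrit, ← mul_sub, ← mul_neg]; gcongr; linarith
    have hzl : -((nX : ℝ) + nY) ≤ z.re := by
      by_contra hc
      push Not at hc
      have : dD * z.re ≤ 1 * z.re := mul_le_mul_of_nonpos_right hdD1 (by linarith)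
      linarith
    have htarget : |lam| ^ (-((dD : ℝ) / d) * z.re - ((nX : ℝ) + nY) / (2 * d)) =
        L ^ (-(dD * z.re + ((nX : ℝ) + nY) / 2)) := by
      rw [hLpow]; congr 1; field_simp; ring
    refine key _ (g + 1) (by positivity) (by linarith) ?_ hγ ?_
    · rw [abs_le]
      constructor <;> linarith [abs_nonneg M]
    · have hsum := DampedOIO.sum_dyadic_rpow_le_of_neg hR0 hL0 ha hβ hN2
      rw [← hg] at hsum
      have hrem : (R / 2 ^ N) ^ (dD * z.re + ((nX : ℝ) + nY) / 2) ≤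
          L ^ (-(dD * z.re + ((nX : ℝ) + nY) / 2)) := by
        rw [Real.rpow_neg hL0.le, ← Real.inv_rpow hL0.le]
        exact Real.rpow_le_rpow hrN.le hN1 hγ
      -- At the scale `1 / L` the oscillatory and the size bounds coincide, so the sum and the
      -- remainder have the same order.
      have hprod : |lam| ^ (-(1 / 2) : ℝ) * L ^ (-(dD * z.re - ((d : ℝ) - nX - nY) / 2)) =
          L ^ (-(dD * z.re + ((nX : ℝ) + nY) / 2)) := by
        rw [hhalf, ← Real.rpow_add hL0]; congr 1; ring
      rw [htarget]
      calc _ ≤ |lam| ^ (-(1 / 2) : ℝ) *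
            (L ^ (-(dD * z.re - ((d : ℝ) - nX - nY) / 2)) * g) +
            L ^ (-(dD * z.re + ((nX : ℝ) + nY) / 2)) := by gcongr
        _ = (g + 1) * L ^ (-(dD * z.re + ((nX : ℝ) + nY) / 2)) := by
          rw [← mul_assoc, hprod]; ring
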